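/- Let $d\ge 1$ and let $\{\varepsilon_i,\ i\in\mathbb{Z}^d\}$ be i.i.d. real random variables with mean $0$ and variance $\sigma^2\in(0,\infty)$. Let $\{a_i,\ i\in\mathbb{Z}^d\}$ be real numbers and let $X_j=\sum_{i\in\mathbb{Z}^d}a_i\varepsilon_{j-i}$, $j\in\mathbb{Z}^d$ (convergence in mean square), be the associated linear random field. Assume that the field has either (i) short memory: $\sum_{i}|a_i|<\infty$ and $\sum_i a_i\neq 0$; or (ii) long memory: $a_i=l(|i|)\,b(i/|i|)\,|i|^{-\alpha}$ for all $i\ne 0$, where $|\cdot|$ is the Euclidean norm, $\alpha\in(d/2,d)$, $l:[1,\infty)\to\mathbb{R}$ is measurable and slowly varying at infinity, i.e. $l(cx)/l(x)\to1$ as $x\to\infty$ for every $c>0$, and $b$ is a continuous function on the unit sphere of $\mathbb{R}^d$ that is not identically zero. Suppose that there are constants $H,C>0$ such that, for complex $z$ in the disc $|z|<H$, $\mathbb{E}|e^{z\varepsilon_0}|<\infty$ and the cumulant generating function $L(z)=\log\mathbb{E}e^{z\varepsilon_0}$ (the analytic logarithm with $L(0)=0$) is analytic and satisfies $|L(z)|<C$.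 For $n\ge1$ let $\Gamma_n^d=[-n,n]^d\cap\mathbb{Z}^d$, $S_n=\sum_{j\in\Gamma_n^d}X_j$, $b_{nj}=\sum_{i\in\Gamma_n^d}a_{i-j}$, $B_n=\sigma^2\sum_{j\in\mathbb{Z}^d}b_{nj}^2$, $F_n(x)=P(S_n<x\sqrt{B_n})$, and let $\Phi$ be the standard normal distribution function. Then there are real coefficients $\beta_{kn}$ $(k\ge0,\ n\ge1)$, depending only on the cumulants of $\varepsilon_0$ and on the coefficients $(a_i)$, such that the power series $\lambda_n(t)=\sum_{k=0}^\infty\beta_{kn}t^k$ converge and are bounded uniformly in $n\ge 1$ on some disc $|t|<r$, $r>0$, and such that for all $x\ge0$ with $x=o(n^{d/2})$, $$\frac{1-F_n(x)}{1-\Phi(x)}=\exp\left\{\frac{x^3}{n^{d/2}}\lambda_n\Big(\frac{x}{n^{d/2}}\Big)\right\}\left(1+O\Big(\frac{x+1}{n^{d/2}}\Big)\right)\qquad(n\to\infty),$$ that is, for every sequence $c_n=o(n^{d/2})$ the error bound holds, with one constant, for all sufficiently large $n$ and all $x\in[0,c_n]$. -/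

import Mathlib

open MeasureTheory ProbabilityTheory Filter Topology Asymptotics

noncomputable section

namespace LinearRandomField

/-- The discrete cube `[-n, n]^d ∩ ℤ^d`. -/
def cube (d n : ℕ) : Finset (Fin d → ℤ) :=
  Finset.Icc (fun _ => -(n : ℤ)) (fun _ => (n : ℤ))

/-- A lattice point seen as a vector of Euclidean space (so that `‖latticePoint i‖` is the
Euclidean norm of `i`). -/
def latticePoint {d : ℕ} (i : Fin d → ℤ) : EuclideanSpace ℝ (Fin d) :=
  WithLp.toLp 2 (fun k => (i k : ℝ))

/-- Short memory: `∑ |a_i| < ∞` and `∑ a_i ≠ 0`. -/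
def ShortMemory {d : ℕ} (a : (Fin d → ℤ) → ℝ) : Prop :=
  Summable (fun i => |a i|) ∧ ∑' i, a i ≠ 0

/-- A function `l : [1, ∞) → ℝ` (extended arbitrarily to `ℝ`) that is measurable and slowly
varying at infinity. -/
def SlowlyVarying (l : ℝ → ℝ) : Prop :=
  Measurable ((Set.Ici (1 : ℝ)).domRestrict l) ∧
    ∀ c : ℝ, 0 < c → Tendsto (fun x => l (c * x) / l x) atTop (𝓝 1)

/-- Long memory: `a_i = l(|i|) b(i/|i|) |i|^{-α}` for `i ≠ 0`, with `α ∈ (d/2, d)`, `l` slowly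
varying at infinity and `b` a continuous function on the unit sphere, not identically zero. -/
def LongMemory {d : ℕ} (a : (Fin d → ℤ) → ℝ) : Prop :=
  ∃ (α : ℝ) (l : ℝ → ℝ) (b : EuclideanSpace ℝ (Fin d) → ℝ),
    (d : ℝ) / 2 < α ∧ α < d ∧ SlowlyVarying l ∧
    ContinuousOn b (Metric.sphere 0 1) ∧ (∃ u ∈ Metric.sphere 0 1, b u ≠ 0) ∧
    ∀ i : Fin d → ℤ, i ≠ 0 →
      a i = l ‖latticePoint i‖ * b (‖latticePoint i‖⁻¹ • latticePoint i)
        * ‖latticePoint i‖ ^ (-α)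

/-- `L` is the cumulant generating function `log 𝔼 exp (z Y)` of `Y` on the disc `|z| < H`:
the exponential moments are finite there and `L` is the analytic logarithm of
`z ↦ 𝔼 exp (z Y)` on the disc normalized by `L 0 = 0`. -/
structure IsCGFOnDisc {Ω : Type*} [MeasurableSpace Ω] (L : ℂ → ℂ) (Y : Ω → ℝ) (μ : Measure Ω)
    (H : ℝ) : Prop where
  integrable : ∀ z ∈ Metric.ball (0 : ℂ) H, Integrable (fun ω => Complex.exp (z * Y ω)) μ
  analytic : AnalyticOnNhd ℂ L (Metric.ball (0 : ℂ) H)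
  map_zero : L 0 = 0
  exp_eq : ∀ z ∈ Metric.ball (0 : ℂ) H, Complex.exp (L z) = complexMGF Y μ z

/-- The cumulant of order `k`: the `k`-th derivative at `0` of the cumulant generating function. -/
def cumulant {Ω : Type*} [MeasurableSpace Ω] (Y : Ω → ℝ) (μ : Measure Ω) (k : ℕ) : ℝ :=
  iteratedDeriv k (cgf Y μ) 0

/-- `X` is the linear random field `X_j = ∑_i a_i ε_{j-i}`, the series being the (unconditional)
limit of its finite partial sums in mean square. -/
def IsLinearField {Ω : Type*} [MeasurableSpace Ω] {d : ℕ} (X : (Fin d → ℤ) → Ω → ℝ)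
    (a : (Fin d → ℤ) → ℝ) (ε : (Fin d → ℤ) → Ω → ℝ) (μ : Measure Ω) : Prop :=
  ∀ j, AEMeasurable (X j) μ ∧
    Tendsto (fun s : Finset (Fin d → ℤ) =>
      eLpNorm (fun ω => X j ω - ∑ i ∈ s, a i * ε (j - i) ω) 2 μ) atTop (𝓝 0)

/-- `S_n = ∑_{j ∈ [-n,n]^d} X_j`. -/
def partialSum {Ω : Type*} {d : ℕ} (X : (Fin d → ℤ) → Ω → ℝ) (n : ℕ) (ω : Ω) : ℝ :=
  ∑ j ∈ cube d n, X j ω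

/-- `b_{nj} = ∑_{i ∈ [-n,n]^d} a_{i-j}`. -/
def coeffSum {d : ℕ} (a : (Fin d → ℤ) → ℝ) (n : ℕ) (j : Fin d → ℤ) : ℝ :=
  ∑ i ∈ cube d n, a (i - j)

/-- `B_n = σ² ∑_j b_{nj}²`. -/
def sumVar {d : ℕ} (a : (Fin d → ℤ) → ℝ) (σ : ℝ) (n : ℕ) : ℝ :=
  σ ^ 2 * ∑' j, coeffSum a n j ^ 2

/-- `F_n(x) = P(S_n < x √B_n)`. -/
def normDist {Ω : Type*} [MeasurableSpace Ω] {d : ℕ} (X : (Fin d → ℤ) → Ω → ℝ)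
    (a : (Fin d → ℤ) → ℝ) (σ : ℝ) (μ : Measure Ω) (n : ℕ) (x : ℝ) : ℝ :=
  μ.real {ω | partialSum X n ω < x * √(sumVar a σ n)}

/-- The standard normal distribution function. -/
def Phi (x : ℝ) : ℝ := cdf (gaussianReal 0 1) x

/-- The real number `n^{d/2}`. -/
def rate (d n : ℕ) : ℝ := (n : ℝ) ^ ((d : ℝ) / 2)

end LinearRandomField

end

noncomputable section

namespace LinearRandomField

/-! ### Cauchy estimates and Taylor remainders -/

/-! Put `Δ = n^{d/2}` and `W = S_n / √B_n = ∑ c_k ε_k`, with `c_k = b_{nk} / √B_n`. Then `∑ c_k² =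
1/σ²`, and the whole dependence on the memory of the field is contained in one estimate: `|c_k| ≤ k₀
/ Δ` with `k₀` independent of `n` (`exists_normalized_coeffSum_le`). For short memory, `|b_{nj}|` is
at most `∑ |a_i|` everywhere and bounded below on about `n^d` indices. For long memory, Potter's
bounds give `|b_{nj}| = O(|l(n)| n^{d-α})`, and a cube of indices at distance of order `n`, placed
in a direction where `b` does not vanish, gives a lower bound of the same order at `n^d` points.

Since `L(z) = σ² z² / 2 + O(z³)`, summing over `k` yields `log 𝔼 exp (z W) = z² / 2 + Δ² E_n(z /
Δ)`, where `E_n` is holomorphic on a disc of radius `R` and satisfies `|E_n(s)| ≤ A |s|³`, with `A`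
and `R` free of `n` (`cubicRemainder_scaledRemainder`, `IsInnovation.hasCubicCGF_map`). This is the
shape of the cumulant generating function of a normalised sum of `Δ²` i.i.d. variables, so Cramér's
argument applies, uniformly in `n`.

For `x = Δ t`, tilt the law of `W` by `exp (Δ p w)`, where `p + E'(p) = t`. The tilted law has mean
`x` and standard deviation `s`, with `s² = 1 + E''(p)`. Undoing the tilt writes `P(W ≥ x) / (1 -
Φ(x))` exactly as `exp (Δ² q(t))` times a ratio of a Laplace integral to a Mills ratio, where `q(t)
= E(p) + (p - t)² / 2` (`IsSaddle.measure_Ici_div`). A Berry–Esseen inequality for intervals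
replaces the standardised tilted law by the normal law at cost `O(1/Δ)`. The Mills ratio at `x` is
at least a constant over `1 + x`, so the relative error is `O((x + 1)/Δ)`
(`exists_cramer_of_hasCubicCGF`).

Finally `q` is holomorphic, real on the real axis and `O(t³)`. The series `λ_n(t) = q(t) / t³`
therefore has real coefficients, and Cauchy's estimates bound it uniformly in `n`. These
coefficients are built from the Taylor series of `L`, that is, from the cumulants, and from `a`. -/

/-- Cauchy's estimate on the circle of centre `w` and radius `‖w‖`, on which `‖f‖ ≤ A (2‖w‖)^(k+1)`:
the order of vanishing drops by exactly one. -/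
theorem norm_deriv_le_of_norm_le_pow {f : ℂ → ℂ} {A R : ℝ} {k : ℕ}
    (hf : DifferentiableOn ℂ f (Metric.ball 0 R))
    (hA : ∀ z ∈ Metric.ball (0 : ℂ) R, ‖f z‖ ≤ A * ‖z‖ ^ (k + 1)) :
    ∀ z ∈ Metric.ball (0 : ℂ) (R / 2), ‖deriv f z‖ ≤ 2 ^ (k + 1) * A * ‖z‖ ^ k := by
  intro z hz
  rw [mem_ball_zero_iff] at hz
  have hR : 0 < R := by linarith [norm_nonneg z]
  have key : ∀ w : ℂ, w ≠ 0 → ‖w‖ < R / 2 → ‖deriv f w‖ ≤ 2 ^ (k + 1) * A * ‖w‖ ^ k := by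
    intro w hw hwR
    have hw0 : 0 < ‖w‖ := norm_pos_iff.2 hw
    have hsub : Metric.closedBall w ‖w‖ ⊆ Metric.ball 0 R := by
      intro y hy
      rw [mem_closedBall_iff_norm] at hy
      rw [mem_ball_zero_iff]
      calc ‖y‖ = ‖(y - w) + w‖ := by simp
        _ ≤ ‖y - w‖ + ‖w‖ := norm_add_le _ _
        _ < R := by linarith
    have hA0 : 0 ≤ A := by
      have h1 := hA w (by rw [mem_ball_zero_iff]; linarith)
      have h2 : 0 ≤ A * ‖w‖ ^ (k + 1) := (norm_nonneg _).trans h1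
      exact nonneg_of_mul_nonneg_left h2 (by positivity)
    have := Complex.norm_deriv_le_of_forall_mem_sphere_norm_le (c := w) (R := ‖w‖)
      (C := A * (2 * ‖w‖) ^ (k + 1)) hw0
      ((hf.mono (Metric.closure_ball_subset_closedBall.trans hsub)).diffContOnCl) (fun y hy => by
        have hy' := Metric.sphere_subset_closedBall hy
        have h1 := hA y (hsub hy')
        refine h1.trans ?_
        have h2 : ‖y‖ ≤ 2 * ‖w‖ := by
          rw [mem_closedBall_iff_norm] at hy'
          calc ‖y‖ = ‖(y - w) + w‖ := by simp
            _ ≤ ‖y - w‖ + ‖w‖ := norm_add_le _ _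
            _ ≤ 2 * ‖w‖ := by linarith
        gcongr)
    refine this.trans_eq ?_
    field_simp
    ring
  -- At the origin the circle degenerates, and the inequality is obtained as a limit from the
  -- punctured disc.
  by_cases hz0 : z = 0
  · subst hz0
    have hc : ContinuousAt (fun w => ‖deriv f w‖ - 2 ^ (k + 1) * A * ‖w‖ ^ k) (0 : ℂ) := by
      have : ContinuousAt (deriv f) 0 :=
        ((hf.deriv Metric.isOpen_ball).continuousOn).continuousAt
          (Metric.ball_mem_nhds 0 hR)
      exact this.norm.sub (by fun_prop)
    have hle : ∀ᶠ w in 𝓝[≠] (0 : ℂ), ‖deriv f w‖ - 2 ^ (k + 1) * A * ‖w‖ ^ k ≤ 0 := by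
      have hb : ∀ᶠ w in 𝓝 (0 : ℂ), w ∈ Metric.ball (0 : ℂ) (R / 2) :=
        Metric.ball_mem_nhds 0 (by linarith)
      filter_upwards [self_mem_nhdsWithin, hb.filter_mono nhdsWithin_le_nhds] with w hw hwb
      rw [mem_ball_zero_iff] at hwb
      linarith [key w hw hwb]
    have := le_of_tendsto (hc.tendsto.mono_left nhdsWithin_le_nhds) hle
    linarith
  · exact key z hz0 hz

/-- The mean value inequality on the closed disc of radius `‖z‖`; repeated use turns a bound on a
top derivative into a Taylor remainder. -/
theorem norm_le_pow_of_norm_deriv_le {f : ℂ → ℂ} {A R : ℝ} {k : ℕ} (hA0 : 0 ≤ A)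
    (hf : DifferentiableOn ℂ f (Metric.ball 0 R)) (h0 : f 0 = 0)
    (hA : ∀ z ∈ Metric.ball (0 : ℂ) R, ‖deriv f z‖ ≤ A * ‖z‖ ^ k) :
    ∀ z ∈ Metric.ball (0 : ℂ) R, ‖f z‖ ≤ A * ‖z‖ ^ (k + 1) := by
  intro z hz
  rw [mem_ball_zero_iff] at hz
  have hsub : ∀ y ∈ Metric.closedBall (0 : ℂ) ‖z‖, y ∈ Metric.ball (0 : ℂ) R := by
    intro y hy
    rw [mem_closedBall_zero_iff] at hy
    rw [mem_ball_zero_iff]; linarith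
  have := Convex.norm_image_sub_le_of_norm_deriv_le (𝕜 := ℂ) (f := f)
    (s := Metric.closedBall 0 ‖z‖) (x := 0) (y := z) (C := A * ‖z‖ ^ k)
    (fun y hy => hf.differentiableAt (Metric.isOpen_ball.mem_nhds (hsub y hy)))
    (fun y hy => (hA y (hsub y hy)).trans (by
      rw [mem_closedBall_zero_iff] at hy; gcongr))
    (convex_closedBall 0 ‖z‖) (by simp) (by simp)
  rw [h0, sub_zero, sub_zero] at this
  exact this.trans_eq (by ring)

/-- `E` is holomorphic on the disc of radius `R`, is `O(z^3)` there and is real on the real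
axis. -/
structure CubicRemainder (E : ℂ → ℂ) (A R : ℝ) : Prop where
  pos_const : 0 < A
  pos_radius : 0 < R
  differentiableOn : DifferentiableOn ℂ E (Metric.ball 0 R)
  norm_le : ∀ z ∈ Metric.ball (0 : ℂ) R, ‖E z‖ ≤ A * ‖z‖ ^ 3
  conj : ∀ z, E (starRingEnd ℂ z) = starRingEnd ℂ (E z)

namespace CubicRemainder

variable {E : ℂ → ℂ} {A R : ℝ}

theorem deriv_conj (h : CubicRemainder E A R) (z : ℂ) :
    deriv E (starRingEnd ℂ z) = starRingEnd ℂ (deriv E z) := by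
  have h1 : (⇑(starRingEnd ℂ) ∘ E ∘ ⇑(starRingEnd ℂ)) = E := by
    funext w; simp [h.conj]
  have h2 := congrFun (deriv_conj_conj (f := E)) (starRingEnd ℂ z)
  rw [h1] at h2
  simpa using h2

theorem deriv2_conj (h : CubicRemainder E A R) (z : ℂ) :
    deriv (deriv E) (starRingEnd ℂ z) = starRingEnd ℂ (deriv (deriv E) z) := by
  have h1 : (⇑(starRingEnd ℂ) ∘ deriv E ∘ ⇑(starRingEnd ℂ)) = deriv E := by
    funext w; simp [h.deriv_conj]
  have h2 := congrFun (deriv_conj_conj (f := deriv E)) (starRingEnd ℂ z)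
  rw [h1] at h2
  simpa using h2

theorem differentiableOn_deriv (h : CubicRemainder E A R) :
    DifferentiableOn ℂ (deriv E) (Metric.ball 0 R) :=
  h.differentiableOn.deriv Metric.isOpen_ball

theorem differentiableOn_deriv2 (h : CubicRemainder E A R) :
    DifferentiableOn ℂ (deriv (deriv E)) (Metric.ball 0 R) :=
  h.differentiableOn_deriv.deriv Metric.isOpen_ball

theorem norm_deriv_le (h : CubicRemainder E A R) {z : ℂ} (hz : ‖z‖ < R / 2) :
    ‖deriv E z‖ ≤ 8 * A * ‖z‖ ^ 2 := by
  have := norm_deriv_le_of_norm_le_pow h.differentiableOn h.norm_le z (by simpa using hz)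
  norm_num at this
  exact this

theorem norm_deriv2_le (h : CubicRemainder E A R) {z : ℂ} (hz : ‖z‖ < R / 4) :
    ‖deriv (deriv E) z‖ ≤ 32 * A * ‖z‖ := by
  have := norm_deriv_le_of_norm_le_pow (R := R / 2) (A := 8 * A) (k := 1)
    (h.differentiableOn_deriv.mono (Metric.ball_subset_ball (by linarith [h.pos_radius])))
    (fun z hz => h.norm_deriv_le (by simpa using hz)) z (by rw [mem_ball_zero_iff]; linarith)
  refine this.trans_eq (by ring)

theorem norm_deriv3_le (h : CubicRemainder E A R) {z : ℂ} (hz : ‖z‖ < R / 8) :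
    ‖deriv (deriv (deriv E)) z‖ ≤ 64 * A := by
  have := norm_deriv_le_of_norm_le_pow (R := R / 4) (A := 32 * A) (k := 0)
    (h.differentiableOn_deriv2.mono (Metric.ball_subset_ball (by linarith [h.pos_radius])))
    (fun z hz => by simpa using h.norm_deriv2_le (by simpa using hz)) z
    (by rw [mem_ball_zero_iff]; linarith)
  refine this.trans_eq (by ring)

/-- Second order Taylor expansion of `E` around a point of a small disc. -/
theorem norm_taylor_le (h : CubicRemainder E A R) {p w : ℂ} (hp : ‖p‖ ≤ R / 16)
    (hw : ‖w‖ < R / 16) :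
    ‖E (p + w) - E p - w * deriv E p - w ^ 2 / 2 * deriv (deriv E) p‖ ≤ 64 * A * ‖w‖ ^ 3 := by
  have hR := h.pos_radius
  have hA := h.pos_const
  have hmem : ∀ y ∈ Metric.ball (0 : ℂ) (R / 16), ‖p + y‖ < R / 8 := by
    intro y hy
    rw [mem_ball_zero_iff] at hy
    linarith [norm_add_le p y]
  have hd : ∀ (g : ℂ → ℂ), DifferentiableOn ℂ g (Metric.ball 0 R) →
      ∀ y ∈ Metric.ball (0 : ℂ) (R / 16), HasDerivAt (fun y => g (p + y)) (deriv g (p + y)) y := by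
    intro g hg y hy
    have hgd : HasDerivAt g (deriv g (p + y)) (p + y) :=
      (hg.differentiableAt (Metric.isOpen_ball.mem_nhds (by
        rw [mem_ball_zero_iff]; linarith [hmem y hy]))).hasDerivAt
    exact hgd.comp_const_add p y
  have hw' : w ∈ Metric.ball (0 : ℂ) (R / 16) := by simpa using hw
  have d2 : ∀ y ∈ Metric.ball (0 : ℂ) (R / 16),
      HasDerivAt (fun y => deriv (deriv E) (p + y) - deriv (deriv E) p)
        (deriv (deriv (deriv E)) (p + y)) y := fun y hy =>
    (hd _ h.differentiableOn_deriv2 y hy).sub_const _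
  -- The bound `64 A` on the third derivative is integrated three times from `w = 0`: `s2`, `s1`,
  -- then the conclusion.
  have s2 := norm_le_pow_of_norm_deriv_le (k := 0) (A := 64 * A) (R := R / 16)
    (f := fun y => deriv (deriv E) (p + y) - deriv (deriv E) p) (by positivity)
    (fun y hy => (d2 y hy).differentiableAt.differentiableWithinAt) (by simp)
    (fun y hy => by
      rw [(d2 y hy).deriv]; simpa using h.norm_deriv3_le (hmem y hy))
  have d1 : ∀ y ∈ Metric.ball (0 : ℂ) (R / 16),
      HasDerivAt (fun y => deriv E (p + y) - deriv E p - y * deriv (deriv E) p)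
        (deriv (deriv E) (p + y) - deriv (deriv E) p) y := fun y hy => by
    simpa using ((hd _ h.differentiableOn_deriv y hy).sub_const (deriv E p)).fun_sub
      ((hasDerivAt_id' y).mul_const (deriv (deriv E) p))
  have s1 := norm_le_pow_of_norm_deriv_le (k := 1) (A := 64 * A) (R := R / 16)
    (f := fun y => deriv E (p + y) - deriv E p - y * deriv (deriv E) p) (by positivity)
    (fun y hy => (d1 y hy).differentiableAt.differentiableWithinAt) (by simp)
    (fun y hy => by rw [(d1 y hy).deriv]; exact s2 y hy)
  have d0 : ∀ y ∈ Metric.ball (0 : ℂ) (R / 16),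
      HasDerivAt (fun y => E (p + y) - E p - y * deriv E p - y ^ 2 / 2 * deriv (deriv E) p)
        (deriv E (p + y) - deriv E p - y * deriv (deriv E) p) y := fun y hy => by
    have h1 := (((hd _ h.differentiableOn y hy).sub_const (E p)).sub
      ((hasDerivAt_id y).mul_const (deriv E p))).sub
      (((hasDerivAt_pow 2 y).div_const 2).mul_const (deriv (deriv E) p))
    refine h1.congr_deriv ?_
    norm_num
  exact norm_le_pow_of_norm_deriv_le (k := 2) (A := 64 * A) (R := R / 16)
    (f := fun y => E (p + y) - E p - y * deriv E p - y ^ 2 / 2 * deriv (deriv E) p) (by positivity)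
    (fun y hy => (d0 y hy).differentiableAt.differentiableWithinAt) (by simp)
    (fun y hy => by rw [(d0 y hy).deriv]; exact s1 y hy) w hw'

end CubicRemainder

/-! ### The saddle point and the remainder of the Legendre transform -/

/-- The solution `p` of `p + E' p = t` close to `0`, obtained by iteration. -/
def saddle (E : ℂ → ℂ) (t : ℂ) : ℂ :=
  limUnder atTop fun m : ℕ => (fun p => t - deriv E p)^[m] 0

/-- With `p` the saddle point, `(p ^ 2 / 2 + E p) - t p + t ^ 2 / 2`. -/
def legendreRemainder (E : ℂ → ℂ) (t : ℂ) : ℂ :=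
  E (saddle E t) + (saddle E t - t) ^ 2 / 2

/-- The Taylor coefficients at `0` of `legendreRemainder E t / t ^ 3`. -/
def cramerCoeff (E : ℂ → ℂ) (k : ℕ) : ℝ :=
  (iteratedDeriv (k + 3) (legendreRemainder E) 0).re / (k + 3).factorial

namespace CubicRemainder

variable {E : ℂ → ℂ} {A R : ℝ}

/-- The radius of the disc in which the saddle point lies. -/
def saddleRadius (A R : ℝ) : ℝ := min (R / 16) (1 / (64 * A))

theorem saddleRadius_pos (h : CubicRemainder E A R) : 0 < saddleRadius A R :=
  lt_min (by linarith [h.pos_radius]) (by have := h.pos_const; positivity)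

theorem saddleRadius_le (A R : ℝ) : saddleRadius A R ≤ R / 16 := min_le_left _ _

theorem mul_saddleRadius_le (h : CubicRemainder E A R) : 64 * A * saddleRadius A R ≤ 1 := by
  have hA := h.pos_const
  calc 64 * A * saddleRadius A R ≤ 64 * A * (1 / (64 * A)) := by
        gcongr; exact min_le_right _ _
    _ = 1 := by field_simp

theorem norm_deriv_le_div (h : CubicRemainder E A R) {z : ℂ} (hz : ‖z‖ ≤ saddleRadius A R) :
    ‖deriv E z‖ ≤ ‖z‖ / 8 := by
  have hA := h.pos_const
  have h1 := h.norm_deriv_le (z := z) (by linarith [saddleRadius_le A R, h.pos_radius])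
  have h2 : 64 * A * ‖z‖ ≤ 1 := by
    refine le_trans ?_ h.mul_saddleRadius_le
    gcongr
  nlinarith [norm_nonneg z]

/-- The term `1 / (64 A)` in `saddleRadius` is there for this bound, which makes `p ↦ t - E'(p)` a
contraction of ratio `1/2` on the disc. -/
theorem norm_deriv2_le_half (h : CubicRemainder E A R) {z : ℂ} (hz : ‖z‖ ≤ saddleRadius A R) :
    ‖deriv (deriv E) z‖ ≤ 1 / 2 := by
  have hA := h.pos_const
  have h1 := h.norm_deriv2_le (z := z) (by linarith [saddleRadius_le A R, h.pos_radius])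
  have h2 : 64 * A * ‖z‖ ≤ 1 := by
    refine le_trans ?_ h.mul_saddleRadius_le
    gcongr
  linarith

theorem norm_deriv_sub_le (h : CubicRemainder E A R) {z w : ℂ} (hz : ‖z‖ ≤ saddleRadius A R)
    (hw : ‖w‖ ≤ saddleRadius A R) : ‖deriv E w - deriv E z‖ ≤ 1 / 2 * ‖w - z‖ := by
  refine Convex.norm_image_sub_le_of_norm_deriv_le (𝕜 := ℂ)
    (s := Metric.closedBall 0 (saddleRadius A R)) (fun y hy => ?_) (fun y hy => ?_)
    (convex_closedBall _ _) (by simpa using hz) (by simpa using hw)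
  · refine h.differentiableOn_deriv.differentiableAt (Metric.isOpen_ball.mem_nhds ?_)
    rw [mem_closedBall_zero_iff] at hy
    rw [mem_ball_zero_iff]
    linarith [saddleRadius_le A R, h.pos_radius]
  · exact h.norm_deriv2_le_half (by simpa using hy)

/-- If `‖p‖ ≤ 2‖t‖`, then `‖E'(p)‖ ≤ ‖t‖ / 4`, so the iteration never leaves the disc of radius
`2‖t‖`. -/
theorem norm_iterate_le (h : CubicRemainder E A R) {t : ℂ} (ht : ‖t‖ < saddleRadius A R / 2)
    (m : ℕ) : ‖(fun p => t - deriv E p)^[m] 0‖ ≤ 2 * ‖t‖ := by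
  induction m with
  | zero => simp
  | succ m ih =>
    rw [Function.iterate_succ_apply']
    have := h.norm_deriv_le_div (z := (fun p => t - deriv E p)^[m] 0) (by linarith)
    calc _ ≤ ‖t‖ + ‖deriv E ((fun p => t - deriv E p)^[m] 0)‖ := norm_sub_le _ _
      _ ≤ 2 * ‖t‖ := by linarith [norm_nonneg t]

theorem dist_iterate_le (h : CubicRemainder E A R) {t : ℂ} (ht : ‖t‖ < saddleRadius A R / 2)
    (m : ℕ) : dist ((fun p => t - deriv E p)^[m] 0) ((fun p => t - deriv E p)^[m + 1] 0) ≤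
      2 * ‖t‖ * (1 / 2) ^ m := by
  induction m with
  | zero => simpa [dist_eq_norm, norm_sub_rev] using h.norm_iterate_le ht 1
  | succ m ih =>
    rw [Function.iterate_succ_apply' _ (m + 1), Function.iterate_succ_apply' _ m, dist_eq_norm]
    rw [Function.iterate_succ_apply' _ m, dist_eq_norm] at ih
    have h1 := h.norm_iterate_le ht m
    have h2 := h.norm_iterate_le ht (m + 1)
    rw [Function.iterate_succ_apply' _ m] at h2
    have := h.norm_deriv_sub_le (z := (fun p => t - deriv E p)^[m] 0) (by linarith)
      (w := t - deriv E ((fun p => t - deriv E p)^[m] 0)) (by linarith)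
    have e : ∀ a b : ℂ, (t - a) - (t - b) = b - a := fun a b => by ring
    simp only [e]
    refine this.trans ?_
    rw [norm_sub_rev] at ih
    rw [pow_succ]
    linarith

theorem tendsto_saddle (h : CubicRemainder E A R) {t : ℂ} (ht : ‖t‖ < saddleRadius A R / 2) :
    Tendsto (fun m : ℕ => (fun p => t - deriv E p)^[m] 0) atTop (𝓝 (saddle E t)) :=
  (cauchySeq_of_le_geometric (1 / 2) (2 * ‖t‖) (by norm_num) (h.dist_iterate_le ht)).tendsto_limUnder

theorem norm_saddle_le (h : CubicRemainder E A R) {t : ℂ} (ht : ‖t‖ < saddleRadius A R / 2) :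
    ‖saddle E t‖ ≤ 2 * ‖t‖ :=
  le_of_tendsto (h.tendsto_saddle ht).norm (Eventually.of_forall (h.norm_iterate_le ht))

theorem saddle_mem (h : CubicRemainder E A R) {t : ℂ} (ht : ‖t‖ < saddleRadius A R / 2) :
    ‖saddle E t‖ < saddleRadius A R := by linarith [h.norm_saddle_le ht]

theorem saddle_eq (h : CubicRemainder E A R) {t : ℂ} (ht : ‖t‖ < saddleRadius A R / 2) :
    saddle E t = t - deriv E (saddle E t) := by
  have h1 := (h.tendsto_saddle ht).comp (tendsto_add_atTop_nat 1)
  have hc : ContinuousAt (fun p => t - deriv E p) (saddle E t) := by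
    refine continuousAt_const.sub ?_
    refine h.differentiableOn_deriv.continuousOn.continuousAt (Metric.isOpen_ball.mem_nhds ?_)
    rw [mem_ball_zero_iff]
    linarith [saddleRadius_le A R, h.pos_radius, h.saddle_mem ht]
  have h2 := hc.tendsto.comp (h.tendsto_saddle ht)
  refine tendsto_nhds_unique h1 (h2.congr fun m => ?_)
  simp only [Function.comp, Function.iterate_succ_apply']

theorem saddle_conj (h : CubicRemainder E A R) {t : ℂ} (ht : ‖t‖ < saddleRadius A R / 2) :
    saddle E (starRingEnd ℂ t) = starRingEnd ℂ (saddle E t) := by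
  have h1 := h.tendsto_saddle (t := starRingEnd ℂ t) (by simpa using ht)
  have h2 := (Complex.continuous_conj.tendsto _).comp (h.tendsto_saddle ht)
  refine tendsto_nhds_unique h1 (h2.congr fun m => ?_)
  simp only [Function.comp]
  induction m with
  | zero => simp
  | succ m ih =>
    simp only [Function.iterate_succ_apply', ← ih, h.deriv_conj, map_sub]

/-- Each iterate is holomorphic in `t`, and the geometric error bound is uniform on the disc, so
Weierstrass' theorem applies to the limit. -/
theorem differentiableOn_saddle (h : CubicRemainder E A R) :
    DifferentiableOn ℂ (saddle E) (Metric.ball 0 (saddleRadius A R / 2)) := by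
  have hpos := h.saddleRadius_pos
  refine TendstoLocallyUniformlyOn.differentiableOn (φ := atTop)
    (F := fun (m : ℕ) t => (fun p => t - deriv E p)^[m] 0) ?_ (Eventually.of_forall fun m => ?_)
    Metric.isOpen_ball
  · refine TendstoUniformlyOn.tendstoLocallyUniformlyOn ?_
    rw [Metric.tendstoUniformlyOn_iff]
    intro ε hε
    have hlim : Tendsto (fun m : ℕ => saddleRadius A R * (1 / 2 : ℝ) ^ m / (1 - 1 / 2)) atTop
        (𝓝 0) := by
      have := (tendsto_pow_atTop_nhds_zero_of_lt_one (r := (1 / 2 : ℝ)) (by norm_num)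
        (by norm_num)).const_mul (saddleRadius A R)
      simpa using this.div_const (1 - 1 / 2 : ℝ)
    filter_upwards [hlim.eventually_lt_const hε] with m hm t ht
    rw [mem_ball_zero_iff] at ht
    rw [dist_comm]
    refine lt_of_le_of_lt ?_ hm
    refine (dist_le_of_le_geometric_of_tendsto (1 / 2) (2 * ‖t‖) (by norm_num)
      (h.dist_iterate_le ht) (h.tendsto_saddle ht) m).trans ?_
    gcongr
    linarith
  · induction m with
    | zero => simp
    | succ m ih =>
      simp only [Function.iterate_succ_apply']
      refine differentiableOn_id.sub (h.differentiableOn_deriv.comp ih fun t ht => ?_)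
      rw [mem_ball_zero_iff] at ht ⊢
      linarith [saddleRadius_le A R, h.pos_radius, h.norm_iterate_le ht m]

theorem differentiableOn_legendreRemainder (h : CubicRemainder E A R) :
    DifferentiableOn ℂ (legendreRemainder E) (Metric.ball 0 (saddleRadius A R / 2)) := by
  refine (h.differentiableOn.comp h.differentiableOn_saddle fun t ht => ?_).add
    (((h.differentiableOn_saddle.sub differentiableOn_id).pow 2).div_const 2)
  rw [mem_ball_zero_iff] at ht ⊢
  linarith [saddleRadius_le A R, h.pos_radius, h.saddle_mem ht]

theorem norm_saddle_sub_le (h : CubicRemainder E A R) {t : ℂ}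
    (ht : ‖t‖ < saddleRadius A R / 2) : ‖saddle E t - t‖ ≤ 32 * A * ‖t‖ ^ 2 := by
  have hA := h.pos_const
  have hm := h.saddle_mem ht
  have e : saddle E t - t = - deriv E (saddle E t) := by
    linear_combination h.saddle_eq ht
  rw [e, norm_neg]
  refine (h.norm_deriv_le (by linarith [saddleRadius_le A R, h.pos_radius])).trans ?_
  have := h.norm_saddle_le ht
  calc 8 * A * ‖saddle E t‖ ^ 2 ≤ 8 * A * (2 * ‖t‖) ^ 2 := by gcongr
    _ = _ := by ring

/-- `E(p)` is cubic since `‖p‖ ≤ 2‖t‖`, while `p - t = -E'(p)` is `O(t²)`, so its square is of order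
four and is absorbed. -/
theorem norm_legendreRemainder_le (h : CubicRemainder E A R) {t : ℂ}
    (ht : ‖t‖ < saddleRadius A R / 2) : ‖legendreRemainder E t‖ ≤ 12 * A * ‖t‖ ^ 3 := by
  have hA := h.pos_const
  have hm := h.saddle_mem ht
  have h1 := h.norm_le (saddle E t) (by
    rw [mem_ball_zero_iff]; linarith [saddleRadius_le A R, h.pos_radius])
  have h2 := h.norm_saddle_sub_le ht
  have h3 := h.norm_saddle_le ht
  have h4 : 128 * A * ‖t‖ ≤ 1 := by
    have := h.mul_saddleRadius_le
    nlinarith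
  calc ‖legendreRemainder E t‖ ≤ ‖E (saddle E t)‖ + ‖(saddle E t - t) ^ 2 / 2‖ := norm_add_le _ _
    _ = ‖E (saddle E t)‖ + ‖saddle E t - t‖ ^ 2 / 2 := by simp
    _ ≤ A * (2 * ‖t‖) ^ 3 + (32 * A * ‖t‖ ^ 2) ^ 2 / 2 := by
      gcongr
      exact h1.trans (by gcongr)
    _ = 8 * A * ‖t‖ ^ 3 + 4 * A * ‖t‖ ^ 3 * (128 * A * ‖t‖) := by ring
    _ ≤ 8 * A * ‖t‖ ^ 3 + 4 * A * ‖t‖ ^ 3 * 1 := by gcongr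
    _ = _ := by ring

theorem legendreRemainder_conj (h : CubicRemainder E A R) {t : ℂ}
    (ht : ‖t‖ < saddleRadius A R / 2) :
    legendreRemainder E (starRingEnd ℂ t) = starRingEnd ℂ (legendreRemainder E t) := by
  simp [legendreRemainder, h.saddle_conj ht, h.conj, map_ofNat]

end CubicRemainder

/-! ### Reality and growth of the Cramér coefficients -/

theorem iteratedDeriv_conj_conj (f : ℂ → ℂ) (k : ℕ) :
    iteratedDeriv k (⇑(starRingEnd ℂ) ∘ f ∘ ⇑(starRingEnd ℂ)) =
      ⇑(starRingEnd ℂ) ∘ iteratedDeriv k f ∘ ⇑(starRingEnd ℂ) := by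
  induction k with
  | zero => simp [iteratedDeriv_zero]
  | succ k ih => rw [iteratedDeriv_succ, ih, deriv_conj_conj, iteratedDeriv_succ]

namespace CubicRemainder

variable {E : ℂ → ℂ} {A R : ℝ}

/-- The Legendre remainder commutes with conjugation near `0`, so its Taylor coefficients are real
and taking `.re` in `cramerCoeff` loses nothing. -/
theorem ofReal_cramerCoeff (h : CubicRemainder E A R) (k : ℕ) :
    (cramerCoeff E k : ℂ) =
      iteratedDeriv (k + 3) (legendreRemainder E) 0 / (k + 3).factorial := by
  have he : (⇑(starRingEnd ℂ) ∘ legendreRemainder E ∘ ⇑(starRingEnd ℂ)) =ᶠ[𝓝 0]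
      legendreRemainder E := by
    have hb : ∀ᶠ w in 𝓝 (0 : ℂ), w ∈ Metric.ball (0 : ℂ) (saddleRadius A R / 2) :=
      Metric.ball_mem_nhds 0 (by linarith [h.saddleRadius_pos])
    filter_upwards [hb] with t ht
    rw [mem_ball_zero_iff] at ht
    simp [h.legendreRemainder_conj ht]
  have h1 := Filter.EventuallyEq.iteratedDeriv_eq (k + 3) he
  rw [iteratedDeriv_conj_conj] at h1
  have h2 : starRingEnd ℂ (iteratedDeriv (k + 3) (legendreRemainder E) 0) =
      iteratedDeriv (k + 3) (legendreRemainder E) 0 := by simpa using h1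
  rw [cramerCoeff]
  push_cast
  rw [Complex.conj_eq_iff_re.1 h2]

theorem norm_iteratedDeriv_legendreRemainder_le (h : CubicRemainder E A R) (k : ℕ) :
    ‖iteratedDeriv k (legendreRemainder E) 0‖ ≤
      k.factorial * (12 * A * (saddleRadius A R / 4) ^ 3) / (saddleRadius A R / 4) ^ k := by
  have hpos := h.saddleRadius_pos
  refine Complex.norm_iteratedDeriv_le_of_forall_mem_sphere_norm_le k (by linarith)
    ((h.differentiableOn_legendreRemainder.mono ?_).diffContOnCl) (fun z hz => ?_)
  · exact Metric.closure_ball_subset_closedBall.trans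
      (Metric.closedBall_subset_ball (by linarith))
  · rw [mem_sphere_zero_iff_norm] at hz
    refine (h.norm_legendreRemainder_le (by rw [hz]; linarith)).trans_eq (by rw [hz])

theorem abs_cramerCoeff_le (h : CubicRemainder E A R) (k : ℕ) :
    |cramerCoeff E k| ≤ 12 * A / (saddleRadius A R / 4) ^ k := by
  have hpos := h.saddleRadius_pos
  have h1 := h.norm_iteratedDeriv_legendreRemainder_le (k + 3)
  have h2 : |cramerCoeff E k| = ‖(cramerCoeff E k : ℂ)‖ := by simp
  rw [h2, h.ofReal_cramerCoeff, norm_div, Complex.norm_natCast]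
  rw [div_le_iff₀ (by positivity)]
  refine h1.trans_eq ?_
  rw [pow_add]
  field_simp

/-- The Cauchy estimates are taken on the circle of radius `saddleRadius / 4`; halving that radius
leaves a geometric series of ratio `1/2`. -/
theorem norm_cramerCoeff_mul_pow_le (h : CubicRemainder E A R) {t : ℂ}
    (ht : ‖t‖ < saddleRadius A R / 8) (k : ℕ) :
    ‖(cramerCoeff E k : ℂ) * t ^ k‖ ≤ 12 * A * (1 / 2) ^ k := by
  have hpos := h.saddleRadius_pos
  have hA := h.pos_const
  rw [norm_mul, norm_pow, Complex.norm_real, Real.norm_eq_abs]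
  calc |cramerCoeff E k| * ‖t‖ ^ k
      ≤ 12 * A / (saddleRadius A R / 4) ^ k * (saddleRadius A R / 8) ^ k := by
        gcongr
        exact h.abs_cramerCoeff_le k
    _ = 12 * A * (1 / 2) ^ k := by
      have e : saddleRadius A R / 8 = saddleRadius A R / 4 * (1 / 2) := by ring
      rw [e, mul_pow]
      field_simp

theorem summable_cramerCoeff (h : CubicRemainder E A R) {t : ℂ}
    (ht : ‖t‖ < saddleRadius A R / 8) :
    Summable fun k => (cramerCoeff E k : ℂ) * t ^ k :=
  Summable.of_norm_bounded ((summable_geometric_two).mul_left (12 * A))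
    (h.norm_cramerCoeff_mul_pow_le ht)

theorem norm_tsum_cramerCoeff_le (h : CubicRemainder E A R) {t : ℂ}
    (ht : ‖t‖ < saddleRadius A R / 8) :
    ‖∑' k, (cramerCoeff E k : ℂ) * t ^ k‖ ≤ 24 * A := by
  refine tsum_of_norm_bounded ?_ (h.norm_cramerCoeff_mul_pow_le ht)
  have := hasSum_geometric_two.mul_left (12 * A)
  rwa [show 12 * A * 2 = 24 * A by ring] at this

/-- The cubic bound kills the Taylor coefficients of orders `0`, `1` and `2`, so the Taylor series
can be divided by `t ^ 3`. -/
theorem pow_mul_tsum_cramerCoeff (h : CubicRemainder E A R) {t : ℂ}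
    (ht : ‖t‖ < saddleRadius A R / 8) :
    t ^ 3 * ∑' k, (cramerCoeff E k : ℂ) * t ^ k = legendreRemainder E t := by
  have hpos := h.saddleRadius_pos
  have hA := h.pos_const
  have hs := Complex.hasSum_taylorSeries_on_ball h.differentiableOn_legendreRemainder
    (z := t) (by rw [mem_ball_zero_iff]; linarith)
  have hq : ∀ z ∈ Metric.ball (0 : ℂ) (saddleRadius A R / 2),
      ‖legendreRemainder E z‖ ≤ 12 * A * ‖z‖ ^ 3 := fun z hz =>
    h.norm_legendreRemainder_le (by simpa using hz)
  have q1 := norm_deriv_le_of_norm_le_pow h.differentiableOn_legendreRemainder hq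
  have q2 := norm_deriv_le_of_norm_le_pow (k := 1)
    ((h.differentiableOn_legendreRemainder.deriv Metric.isOpen_ball).mono
      (Metric.ball_subset_ball (by linarith))) q1
  have z0 : iteratedDeriv 0 (legendreRemainder E) 0 = 0 := by
    have := hq 0 (by simp [hpos])
    simpa using this
  have z1 : iteratedDeriv 1 (legendreRemainder E) 0 = 0 := by
    have := q1 0 (by simp [hpos])
    simpa [iteratedDeriv_one] using this
  have z2 : iteratedDeriv 2 (legendreRemainder E) 0 = 0 := by
    have := q2 0 (by simp [hpos])
    rw [iteratedDeriv_succ, iteratedDeriv_one]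
    simpa using this
  rw [← hasSum_nat_add_iff' 3] at hs
  simp only [Finset.sum_range_succ, Finset.sum_range_zero, z0, z1, z2, smul_zero, add_zero,
    sub_zero] at hs
  rw [← hs.tsum_eq, ← tsum_mul_left]
  congr 1
  funext k
  rw [h.ofReal_cramerCoeff, pow_add]
  simp only [smul_eq_mul]
  rw [div_eq_mul_inv]
  ring

end CubicRemainder
/-! ### A smoothing inequality for intervals -/

/-- An integrable kernel `V` of total mass one with cubic decay whose Fourier transform `ρ` is
supported in `[-1, 1]`. -/
structure IsSmoothingKernel (ρ : ℝ → ℝ) (V : ℝ → ℂ) (D : ℝ) : Prop where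
  continuous_rho : Continuous ρ
  integrable_rho : Integrable ρ
  rho_nonneg : ∀ v, 0 ≤ ρ v
  rho_le_one : ∀ v, ρ v ≤ 1
  rho_eq_zero : ∀ v, 1 < |v| → ρ v = 0
  continuous : Continuous V
  integrable : Integrable V
  integral_eq_one : ∫ y, V y = 1
  eq_integral : ∀ y, V y = ∫ v : ℝ, (1 / (2 * Real.pi) : ℂ) * (ρ v * Complex.exp (-(v * y) * Complex.I))
  pos : 0 < D
  norm_le : ∀ y, ‖V y‖ ≤ D * (1 + |y|) ^ (-3 : ℤ)

/-- `ρ` is a smooth bump supported in `[-1, 1]` and `V` its rescaled Fourier transform. The decay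
holds because `V` is Schwartz, and Fourier inversion at `0` identifies the total mass with the value
of the bump at `0`. -/
theorem exists_isSmoothingKernel : ∃ ρ V D, IsSmoothingKernel ρ V D := by
  obtain ⟨f, hf⟩ : ∃ f : ContDiffBump (0 : ℝ), f.rOut = 1 :=
    ⟨⟨1 / 2, 1, by norm_num, by norm_num⟩, rfl⟩
  have hcs : HasCompactSupport (fun x => (f x : ℂ)) :=
    f.hasCompactSupport.comp_left (g := ((↑) : ℝ → ℂ)) Complex.ofReal_zero
  have hcd : ContDiff ℝ (⊤ : ℕ∞) (fun x => (f x : ℂ)) :=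
    Complex.ofRealCLM.contDiff.comp f.contDiff
  let g : SchwartzMap ℝ ℂ := hcs.toSchwartzMap hcd
  have hg : ∀ x, g x = (f x : ℂ) := fun x => rfl
  let G : SchwartzMap ℝ ℂ := FourierTransform.fourier g
  have hG : ∀ y, G y = ∫ v : ℝ, Complex.exp (↑(-2 * Real.pi * v * y) * Complex.I) • g v := by
    intro y
    have : G y = (FourierTransform.fourier (g : ℝ → ℂ)) y := by
      rw [← SchwartzMap.fourier_coe]
    rw [this, Real.fourier_real_eq_integral_exp_smul]
  have hpi := Real.pi_pos
  have hGint : ∫ y, G y = 1 := by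
    have h1 : (FourierTransformInv.fourierInv G : SchwartzMap ℝ ℂ) = g :=
      FourierTransform.fourierInv_fourier_eq g
    have h2 : (FourierTransformInv.fourierInv G : SchwartzMap ℝ ℂ) 0 = g 0 := by rw [h1]
    rw [SchwartzMap.fourierInv_coe, Real.fourierInv_eq'] at h2
    simpa [hg, f.one_of_mem_closedBall (Metric.mem_closedBall_self f.rIn_pos.le)] using h2
  obtain ⟨D, hD⟩ : ∃ D, ∀ y : ℝ, (1 + ‖y‖) ^ 3 * ‖G y‖ ≤ D := by
    refine ⟨2 ^ 3 * ((Finset.Iic ((3, 0) : ℕ × ℕ)).sup fun m =>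
      SchwartzMap.seminorm ℝ m.1 m.2) G, fun y => ?_⟩
    have := SchwartzMap.one_add_le_sup_seminorm_apply (𝕜 := ℝ) (m := (3, 0)) (k := 3) (n := 0)
      le_rfl le_rfl G y
    rw [norm_iteratedFDeriv_zero] at this
    exact this
  -- The factor `1 / (2π)`, inside and outside, passes from the kernel `exp (-2π i v y)` to `exp (-i
  -- v y)` used by characteristic functions.
  refine ⟨f, fun y => (1 / (2 * Real.pi) : ℂ) * G ((1 / (2 * Real.pi)) * y),
    (|D| + 1) * (2 * Real.pi) ^ 3, ?_⟩
  refine ⟨f.continuous, f.continuous.integrable_of_hasCompactSupport f.hasCompactSupport,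
    fun v => f.nonneg, fun v => f.le_one, fun v hv => ?_, ?_, ?_, ?_, fun y => ?_, by positivity,
    fun y => ?_⟩
  · refine f.zero_of_le_dist ?_
    rw [hf, Real.dist_eq, sub_zero]
    exact hv.le
  · exact continuous_const.mul (G.continuous.comp (by fun_prop))
  · exact (G.integrable.comp_mul_left' (R := 1 / (2 * Real.pi)) (by positivity)).const_mul _
  · rw [integral_const_mul, Measure.integral_comp_mul_left, hGint,
      abs_of_pos (by positivity : (0 : ℝ) < (1 / (2 * Real.pi))⁻¹)]
    simp only [one_div, inv_inv, Complex.real_smul]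
    push_cast
    field_simp
  · rw [integral_const_mul, hG]
    congr 1
    refine integral_congr_ae (ae_of_all _ fun v => ?_)
    simp only [hg, smul_eq_mul]
    rw [mul_comm]
    congr 2
    push_cast
    field_simp
  · have h1 := hD ((1 / (2 * Real.pi)) * y)
    have h2 : (1 + |y|) ≤ 2 * Real.pi * (1 + ‖(1 / (2 * Real.pi)) * y‖) := by
      rw [Real.norm_eq_abs, abs_mul, abs_of_pos (by positivity : 0 < 1 / (2 * Real.pi)), mul_add]
      have : 2 * Real.pi * (1 / (2 * Real.pi) * |y|) = |y| := by field_simp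
      rw [this]
      linarith [Real.pi_gt_three]
    rw [zpow_neg, ← div_eq_mul_inv, le_div_iff₀ (by positivity), norm_mul]
    have h3 : ‖(1 / (2 * Real.pi) : ℂ)‖ ≤ 1 := by
      have : (1 / (2 * Real.pi) : ℂ) = ((1 / (2 * Real.pi) : ℝ) : ℂ) := by push_cast; rfl
      rw [this, Complex.norm_real, Real.norm_eq_abs, abs_of_pos (by positivity)]
      rw [div_le_one (by positivity)]
      linarith [Real.pi_gt_three]
    calc ‖(1 / (2 * Real.pi) : ℂ)‖ * ‖G (1 / (2 * Real.pi) * y)‖ * (1 + |y|) ^ (3 : ℤ)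
        ≤ 1 * ‖G (1 / (2 * Real.pi) * y)‖ *
          (2 * Real.pi * (1 + ‖(1 / (2 * Real.pi)) * y‖)) ^ 3 := by
          rw [show (3 : ℤ) = ((3 : ℕ) : ℤ) by rfl, zpow_natCast]
          gcongr
      _ = ((1 + ‖(1 / (2 * Real.pi)) * y‖) ^ 3 * ‖G (1 / (2 * Real.pi) * y)‖) *
          (2 * Real.pi) ^ 3 := by ring
      _ ≤ (|D| + 1) * (2 * Real.pi) ^ 3 := by
        gcongr
        linarith [le_abs_self D]

namespace IsSmoothingKernel

variable {ρ : ℝ → ℝ} {V : ℝ → ℂ} {D : ℝ}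

theorem hasDerivAt_tail {t : ℝ} (ht : 0 ≤ t) :
    HasDerivAt (fun t : ℝ => -(1 + t) ^ (-2 : ℤ) / 2) ((1 + t) ^ (-3 : ℤ)) t := by
  have h1 : HasDerivAt (fun t : ℝ => 1 + t) 1 t := (hasDerivAt_id t).const_add 1
  have h2 := (hasDerivAt_zpow (-2) (1 + t) (Or.inl (by linarith))).comp t h1
  refine (h2.neg.div_const 2).congr_deriv ?_
  norm_num

theorem tendsto_tail : Tendsto (fun t : ℝ => -(1 + t) ^ (-2 : ℤ) / 2) atTop (𝓝 0) := by
  have h1 : Tendsto (fun t : ℝ => 1 + t) atTop atTop := tendsto_atTop_add_const_left _ _ tendsto_id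
  have h2 := (tendsto_zpow_atTop_zero (𝕜 := ℝ) (n := -2) (by norm_num)).comp h1
  have := (h2.neg).div_const 2
  simpa using this

theorem norm_setIntegral_Ioi_le (h : IsSmoothingKernel ρ V D) {x : ℝ} (hx : 0 ≤ x) :
    ‖∫ y in Set.Ioi x, V y‖ ≤ D * (1 + |x|) ^ (-2 : ℤ) := by
  have hd : ∀ t ∈ Set.Ici x, HasDerivAt (fun t : ℝ => -(1 + t) ^ (-2 : ℤ) / 2)
      ((1 + t) ^ (-3 : ℤ)) t := fun t ht => hasDerivAt_tail (hx.trans ht)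
  have hn : ∀ t ∈ Set.Ioi x, (0 : ℝ) ≤ (1 + t) ^ (-3 : ℤ) := fun t ht => by
    have : 0 < 1 + t := by linarith [Set.mem_Ioi.1 ht]
    positivity
  have hi := integrableOn_Ioi_deriv_of_nonneg' hd hn tendsto_tail
  have he := integral_Ioi_of_hasDerivAt_of_nonneg' hd hn tendsto_tail
  have hle : ‖∫ y in Set.Ioi x, V y‖ ≤ ∫ y in Set.Ioi x, D * (1 + y) ^ (-3 : ℤ) := by
    refine norm_integral_le_of_norm_le (hi.const_mul D) ?_
    refine (ae_restrict_mem measurableSet_Ioi).mono fun y hy => ?_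
    have := h.norm_le y
    rwa [abs_of_nonneg (hx.trans (Set.mem_Ioi.1 hy).le)] at this
  refine hle.trans ?_
  rw [integral_const_mul, he, abs_of_nonneg hx]
  have hD := h.pos
  have : (0 : ℝ) < (1 + x) ^ (-2 : ℤ) := by positivity
  nlinarith

theorem norm_setIntegral_Iic_le (h : IsSmoothingKernel ρ V D) {x : ℝ} (hx : x ≤ 0) :
    ‖∫ y in Set.Iic x, V y‖ ≤ D * (1 + |x|) ^ (-2 : ℤ) := by
  have hk : ‖∫ y in Set.Iic x, V y‖ ≤ ∫ y in Set.Ioi (-x), D * (1 + y) ^ (-3 : ℤ) := by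
    have h1 : ∫ y in Set.Iic x, V y = ∫ y in Set.Ioi (-x), V (-y) := by
      simp
    have hd : ∀ t ∈ Set.Ici (-x), HasDerivAt (fun t : ℝ => -(1 + t) ^ (-2 : ℤ) / 2)
        ((1 + t) ^ (-3 : ℤ)) t := fun t ht =>
      hasDerivAt_tail (le_trans (by linarith) (Set.mem_Ici.1 ht))
    have hn : ∀ t ∈ Set.Ioi (-x), (0 : ℝ) ≤ (1 + t) ^ (-3 : ℤ) := fun t ht => by
      have : 0 < 1 + t := by linarith [Set.mem_Ioi.1 ht]
      positivity
    have hi := integrableOn_Ioi_deriv_of_nonneg' hd hn tendsto_tail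
    rw [h1]
    refine norm_integral_le_of_norm_le (hi.const_mul D) ?_
    refine (ae_restrict_mem measurableSet_Ioi).mono fun y hy => ?_
    have := h.norm_le (-y)
    rwa [abs_neg, abs_of_nonneg (by linarith [Set.mem_Ioi.1 hy])] at this
  refine hk.trans ?_
  have hd : ∀ t ∈ Set.Ici (-x), HasDerivAt (fun t : ℝ => -(1 + t) ^ (-2 : ℤ) / 2)
      ((1 + t) ^ (-3 : ℤ)) t := fun t ht =>
    hasDerivAt_tail (le_trans (by linarith) (Set.mem_Ici.1 ht))
  have hn : ∀ t ∈ Set.Ioi (-x), (0 : ℝ) ≤ (1 + t) ^ (-3 : ℤ) := fun t ht => by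
    have : 0 < 1 + t := by linarith [Set.mem_Ioi.1 ht]
    positivity
  rw [integral_const_mul, integral_Ioi_of_hasDerivAt_of_nonneg' hd hn tendsto_tail,
    abs_of_nonpos hx]
  have hD := h.pos
  have hx' : 0 < 1 + -x := by linarith
  have : (0 : ℝ) < (1 + -x) ^ (-2 : ℤ) := by positivity
  nlinarith

/-- The indicator of `[a, b]` smoothed at scale `1 / T`. -/
def smoothed (V : ℝ → ℂ) (T a b w : ℝ) : ℂ := ∫ y in a..b, (T : ℂ) * V (T * (w - y))

/-- The smoothed indicator is a difference of two values of the primitive of `V`, so its error is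
governed by the tails of `V`. -/
theorem smoothed_eq (h : IsSmoothingKernel ρ V D) {T : ℝ} (hT : 0 < T) (a b w : ℝ) :
    smoothed V T a b w =
      (∫ y in Set.Iic (T * (w - a)), V y) - ∫ y in Set.Iic (T * (w - b)), V y := by
  rw [intervalIntegral.integral_Iic_sub_Iic h.integrable.integrableOn h.integrable.integrableOn,
    smoothed, intervalIntegral.integral_const_mul]
  have h1 : (fun y => V (T * (w - y))) = fun y => V (T * w - T * y) := by
    funext y; ring_nf
  rw [h1, intervalIntegral.integral_comp_sub_mul V hT.ne']
  rw [Complex.real_smul, ← mul_assoc]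
  rw [show (T : ℂ) * ((T⁻¹ : ℝ) : ℂ) = 1 by
    rw [← Complex.ofReal_mul, mul_inv_cancel₀ hT.ne', Complex.ofReal_one], one_mul, mul_sub, mul_sub]

/-- Wherever `w` lies relative to `a` and `b`, the difference is a combination of one tail of `V`
beyond `T (w - a)` and one beyond `T (w - b)`. -/
theorem norm_indicator_sub_smoothed_le (h : IsSmoothingKernel ρ V D) {T : ℝ} (hT : 0 < T)
    {a b : ℝ} (hab : a ≤ b) (w : ℝ) :
    ‖(Set.Icc a b).indicator (fun _ => (1 : ℂ)) w - smoothed V T a b w‖ ≤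
      D * ((1 + |T * (w - a)|) ^ (-2 : ℤ) + (1 + |T * (w - b)|) ^ (-2 : ℤ)) := by
  have hcompl : ∀ x, 1 - ∫ y in Set.Iic x, V y = ∫ y in Set.Ioi x, V y := by
    intro x
    rw [← h.integral_eq_one, ← Set.compl_Iic, ← integral_add_compl (measurableSet_Iic (a := x))
      h.integrable]
    ring
  rw [h.smoothed_eq hT, mul_add]
  rcases lt_or_ge w a with hwa | hwa
  · rw [Set.indicator_of_notMem (by simp [hwa])]
    have h1 := h.norm_setIntegral_Iic_le (x := T * (w - a)) (by nlinarith)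
    have h2 := h.norm_setIntegral_Iic_le (x := T * (w - b)) (by nlinarith)
    rw [zero_sub, norm_neg]
    exact (norm_sub_le _ _).trans (add_le_add h1 h2)
  · rcases lt_or_ge b w with hwb | hwb
    · rw [Set.indicator_of_notMem (by simp [hwb])]
      have h1 := h.norm_setIntegral_Ioi_le (x := T * (w - a)) (by nlinarith)
      have h2 := h.norm_setIntegral_Ioi_le (x := T * (w - b)) (by nlinarith)
      rw [← hcompl] at h1 h2
      refine le_trans (le_of_eq ?_) ((norm_sub_le _ _).trans (add_le_add h1 h2))
      congr 1; ring
    · rw [Set.indicator_of_mem (Set.mem_Icc.2 ⟨hwa, hwb⟩)]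
      have h1 := h.norm_setIntegral_Ioi_le (x := T * (w - a)) (by nlinarith)
      have h2 := h.norm_setIntegral_Iic_le (x := T * (w - b)) (by nlinarith)
      rw [← hcompl] at h1
      refine le_trans (le_of_eq ?_) ((norm_add_le _ _).trans (add_le_add h1 h2))
      congr 1; ring

/-- Fubini. Since `ρ` vanishes outside `[-1, 1]`, only the values of `charFun ν` on `[-T, T]` enter.
-/
theorem integral_comp_affine (h : IsSmoothingKernel ρ V D) (ν : Measure ℝ) [IsProbabilityMeasure ν]
    (T y : ℝ) : ∫ w, V (T * (w - y)) ∂ν = ∫ v : ℝ, (1 / (2 * Real.pi) : ℂ) *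
      (ρ v * charFun ν (-(v * T)) * Complex.exp (v * T * y * Complex.I)) := by
  simp_rw [h.eq_integral]
  rw [integral_integral_swap]
  · refine integral_congr_ae (ae_of_all _ fun v => ?_)
    simp only [integral_const_mul, charFun_apply_real]
    rw [mul_assoc, mul_assoc, ← integral_mul_const]
    congr 3
    funext w
    rw [← Complex.exp_add]
    congr 1
    push_cast
    ring
  · have hdom : Integrable (fun z : ℝ × ℝ => (1 / (2 * Real.pi)) * ρ z.2) (ν.prod volume) :=
      (h.integrable_rho.comp_snd ν).const_mul _
    refine hdom.mono' ?_ (ae_of_all _ fun z => ?_)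
    · have := h.continuous_rho
      exact Continuous.aestronglyMeasurable (by unfold Function.uncurry; fun_prop)
    · simp only [Function.uncurry]
      rw [norm_mul, norm_mul, show -((z.2 : ℂ) * ↑(T * (z.1 - y))) * Complex.I =
        ((-(z.2 * (T * (z.1 - y))) : ℝ) : ℂ) * Complex.I by push_cast; ring,
        Complex.norm_exp_ofReal_mul_I, mul_one, Complex.norm_real, Real.norm_eq_abs,
        abs_of_nonneg (h.rho_nonneg _)]
      have : ‖(1 / (2 * Real.pi) : ℂ)‖ = 1 / (2 * Real.pi) := by
        rw [show (1 / (2 * Real.pi) : ℂ) = ((1 / (2 * Real.pi) : ℝ) : ℂ) by push_cast; rfl,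
          Complex.norm_real, Real.norm_eq_abs, abs_of_pos (by positivity)]
      rw [this]

/-- This bound does not involve the length of `[a, b]`; its singularity at `v = 0` will be
compensated by a cubic factor in the difference of characteristic functions. -/
theorem norm_interval_exp_le {T : ℝ} (v : ℝ) (hv : v ≠ 0) (hT : 0 < T) (a b : ℝ) :
    ‖∫ y in a..b, (T : ℂ) * Complex.exp (v * T * y * Complex.I)‖ ≤ 2 / |v| := by
  have hc : ((v * T : ℝ) * Complex.I : ℂ) ≠ 0 := by
    simp [hv, hT.ne']
  have h1 : ∀ y : ℝ, Complex.exp (v * T * y * Complex.I) =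
      Complex.exp (((v * T : ℝ) * Complex.I) * y) := fun y => by
    congr 1; push_cast; ring
  simp_rw [h1]
  rw [intervalIntegral.integral_const_mul, integral_exp_mul_complex hc, norm_mul, norm_div]
  have h2 : ∀ y : ℝ, ‖Complex.exp (((v * T : ℝ) * Complex.I) * y)‖ = 1 := fun y => by
    rw [show ((v * T : ℝ) * Complex.I : ℂ) * y = ((v * T * y : ℝ) : ℂ) * Complex.I by
      push_cast; ring, Complex.norm_exp_ofReal_mul_I]
  have h3 : ‖Complex.exp (((v * T : ℝ) * Complex.I) * b) -
      Complex.exp (((v * T : ℝ) * Complex.I) * a)‖ ≤ 2 := by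
    refine (norm_sub_le _ _).trans ?_
    rw [h2, h2]; norm_num
  rw [norm_mul, Complex.norm_I, mul_one, Complex.norm_real, Complex.norm_real, Real.norm_eq_abs,
    Real.norm_eq_abs, abs_mul, abs_of_pos hT]
  calc T * (_ / (|v| * T)) ≤ T * (2 / (|v| * T)) := by gcongr
    _ = 2 / |v| := by field_simp

theorem continuous_charFun (ν : Measure ℝ) [IsProbabilityMeasure ν] : Continuous (charFun ν) := by
  fun_prop

theorem integral_smoothed (h : IsSmoothingKernel ρ V D) (ν : Measure ℝ) [IsProbabilityMeasure ν]
    (T a b : ℝ) : ∫ w, smoothed V T a b w ∂ν = ∫ v : ℝ, (1 / (2 * Real.pi) : ℂ) *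
      (ρ v * charFun ν (-(v * T)) *
        ∫ y in a..b, (T : ℂ) * Complex.exp (v * T * y * Complex.I)) := by
  have hV : ∀ y, ‖V y‖ ≤ D := fun y => (h.norm_le y).trans (by
    refine mul_le_of_le_one_right h.pos.le ?_
    rw [zpow_neg]
    refine inv_le_one_of_one_le₀ ?_
    exact one_le_zpow₀ (by linarith [abs_nonneg y]) (by norm_num))
  have : IsFiniteMeasure ((volume : Measure ℝ).restrict (Set.uIoc a b)) :=
    ⟨by rw [Measure.restrict_apply_univ]; exact measure_Ioc_lt_top⟩
  unfold smoothed
  rw [← intervalIntegral_integral_swap]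
  · have h1 : ∀ y, ∫ w, (T : ℂ) * V (T * (w - y)) ∂ν = ∫ v : ℝ, (1 / (2 * Real.pi) : ℂ) *
        (ρ v * charFun ν (-(v * T)) * ((T : ℂ) * Complex.exp (v * T * y * Complex.I))) := by
      intro y
      rw [integral_const_mul, h.integral_comp_affine, ← integral_const_mul]
      congr 1
      funext v
      ring
    simp_rw [h1]
    rw [intervalIntegral_integral_swap]
    · congr 1
      funext v
      rw [intervalIntegral.integral_const_mul, intervalIntegral.integral_const_mul]
    · have hdom : Integrable (fun z : ℝ × ℝ => (1 / (2 * Real.pi)) * (ρ z.2 * |T|))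
          ((volume.restrict (Set.uIoc a b)).prod volume) :=
        ((h.integrable_rho.mul_const |T|).comp_snd _).const_mul _
      refine hdom.mono' ?_ (ae_of_all _ fun z => ?_)
      · have := h.continuous_rho
        have := continuous_charFun ν
        exact Continuous.aestronglyMeasurable (by unfold Function.uncurry; fun_prop)
      · simp only [Function.uncurry]
        rw [norm_mul, norm_mul, norm_mul, norm_mul,
          show (z.2 : ℂ) * T * z.1 * Complex.I = ((z.2 * T * z.1 : ℝ) : ℂ) * Complex.I by
          push_cast; ring,
          Complex.norm_exp_ofReal_mul_I, mul_one, Complex.norm_real, Real.norm_eq_abs,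
          abs_of_nonneg (h.rho_nonneg _), Complex.norm_real, Real.norm_eq_abs]
        have : ‖(1 / (2 * Real.pi) : ℂ)‖ = 1 / (2 * Real.pi) := by
          rw [show (1 / (2 * Real.pi) : ℂ) = ((1 / (2 * Real.pi) : ℝ) : ℂ) by push_cast; rfl,
            Complex.norm_real, Real.norm_eq_abs, abs_of_pos (by positivity)]
        rw [this]
        have h2 := norm_charFun_le_one (μ := ν) (-(z.2 * T))
        have h3 := h.rho_nonneg z.2
        gcongr
        exact mul_le_of_le_one_right h3 h2
  · have hdom : Integrable (fun _ : ℝ × ℝ => |T| * D)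
        ((volume.restrict (Set.uIoc a b)).prod ν) := integrable_const _
    refine hdom.mono' ?_ (ae_of_all _ fun z => ?_)
    · have := h.continuous
      exact Continuous.aestronglyMeasurable (by unfold Function.uncurry; fun_prop)
    · simp only [Function.uncurry]
      rw [norm_mul, Complex.norm_real, Real.norm_eq_abs]
      gcongr
      exact hV _

end IsSmoothingKernel
-- Concentration through the Fejér kernel
/-- The Fejér kernel `2 (1 - cos θ) / θ ^ 2`, as the Fourier transform of a triangle. -/
def fejer (θ : ℝ) : ℝ := 2 * ∫ u in (0 : ℝ)..1, (1 - u) * Real.cos (u * θ)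

theorem fejer_of_ne {θ : ℝ} (hθ : θ ≠ 0) : fejer θ = 2 * (1 - Real.cos θ) / θ ^ 2 := by
  have hd : ∀ u ∈ Set.uIcc (0 : ℝ) 1, HasDerivAt
      (fun u => (1 - u) * Real.sin (u * θ) / θ - Real.cos (u * θ) / θ ^ 2)
      ((1 - u) * Real.cos (u * θ)) u := by
    intro u _
    have h1 : HasDerivAt (fun u : ℝ => u * θ) θ u := by simpa using (hasDerivAt_id u).mul_const θ
    have h2 := ((((hasDerivAt_id' u).const_sub 1).fun_mul h1.sin).div_const θ).fun_sub
      (h1.cos.div_const (θ ^ 2))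
    refine h2.congr_deriv ?_
    field_simp
    ring
  rw [fejer, intervalIntegral.integral_eq_sub_of_hasDerivAt hd
    (Continuous.intervalIntegrable (by fun_prop) _ _)]
  simp
  field_simp
  ring

theorem fejer_zero : fejer 0 = 1 := by
  simp only [fejer, mul_zero, Real.cos_zero, mul_one]
  rw [intervalIntegral.integral_sub (by simp) (by simp)]
  simp
  norm_num

theorem fejer_nonneg (θ : ℝ) : 0 ≤ fejer θ := by
  by_cases h : θ = 0
  · rw [h, fejer_zero]; norm_num
  · rw [fejer_of_ne h]
    have := Real.cos_le_one θ
    exact div_nonneg (by linarith) (by positivity)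

/-- The Fejér kernel vanishes at the nonzero multiples of `2π`, so one copy cannot dominate. A shift
by `1` repairs this: `cos θ + cos (θ + 1) ≤ 2 cos (1/2) ≤ 15/8`, and `8 (2 - 15/8) = 1` explains the
factor `4`. -/
theorem one_add_abs_zpow_le_fejer (θ : ℝ) :
    (1 + |θ|) ^ (-2 : ℤ) ≤ 4 * (fejer θ + fejer (θ + 1)) := by
  have hle : (1 + |θ|) ^ (-2 : ℤ) ≤ 1 := by
    rw [zpow_neg]
    exact inv_le_one_of_one_le₀ (one_le_zpow₀ (by linarith [abs_nonneg θ]) (by norm_num))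
  by_cases h0 : θ = 0
  · have := fejer_nonneg (θ + 1)
    rw [h0] at this hle ⊢
    rw [fejer_zero]; linarith
  by_cases h1 : θ + 1 = 0
  · have := fejer_nonneg θ
    rw [h1, fejer_zero]; linarith
  have hpos : 0 < 1 + |θ| := by positivity
  have e : (1 + |θ|) ^ (-2 : ℤ) = 1 / (1 + |θ|) ^ 2 := by
    rw [zpow_neg, one_div]; rfl
  have hcos : Real.cos θ + Real.cos (θ + 1) ≤ 15 / 8 := by
    have h2 : Real.cos θ + Real.cos (θ + 1) = 2 * Real.cos (θ + 1 / 2) * Real.cos (1 / 2) := by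
      rw [Real.cos_add_cos]
      rw [show (θ + (θ + 1)) / 2 = θ + 1 / 2 by ring, show (θ - (θ + 1)) / 2 = -(1 / 2) by ring,
        Real.cos_neg]
    have h3 : Real.cos (1 / 2) ≤ 15 / 16 := by
      have h4 := Real.cos_one_le
      rw [show (1 : ℝ) = 2 * (1 / 2) by norm_num, Real.cos_two_mul] at h4
      nlinarith
    have h5 : 0 ≤ Real.cos (1 / 2) :=
      Real.cos_nonneg_of_neg_pi_div_two_le_of_le (by linarith [Real.pi_gt_three])
        (by linarith [Real.pi_gt_three])
    have h6 := Real.cos_le_one (θ + 1 / 2)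
    rw [h2]
    nlinarith
  have hk : ∀ x : ℝ, x ≠ 0 → |x| ≤ 1 + |θ| → 2 * (1 - Real.cos x) / (1 + |θ|) ^ 2 ≤ fejer x := by
    intro x hx hxθ
    rw [fejer_of_ne hx]
    have := Real.cos_le_one x
    have h2 : x ^ 2 ≤ (1 + |θ|) ^ 2 := by
      rw [← sq_abs x]; gcongr
    exact div_le_div_of_nonneg_left (by linarith) (by positivity) h2
  have a1 := hk θ h0 (by linarith)
  have a2 := hk (θ + 1) h1 (by
    refine (abs_add_le _ _).trans ?_
    rw [abs_one]; linarith)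
  rw [e]
  calc 1 / (1 + |θ|) ^ 2
      ≤ 4 * (2 * (1 - Real.cos θ) / (1 + |θ|) ^ 2 + 2 * (1 - Real.cos (θ + 1)) / (1 + |θ|) ^ 2) := by
        rw [← add_div, ← mul_div_assoc]
        gcongr
        linarith
    _ ≤ _ := by linarith

theorem integrable_exp_neg_sq_div {T k : ℝ} (hT : T ≠ 0) (hk : 0 < k) :
    Integrable fun v : ℝ => Real.exp (-(v * T) ^ 2 / k) := by
  have := integrable_exp_neg_mul_sq (b := T ^ 2 / k) (by positivity)
  refine this.congr (ae_of_all _ fun v => ?_)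
  ring_nf

theorem integral_exp_neg_sq_div {T k : ℝ} (hT : 0 < T) (hk : 0 < k) :
    ∫ v : ℝ, Real.exp (-(v * T) ^ 2 / k) = √(Real.pi * k) / T := by
  have h1 : ∀ v : ℝ, Real.exp (-(v * T) ^ 2 / k) = Real.exp (-(T ^ 2 / k) * v ^ 2) := fun v => by
    congr 1; ring
  simp_rw [h1]
  rw [integral_gaussian]
  rw [show Real.pi / (T ^ 2 / k) = (Real.pi * k) / T ^ 2 by field_simp,
    Real.sqrt_div (by positivity), Real.sqrt_sq hT.le]

/-- The Fejér kernel is an average of cosines `cos (u θ)` over `u ∈ [0, 1]`. After integration in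
`ν` each is at most `‖charFun ν (u T)‖`, and the Gaussian bound integrates to `O(1/T)`. -/
theorem integral_fejer_le (ν : Measure ℝ) [IsProbabilityMeasure ν] {T : ℝ} (hT : 0 < T)
    (hf : ∀ u : ℝ, |u| ≤ T → ‖charFun ν u‖ ≤ Real.exp (-u ^ 2 / 4)) (c : ℝ) :
    ∫ w, fejer (T * w + c) ∂ν ≤ 8 / T := by
  have hswap : ∫ w, fejer (T * w + c) ∂ν =
      2 * ∫ u in (0 : ℝ)..1, (1 - u) * ∫ w, Real.cos (u * (T * w + c)) ∂ν := by
    unfold fejer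
    rw [integral_const_mul, ← intervalIntegral_integral_swap]
    · simp_rw [integral_const_mul]
    · have : IsFiniteMeasure ((volume : Measure ℝ).restrict (Set.uIoc 0 1)) :=
        ⟨by rw [Measure.restrict_apply_univ]; exact measure_Ioc_lt_top⟩
      have hi : Integrable (fun u : ℝ => 1 - u) ((volume : Measure ℝ).restrict (Set.uIoc 0 1)) :=
        (Continuous.integrableOn_uIcc (by fun_prop)).mono_set Set.uIoc_subset_uIcc
      refine (hi.norm.comp_fst ν).mono' (Continuous.aestronglyMeasurable
        (by unfold Function.uncurry; fun_prop)) (ae_of_all _ fun z => ?_)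
      simp only [Function.uncurry, norm_mul]
      exact mul_le_of_le_one_right (norm_nonneg _) (Real.abs_cos_le_one _)
  have hcos : ∀ u : ℝ, ∫ w, Real.cos (u * (T * w + c)) ∂ν ≤ ‖charFun ν (u * T)‖ := by
    intro u
    have h1 : ∫ w, Complex.exp ((u * (T * w + c) : ℝ) * Complex.I) ∂ν =
        charFun ν (u * T) * Complex.exp ((u * c : ℝ) * Complex.I) := by
      rw [charFun_apply_real, ← integral_mul_const]
      congr 1
      funext w
      rw [← Complex.exp_add]
      congr 1
      push_cast
      ring
    have hint : Integrable (fun w : ℝ => Complex.exp ((u * (T * w + c) : ℝ) * Complex.I)) ν := by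
      refine (integrable_const (1 : ℝ)).mono' (Continuous.aestronglyMeasurable (by fun_prop))
        (ae_of_all _ fun w => ?_)
      rw [Complex.norm_exp_ofReal_mul_I]
    have h2 : ∫ w, Real.cos (u * (T * w + c)) ∂ν =
        (∫ w, Complex.exp ((u * (T * w + c) : ℝ) * Complex.I) ∂ν).re := by
      have := integral_re hint
      simp only [RCLike.re_to_complex, Complex.exp_ofReal_mul_I_re] at this
      exact this
    rw [h2, h1]
    refine (Complex.re_le_norm _).trans ?_
    rw [norm_mul, Complex.norm_exp_ofReal_mul_I, mul_one]
  have hint2 := integrable_exp_neg_sq_div (T := T) (k := 4) hT.ne' (by norm_num)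
  have hle : ∫ u in (0 : ℝ)..1, (1 - u) * ∫ w, Real.cos (u * (T * w + c)) ∂ν ≤
      ∫ v : ℝ, Real.exp (-(v * T) ^ 2 / 4) := by
    have h1 : ∫ u in (0 : ℝ)..1, (1 - u) * ∫ w, Real.cos (u * (T * w + c)) ∂ν ≤
        ∫ u in (0 : ℝ)..1, Real.exp (-(u * T) ^ 2 / 4) := by
      refine intervalIntegral.integral_mono_on_of_le_Ioo zero_le_one ?_ hint2.intervalIntegrable ?_
      · refine Continuous.intervalIntegrable ?_ _ _
        refine (by fun_prop : Continuous fun u : ℝ => 1 - u).mul ?_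
        refine continuous_of_dominated (bound := fun _ => 1)
          (fun u => Continuous.aestronglyMeasurable (by fun_prop))
          (fun u => ae_of_all _ fun w => Real.abs_cos_le_one _) (integrable_const _)
          (ae_of_all _ fun w => by fun_prop)
      · intro u hu
        have h2 := hf (u * T) (by
          rw [abs_of_nonneg (by have := hu.1; positivity)]
          nlinarith [hu.2])
        have h3 := (hcos u).trans h2
        calc (1 - u) * ∫ w, Real.cos (u * (T * w + c)) ∂ν
            ≤ (1 - u) * Real.exp (-(u * T) ^ 2 / 4) :=
              mul_le_mul_of_nonneg_left h3 (by linarith [hu.2])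
          _ ≤ 1 * Real.exp (-(u * T) ^ 2 / 4) := by
              gcongr; linarith [hu.1]
          _ = _ := one_mul _
    refine h1.trans ?_
    rw [intervalIntegral.integral_of_le zero_le_one]
    exact setIntegral_le_integral hint2 (ae_of_all _ fun v => (Real.exp_pos _).le)
  rw [hswap]
  rw [integral_exp_neg_sq_div hT (by norm_num)] at hle
  have hs : √(Real.pi * 4) ≤ 4 := by
    rw [Real.sqrt_le_left (by norm_num)]
    linarith [Real.pi_le_four]
  calc _ ≤ 2 * (√(Real.pi * 4) / T) := by gcongr
    _ ≤ 2 * (4 / T) := by gcongr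
    _ = 8 / T := by ring

theorem continuous_fejer : Continuous fejer := by
  unfold fejer
  exact continuous_const.mul
    (intervalIntegral.continuous_parametric_intervalIntegral_of_continuous' (by
      unfold Function.uncurry; fun_prop) 0 1)

theorem abs_fejer_le (θ : ℝ) : |fejer θ| ≤ 2 := by
  rw [fejer, abs_mul, abs_two]
  have := intervalIntegral.norm_integral_le_of_norm_le_const (a := (0 : ℝ)) (b := 1)
    (f := fun u => (1 - u) * Real.cos (u * θ)) (C := 1) (fun u hu => by
      rw [Set.uIoc_of_le zero_le_one] at hu
      rw [norm_mul, Real.norm_eq_abs, Real.norm_eq_abs]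
      have h1 : |1 - u| ≤ 1 := by
        rw [abs_le]; constructor <;> linarith [hu.1, hu.2]
      calc _ ≤ 1 * 1 := mul_le_mul h1 (Real.abs_cos_le_one _) (abs_nonneg _) zero_le_one
        _ = 1 := one_mul 1)
  rw [Real.norm_eq_abs] at this
  simp at this
  linarith

theorem integrable_one_add_abs_zpow (ν : Measure ℝ) [IsProbabilityMeasure ν] (T a : ℝ) :
    Integrable (fun w => (1 + |T * (w - a)|) ^ (-2 : ℤ)) ν := by
  refine (integrable_const (1 : ℝ)).mono' (Continuous.aestronglyMeasurable ?_)
    (ae_of_all _ fun w => ?_)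
  · refine Continuous.zpow₀ (by fun_prop) _ fun w => Or.inl ?_
    positivity
  · rw [Real.norm_eq_abs, abs_of_nonneg (by positivity), zpow_neg]
    exact inv_le_one_of_one_le₀ (one_le_zpow₀ (by linarith [abs_nonneg (T * (w - a))])
      (by norm_num))

/-- Concentration at scale `1 / T`. -/
theorem integral_one_add_abs_zpow_le (ν : Measure ℝ) [IsProbabilityMeasure ν] {T : ℝ}
    (hT : 0 < T) (hf : ∀ u : ℝ, |u| ≤ T → ‖charFun ν u‖ ≤ Real.exp (-u ^ 2 / 4)) (a : ℝ) :
    ∫ w, (1 + |T * (w - a)|) ^ (-2 : ℤ) ∂ν ≤ 64 / T := by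
  have hi : ∀ c, Integrable (fun w => fejer (T * w + c)) ν := fun c => by
    refine (integrable_const (2 : ℝ)).mono'
      (continuous_fejer.comp (by fun_prop)).aestronglyMeasurable
      (ae_of_all _ fun w => abs_fejer_le _)
  have h1 := integral_fejer_le ν hT hf (-(T * a))
  have h2 := integral_fejer_le ν hT hf (-(T * a) + 1)
  calc ∫ w, (1 + |T * (w - a)|) ^ (-2 : ℤ) ∂ν
      ≤ ∫ w, 4 * (fejer (T * w + -(T * a)) + fejer (T * w + (-(T * a) + 1))) ∂ν := by
        refine integral_mono (integrable_one_add_abs_zpow ν T a) (((hi _).add (hi _)).const_mul 4)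
          fun w => ?_
        refine (one_add_abs_zpow_le_fejer _).trans_eq ?_
        ring_nf
    _ = 4 * ((∫ w, fejer (T * w + -(T * a)) ∂ν) +
          ∫ w, fejer (T * w + (-(T * a) + 1)) ∂ν) := by
        rw [integral_const_mul, integral_add (hi _) (hi _)]
    _ ≤ 4 * (8 / T + 8 / T) := by gcongr
    _ = 64 / T := by ring

theorem norm_charFun_gaussian (u : ℝ) :
    charFun (gaussianReal 0 1) u = Real.exp (-u ^ 2 / 2) := by
  rw [charFun_gaussianReal]
  push_cast
  congr 1
  simp
  ring

/-! ### The Berry–Esseen inequality for intervals -/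

namespace IsSmoothingKernel

variable {ρ : ℝ → ℝ} {V : ℝ → ℂ} {D : ℝ}

theorem integrable_smoothed (h : IsSmoothingKernel ρ V D) (ν : Measure ℝ) [IsProbabilityMeasure ν]
    {T : ℝ} (hT : 0 < T) {a b : ℝ} (hab : a ≤ b) : Integrable (smoothed V T a b) ν := by
  refine (integrable_const (1 + 2 * D)).mono' (Continuous.aestronglyMeasurable ?_)
    (ae_of_all _ fun w => ?_)
  · have := h.continuous
    exact intervalIntegral.continuous_parametric_intervalIntegral_of_continuous' (by
      unfold Function.uncurry; fun_prop) a b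
  · have h1 := h.norm_indicator_sub_smoothed_le hT hab w
    have hle : ∀ x : ℝ, (1 + |x|) ^ (-2 : ℤ) ≤ 1 := fun x => by
      rw [zpow_neg]
      exact inv_le_one_of_one_le₀ (one_le_zpow₀ (by linarith [abs_nonneg x]) (by norm_num))
    have h2 : ‖(Set.Icc a b).indicator (fun _ => (1 : ℂ)) w‖ ≤ 1 := by
      refine (norm_indicator_le_norm_self _ _).trans ?_
      simp
    have h3 := hle (T * (w - a))
    have h4 := hle (T * (w - b))
    have hD := h.pos
    calc ‖smoothed V T a b w‖
        = ‖(Set.Icc a b).indicator (fun _ => (1 : ℂ)) w -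
          ((Set.Icc a b).indicator (fun _ => (1 : ℂ)) w - smoothed V T a b w)‖ := by
          congr 1; ring
      _ ≤ _ := norm_sub_le _ _
      _ ≤ 1 + 2 * D := by nlinarith

/-- Smoothing matters only near the two end points, and the concentration bound limits the mass that
`ν` puts there at scale `1/T`. -/
theorem norm_measure_sub_integral_smoothed_le (h : IsSmoothingKernel ρ V D) (ν : Measure ℝ)
    [IsProbabilityMeasure ν] {T : ℝ} (hT : 0 < T) {a b : ℝ} (hab : a ≤ b)
    (hf : ∀ u : ℝ, |u| ≤ T → ‖charFun ν u‖ ≤ Real.exp (-u ^ 2 / 4)) :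
    ‖(ν.real (Set.Icc a b) : ℂ) - ∫ w, smoothed V T a b w ∂ν‖ ≤ 128 * D / T := by
  have h1 : (ν.real (Set.Icc a b) : ℂ) =
      ∫ w, (Set.Icc a b).indicator (fun _ => (1 : ℂ)) w ∂ν := by
    rw [integral_indicator_const _ measurableSet_Icc]
    simp
  have hD := h.pos
  rw [h1, ← integral_sub ((integrable_const _).indicator measurableSet_Icc)
    (h.integrable_smoothed ν hT hab)]
  refine (norm_integral_le_of_norm_le (((integrable_one_add_abs_zpow ν T a).add
    (integrable_one_add_abs_zpow ν T b)).const_mul D)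
    (ae_of_all _ (h.norm_indicator_sub_smoothed_le hT hab))).trans ?_
  simp only [Pi.add_apply]
  rw [integral_const_mul, integral_add (integrable_one_add_abs_zpow ν T a)
    (integrable_one_add_abs_zpow ν T b)]
  have ha := integral_one_add_abs_zpow_le ν hT hf a
  have hb := integral_one_add_abs_zpow_le ν hT hf b
  calc _ ≤ D * (64 / T + 64 / T) := by gcongr
    _ = _ := by ring

/-- On the Fourier side the factor `|v T|³` of the hypothesis meets the factor `2 / |v|` of the
interval, leaving `η T (v T)²` times a Gaussian, whose integral is `O(η)`, uniformly in `a` and `b`.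
-/
theorem norm_integral_smoothed_sub_le (h : IsSmoothingKernel ρ V D) (ν : Measure ℝ)
    [IsProbabilityMeasure ν] {T η : ℝ} (hT : 0 < T) (hη : 0 ≤ η) (a b : ℝ)
    (hfg : ∀ u : ℝ, |u| ≤ T → ‖charFun ν u - charFun (gaussianReal 0 1) u‖ ≤
      η * |u| ^ 3 * Real.exp (-u ^ 2 / 4)) :
    ‖(∫ w, smoothed V T a b w ∂ν) - ∫ w, smoothed V T a b w ∂(gaussianReal 0 1)‖ ≤ 48 * η := by
  have hJ : ∀ v : ℝ, ‖∫ y in a..b, (T : ℂ) * Complex.exp (v * T * y * Complex.I)‖ ≤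
      T * |b - a| := fun v => by
    refine intervalIntegral.norm_integral_le_of_norm_le_const fun y _ => ?_
    rw [norm_mul, show (v * T * y * Complex.I : ℂ) = ((v * T * y : ℝ) : ℂ) * Complex.I by
      push_cast; ring, Complex.norm_exp_ofReal_mul_I, mul_one, Complex.norm_real,
      Real.norm_eq_abs, abs_of_pos hT]
  have hpi3 := Real.pi_gt_three
  have hnp : ‖(1 / (2 * Real.pi) : ℂ)‖ = 1 / (2 * Real.pi) := by
    rw [show (1 / (2 * Real.pi) : ℂ) = ((1 / (2 * Real.pi) : ℝ) : ℂ) by push_cast; rfl,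
      Complex.norm_real, Real.norm_eq_abs, abs_of_pos (by positivity)]
  have hJc : Continuous fun v : ℝ => ∫ y in a..b, (T : ℂ) * Complex.exp (v * T * y * Complex.I) :=
    intervalIntegral.continuous_parametric_intervalIntegral_of_continuous' (by
      unfold Function.uncurry; fun_prop) a b
  have hint : ∀ (ν : Measure ℝ) [IsProbabilityMeasure ν], Integrable fun v : ℝ =>
      (1 / (2 * Real.pi) : ℂ) * (ρ v * charFun ν (-(v * T)) *
        ∫ y in a..b, (T : ℂ) * Complex.exp (v * T * y * Complex.I)) := by
    intro ν _
    refine (h.integrable_rho.mul_const (T * |b - a|)).mono' ?_ (ae_of_all _ fun v => ?_)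
    · have := h.continuous_rho
      have := continuous_charFun ν
      exact Continuous.aestronglyMeasurable (by fun_prop)
    · have h1 := norm_charFun_le_one (μ := ν) (-(v * T))
      have h2 := h.rho_nonneg v
      rw [norm_mul, norm_mul, norm_mul, hnp, Complex.norm_real, Real.norm_eq_abs, abs_of_nonneg h2]
      have h3 : 1 / (2 * Real.pi) ≤ 1 := by
        rw [div_le_one (by positivity)]; linarith
      calc _ ≤ 1 * (ρ v * 1 * (T * |b - a|)) := by
            gcongr
            exact hJ v
        _ = _ := by ring
  rw [h.integral_smoothed, h.integral_smoothed, ← integral_sub (hint _) (hint _)]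
  have hi8 := integrable_exp_neg_sq_div (T := T) (k := 8) hT.ne' (by norm_num)
  refine (norm_integral_le_of_norm_le (hi8.const_mul (8 * η * T)) ?_).trans ?_
  · have hne : ∀ᵐ v : ℝ, v ≠ 0 := by
      simp [ae_iff, measure_singleton]
    filter_upwards [hne] with v hv
    rw [← mul_sub, ← sub_mul, ← mul_sub, norm_mul, norm_mul, norm_mul, hnp, Complex.norm_real,
      Real.norm_eq_abs, abs_of_nonneg (h.rho_nonneg v)]
    by_cases hv1 : 1 < |v|
    · rw [h.rho_eq_zero v hv1]
      simp only [zero_mul, mul_zero]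
      positivity
    · push Not at hv1
      have h1 := hfg (-(v * T)) (by
        rw [abs_neg, abs_mul, abs_of_pos hT]
        nlinarith)
      have h2 := norm_interval_exp_le v hv hT a b
      have h3 := h.rho_le_one v
      have h4 := h.rho_nonneg v
      have hv0 : 0 < |v| := abs_pos.2 hv
      -- The polynomial factor is paid for by a weaker Gaussian.
      have h5 : (v * T) ^ 2 * Real.exp (-(v * T) ^ 2 / 4) ≤ 8 * Real.exp (-(v * T) ^ 2 / 8) := by
        have : (v * T) ^ 2 / 8 ≤ Real.exp ((v * T) ^ 2 / 8) := by
          linarith [Real.add_one_le_exp ((v * T) ^ 2 / 8)]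
        calc (v * T) ^ 2 * Real.exp (-(v * T) ^ 2 / 4)
            = 8 * ((v * T) ^ 2 / 8) * Real.exp (-(v * T) ^ 2 / 4) := by ring
          _ ≤ 8 * Real.exp ((v * T) ^ 2 / 8) * Real.exp (-(v * T) ^ 2 / 4) := by gcongr
          _ = 8 * Real.exp (-(v * T) ^ 2 / 8) := by
            rw [mul_assoc, ← Real.exp_add]; congr 2; ring
      calc _ ≤ 1 / (2 * Real.pi) * (1 * (η * |-(v * T)| ^ 3 * Real.exp (-(-(v * T)) ^ 2 / 4)) *
            (2 / |v|)) := by gcongr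
        _ = 1 / Real.pi * (η * T * ((v * T) ^ 2 * Real.exp (-(v * T) ^ 2 / 4))) := by
          rw [abs_neg, neg_sq, abs_mul, abs_of_pos hT]
          have : |v| ^ 3 = |v| * v ^ 2 := by rw [pow_succ', sq_abs]
          rw [mul_pow, this]
          field_simp
        _ ≤ 1 * (η * T * (8 * Real.exp (-(v * T) ^ 2 / 8))) := by
          gcongr
          rw [div_le_one (by positivity)]; linarith
        _ = _ := by ring
  · rw [integral_const_mul, integral_exp_neg_sq_div hT (by norm_num)]
    have hs : √(Real.pi * 8) ≤ 6 := by
      rw [Real.sqrt_le_left (by norm_num)]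
      linarith [Real.pi_le_four]
    calc 8 * η * T * (√(Real.pi * 8) / T) = 8 * η * √(Real.pi * 8) := by field_simp
      _ ≤ 8 * η * 6 := by gcongr
      _ = 48 * η := by ring

end IsSmoothingKernel

/-- A Berry–Esseen type inequality for the probabilities of intervals. -/
theorem exists_abs_measure_Icc_sub_gaussian_le : ∃ C : ℝ, 0 < C ∧ ∀ (ν : Measure ℝ)
    [IsProbabilityMeasure ν] (T η : ℝ), 0 < T → 0 ≤ η →
    (∀ u : ℝ, |u| ≤ T → ‖charFun ν u‖ ≤ Real.exp (-u ^ 2 / 4)) →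
    (∀ u : ℝ, |u| ≤ T → ‖charFun ν u - Real.exp (-u ^ 2 / 2)‖ ≤
      η * |u| ^ 3 * Real.exp (-u ^ 2 / 4)) →
    ∀ a b : ℝ, a ≤ b →
      |ν.real (Set.Icc a b) - (gaussianReal 0 1).real (Set.Icc a b)| ≤ C * (1 / T + η) := by
  obtain ⟨ρ, V, D, h⟩ := exists_isSmoothingKernel
  have hD := h.pos
  refine ⟨256 * D + 48, by positivity, fun ν _ T η hT hη hf hfg a b hab => ?_⟩
  have h1 := h.norm_measure_sub_integral_smoothed_le ν hT hab hf
  have h2 := h.norm_measure_sub_integral_smoothed_le (gaussianReal 0 1) hT hab (fun u _ => by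
    rw [norm_charFun_gaussian, Complex.norm_real, Real.norm_eq_abs, abs_of_pos (Real.exp_pos _),
      Real.exp_le_exp]
    nlinarith [sq_nonneg u])
  have h3 := h.norm_integral_smoothed_sub_le ν hT hη a b (fun u hu => by
    rw [norm_charFun_gaussian]; exact hfg u hu)
  have e : |ν.real (Set.Icc a b) - (gaussianReal 0 1).real (Set.Icc a b)| =
      ‖((ν.real (Set.Icc a b) : ℂ) - ∫ w, IsSmoothingKernel.smoothed V T a b w ∂ν) +
        ((∫ w, IsSmoothingKernel.smoothed V T a b w ∂ν) -
          ∫ w, IsSmoothingKernel.smoothed V T a b w ∂(gaussianReal 0 1)) -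
        (((gaussianReal 0 1).real (Set.Icc a b) : ℂ) -
          ∫ w, IsSmoothingKernel.smoothed V T a b w ∂(gaussianReal 0 1))‖ := by
    rw [← Real.norm_eq_abs, ← Complex.norm_real]
    congr 1
    push_cast
    ring
  rw [e]
  refine (norm_sub_le _ _).trans ?_
  refine (add_le_add (norm_add_le _ _) le_rfl).trans ?_
  have : 0 < 1 / T := by positivity
  calc _ ≤ 128 * D / T + 48 * η + 128 * D / T := by gcongr
    _ = 256 * D * (1 / T) + 48 * η := by ring
    _ ≤ _ := by nlinarith

/-! ### The Mills ratio -/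

/-- The Mills ratio `∫_0^∞ exp (- y t - t ^ 2 / 2) dt` of the standard normal law. -/
def mills (y : ℝ) : ℝ := ∫ t in Set.Ioi (0 : ℝ), Real.exp (-(y * t) - t ^ 2 / 2)

theorem integrableOn_mills {y : ℝ} (hy : 0 ≤ y) :
    IntegrableOn (fun t : ℝ => Real.exp (-(y * t) - t ^ 2 / 2)) (Set.Ioi 0) := by
  have h1 : Integrable fun t : ℝ => Real.exp (-(1 / 2) * t ^ 2) :=
    integrable_exp_neg_mul_sq (by norm_num)
  refine (h1.integrableOn (s := Set.Ioi 0)).mono'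
    (Continuous.aestronglyMeasurable (by fun_prop)) ?_
  refine (ae_restrict_mem measurableSet_Ioi).mono fun t ht => ?_
  rw [Real.norm_eq_abs, abs_of_pos (Real.exp_pos _), Real.exp_le_exp]
  have := mul_nonneg hy (le_of_lt (Set.mem_Ioi.1 ht))
  linarith

/-- On `(0, 1/(1+y)]` both `y t ≤ 1` and `t² / 2 ≤ 1/2`, so the integrand is at least `exp (-3/2)`.
-/
theorem le_mills {y : ℝ} (hy : 0 ≤ y) : Real.exp (-(3 / 2)) / (1 + y) ≤ mills y := by
  have hpos : 0 < 1 + y := by linarith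
  have h1 : ∫ _ in Set.Ioc (0 : ℝ) (1 / (1 + y)), Real.exp (-(3 / 2)) =
      Real.exp (-(3 / 2)) / (1 + y) := by
    rw [setIntegral_const, measureReal_def, Real.volume_Ioc, sub_zero,
      ENNReal.toReal_ofReal (by positivity), smul_eq_mul]
    ring
  rw [← h1]
  have hsub : Set.Ioc (0 : ℝ) (1 / (1 + y)) ⊆ Set.Ioi 0 := fun t ht => ht.1
  refine le_trans (setIntegral_mono_on (integrableOn_const (by simp))
    ((integrableOn_mills hy).mono_set hsub) measurableSet_Ioc fun t ht => ?_)
    (setIntegral_mono_set (integrableOn_mills hy) (ae_of_all _ fun t => (Real.exp_pos _).le)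
      hsub.eventuallyLE)
  rw [Real.exp_le_exp]
  have h2 : (1 + y) * t ≤ 1 := by
    have := ht.2
    rwa [le_div_iff₀ hpos, mul_comm] at this
  have ht0 := ht.1
  have h3 : t ≤ 1 := by nlinarith
  nlinarith

theorem mills_pos {y : ℝ} (hy : 0 ≤ y) : 0 < mills y :=
  lt_of_lt_of_le (div_pos (Real.exp_pos _) (by linarith)) (le_mills hy)

/-- The integrand is Lipschitz in `y` with constant `t exp (-m t)`, whose integral over the half
line is `1 / m²`. -/
theorem abs_mills_sub_le {a b m : ℝ} (hm : 0 < m) (ha : m ≤ a) (hb : m ≤ b) :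
    |mills a - mills b| ≤ |a - b| / m ^ 2 := by
  have h0 : ∫ t in Set.Ioi (0 : ℝ), t * Real.exp (-(m * t)) = 1 / m ^ 2 := by
    have := Real.integral_rpow_mul_exp_neg_mul_Ioi (a := 2) (by norm_num) hm
    norm_num at this
    rw [this]; norm_num
  have hi : IntegrableOn (fun t : ℝ => t * Real.exp (-(m * t))) (Set.Ioi 0) :=
    Integrable.of_integral_ne_zero (by rw [h0]; positivity)
  rw [mills, mills, ← integral_sub (integrableOn_mills (hm.le.trans ha))
    (integrableOn_mills (hm.le.trans hb)), ← Real.norm_eq_abs]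
  refine (norm_integral_le_of_norm_le (hi.const_mul |a - b|) ?_).trans_eq ?_
  · refine (ae_restrict_mem measurableSet_Ioi).mono fun t ht => ?_
    have ht0 : 0 < t := ht
    have key : ∀ a b : ℝ, m ≤ a → a ≤ b →
        |Real.exp (-(a * t) - t ^ 2 / 2) - Real.exp (-(b * t) - t ^ 2 / 2)| ≤
          |a - b| * (t * Real.exp (-(m * t))) := by
      intro a b ha hab
      have h1 : Real.exp (-(b * t) - t ^ 2 / 2) =
          Real.exp (-(a * t) - t ^ 2 / 2) * Real.exp (-((b - a) * t)) := by
        rw [← Real.exp_add]; congr 1; ring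
      have h2 : 1 - (b - a) * t ≤ Real.exp (-((b - a) * t)) := by
        linarith [Real.add_one_le_exp (-((b - a) * t))]
      have h3 : Real.exp (-((b - a) * t)) ≤ 1 := by
        rw [Real.exp_le_one_iff]
        have := mul_nonneg (sub_nonneg.2 hab) ht0.le
        linarith
      have h4 : Real.exp (-(a * t) - t ^ 2 / 2) ≤ Real.exp (-(m * t)) := by
        rw [Real.exp_le_exp]
        nlinarith [sq_nonneg t]
      rw [h1, abs_sub_comm a b, abs_of_nonneg (sub_nonneg.2 hab), ← mul_one_sub, abs_mul,
        abs_of_pos (Real.exp_pos _), abs_of_nonneg (by linarith)]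
      calc _ ≤ Real.exp (-(m * t)) * ((b - a) * t) := by
            gcongr
            linarith
        _ = _ := by ring
    rw [Real.norm_eq_abs]
    rcases le_total a b with hab | hab
    · exact key a b ha hab
    · rw [abs_sub_comm, abs_sub_comm a b]
      exact key b a hb hab
  · rw [integral_const_mul, h0]; ring

theorem setIntegral_gaussianReal (f : ℝ → ℝ) {s : Set ℝ} (hs : MeasurableSet s) :
    ∫ y in s, f y ∂(gaussianReal 0 1) =
      (√(2 * Real.pi))⁻¹ * ∫ y in s, Real.exp (-y ^ 2 / 2) * f y := by
  rw [← integral_indicator hs, integral_gaussianReal_eq_integral_smul one_ne_zero,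
    ← integral_indicator hs, ← integral_const_mul]
  congr 1
  funext y
  by_cases hy : y ∈ s
  · simp only [Set.indicator_of_mem hy, gaussianPDFReal, smul_eq_mul, NNReal.coe_one, mul_one,
      sub_zero]
    ring
  · simp [Set.indicator_of_notMem hy]

theorem setIntegral_exp_gaussianReal (y : ℝ) :
    ∫ t in Set.Ici 0, Real.exp (-(y * t)) ∂(gaussianReal 0 1) = (√(2 * Real.pi))⁻¹ * mills y := by
  rw [setIntegral_gaussianReal _ measurableSet_Ici, integral_Ici_eq_integral_Ioi, mills]
  congr 2
  funext t
  rw [← Real.exp_add]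
  congr 1; ring

theorem one_sub_Phi (x : ℝ) :
    1 - Phi x = (√(2 * Real.pi))⁻¹ * (Real.exp (-x ^ 2 / 2) * mills x) := by
  have h1 : 1 - Phi x = ∫ _ in Set.Ioi x, (1 : ℝ) ∂(gaussianReal 0 1) := by
    rw [Phi, cdf_eq_real, ← probReal_compl_eq_one_sub measurableSet_Iic, Set.compl_Iic]
    simp
  rw [h1, setIntegral_gaussianReal _ measurableSet_Ioi]
  congr 1
  have h2 := (measurePreserving_add_left volume x).setIntegral_preimage_emb
    (MeasurableEquiv.addLeft x).measurableEmbedding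
    (fun y => Real.exp (-y ^ 2 / 2) * 1) (Set.Ioi x)
  rw [← h2, mills, ← integral_const_mul]
  have h3 : (fun t => x + t) ⁻¹' Set.Ioi x = Set.Ioi 0 := by
    ext t; simp
  rw [h3]
  congr 1
  funext t
  rw [mul_one, ← Real.exp_add]
  congr 1; ring

/-! ### Laplace transforms on the half line -/

/-- The layer cake formula; levels above `1` do not occur. -/
theorem setIntegral_exp_eq (ν : Measure ℝ) [IsProbabilityMeasure ν] {y : ℝ} (hy : 0 ≤ y) :
    ∫ t in Set.Ici 0, Real.exp (-(y * t)) ∂ν =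
      ∫ u in Set.Ioc (0 : ℝ) 1,
        ν.real {t | u ≤ (Set.Ici 0).indicator (fun t => Real.exp (-(y * t))) t} := by
  have hle : ∀ t, (Set.Ici (0 : ℝ)).indicator (fun t => Real.exp (-(y * t))) t ≤ 1 := by
    intro t
    refine Set.indicator_apply_le' (fun ht => ?_) fun _ => zero_le_one
    rw [Real.exp_le_one_iff]
    have := mul_nonneg hy (Set.mem_Ici.1 ht)
    linarith
  have hnn : ∀ t, 0 ≤ (Set.Ici (0 : ℝ)).indicator (fun t => Real.exp (-(y * t))) t := fun t =>
    Set.indicator_nonneg (fun _ _ => (Real.exp_pos _).le) t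
  rw [← integral_indicator measurableSet_Ici]
  refine Integrable.integral_eq_integral_Ioc_meas_le ?_ (ae_of_all _ hnn) (ae_of_all _ hle)
  refine (integrable_const (1 : ℝ)).mono' ?_ (ae_of_all _ fun t => ?_)
  · exact ((by fun_prop : Measurable fun t : ℝ => Real.exp (-(y * t))).indicator
      measurableSet_Ici).aestronglyMeasurable
  · rw [Real.norm_eq_abs, abs_of_nonneg (hnn t)]
    exact hle t

theorem abs_measure_Ici_sub_le {ν γ : Measure ℝ} [IsProbabilityMeasure ν] [IsProbabilityMeasure γ]
    {δ : ℝ} (h : ∀ a b : ℝ, a ≤ b → |ν.real (Set.Icc a b) - γ.real (Set.Icc a b)| ≤ δ) (a : ℝ) :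
    |ν.real (Set.Ici a) - γ.real (Set.Ici a)| ≤ δ := by
  have hlim : ∀ (ν : Measure ℝ) [IsProbabilityMeasure ν],
      Tendsto (fun n : ℕ => ν.real (Set.Icc a (a + n))) atTop (𝓝 (ν.real (Set.Ici a))) := by
    intro ν _
    have hU : ⋃ n : ℕ, Set.Icc a (a + n) = Set.Ici a := by
      ext t
      simp only [Set.mem_iUnion, Set.mem_Icc, Set.mem_Ici]
      constructor
      · rintro ⟨n, h1, _⟩; exact h1
      · intro ht
        obtain ⟨n, hn⟩ := exists_nat_ge (t - a)
        exact ⟨n, ht, by linarith⟩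
    have hm : Monotone fun n : ℕ => Set.Icc a (a + n) := fun m n hmn =>
      Set.Icc_subset_Icc_right (by
        have : (m : ℝ) ≤ n := by exact_mod_cast hmn
        linarith)
    have := tendsto_measure_iUnion_atTop (μ := ν) hm
    rw [hU] at this
    exact (ENNReal.tendsto_toReal (measure_ne_top ν _)).comp this
  refine le_of_tendsto ((hlim ν).sub (hlim γ)).abs (Eventually.of_forall fun n => ?_)
  exact h a (a + n) (by linarith [Nat.cast_nonneg (α := ℝ) n])

/-- The superlevel sets of `t ↦ exp (-y t)` on the half line are the intervals `[0, -log u / y]`, so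
a uniform bound on intervals passes through the layer cake formula without loss. -/
theorem abs_setIntegral_exp_sub_le {ν γ : Measure ℝ} [IsProbabilityMeasure ν]
    [IsProbabilityMeasure γ] {δ : ℝ}
    (h : ∀ a b : ℝ, a ≤ b → |ν.real (Set.Icc a b) - γ.real (Set.Icc a b)| ≤ δ)
    {y : ℝ} (hy : 0 ≤ y) :
    |(∫ t in Set.Ici 0, Real.exp (-(y * t)) ∂ν) - ∫ t in Set.Ici 0, Real.exp (-(y * t)) ∂γ| ≤
      δ := by
  set f : ℝ → ℝ := (Set.Ici 0).indicator (fun t => Real.exp (-(y * t))) with hf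
  have hint : ∀ (ν : Measure ℝ) [IsProbabilityMeasure ν],
      IntegrableOn (fun u => ν.real {t | u ≤ f t}) (Set.Ioc (0 : ℝ) 1) := by
    intro ν _
    have hanti : Antitone fun u => ν.real {t | u ≤ f t} := fun u v huv =>
      measureReal_mono (fun t ht => huv.trans ht)
    have := hanti.intervalIntegrable (μ := volume) (a := 0) (b := 1)
    rwa [intervalIntegrable_iff_integrableOn_Ioc_of_le zero_le_one] at this
  have hset : ∀ u ∈ Set.Ioc (0 : ℝ) 1,
      |ν.real {t | u ≤ f t} - γ.real {t | u ≤ f t}| ≤ δ := by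
    intro u hu
    have hmem : ∀ t, u ≤ f t ↔ 0 ≤ t ∧ y * t ≤ -Real.log u := by
      intro t
      by_cases ht : 0 ≤ t
      · rw [hf, Set.indicator_of_mem (Set.mem_Ici.2 ht), ← Real.log_le_iff_le_exp hu.1]
        constructor
        · intro h1; exact ⟨ht, by linarith⟩
        · rintro ⟨_, h1⟩; linarith
      · rw [hf, Set.indicator_of_notMem (by simpa using ht)]
        constructor
        · intro h1; exact absurd h1 (by linarith [hu.1])
        · rintro ⟨h1, _⟩; exact absurd h1 ht
    have hlog : 0 ≤ -Real.log u := by linarith [Real.log_nonpos hu.1.le hu.2]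
    -- For `y = 0` the superlevel set is the whole half line, reached as a limit of intervals.
    rcases hy.eq_or_lt with h0 | h0
    · have : {t | u ≤ f t} = Set.Ici 0 := by
        ext t
        rw [Set.mem_ofPred_eq, hmem, ← h0, zero_mul, Set.mem_Ici]
        exact ⟨fun h => h.1, fun h => ⟨h, hlog⟩⟩
      rw [this]
      exact abs_measure_Ici_sub_le h 0
    · have : {t | u ≤ f t} = Set.Icc 0 (-Real.log u / y) := by
        ext t
        rw [Set.mem_ofPred_eq, hmem, Set.mem_Icc, le_div_iff₀ h0, mul_comm]
      rw [this]
      exact h _ _ (by positivity)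
  rw [setIntegral_exp_eq ν hy, setIntegral_exp_eq γ hy, ← integral_sub (hint ν) (hint γ),
    ← Real.norm_eq_abs]
  have := norm_setIntegral_le_of_norm_le_const (μ := volume) (s := Set.Ioc (0 : ℝ) 1) (C := δ)
    (f := fun u => ν.real {t | u ≤ f t} - γ.real {t | u ≤ f t}) (by simp) (fun u hu => by
      rw [Real.norm_eq_abs]; exact hset u hu)
  simpa using this

/-! ### Cramér's theorem for a law with a controlled moment generating function -/

theorem norm_exp_sub_one_le_mul_exp (z : ℂ) : ‖Complex.exp z - 1‖ ≤ ‖z‖ * Real.exp ‖z‖ := by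
  simpa using Complex.norm_exp_sub_sum_le_norm_mul_exp z 1

/-- The moment generating function of `ν` is `exp (z ^ 2 / 2 + Δ ^ 2 E (z / Δ))` on the disc
of radius `R Δ`. -/
structure HasCubicCGF (ν : Measure ℝ) (E : ℂ → ℂ) (R Δ : ℝ) : Prop where
  integrable : ∀ z : ℂ, ‖z‖ < R * Δ → Integrable (fun w : ℝ => Complex.exp (z * w)) ν
  integral_eq : ∀ z : ℂ, ‖z‖ < R * Δ →
    ∫ w : ℝ, Complex.exp (z * w) ∂ν = Complex.exp (z ^ 2 / 2 + Δ ^ 2 * E (z / Δ))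

namespace CubicRemainder

variable {E : ℂ → ℂ} {A R : ℝ}

theorem ofReal_re_saddle (h : CubicRemainder E A R) {t : ℝ}
    (ht : ‖(t : ℂ)‖ < saddleRadius A R / 2) : ((saddle E t).re : ℂ) = saddle E t :=
  Complex.conj_eq_iff_re.1 (by rw [← h.saddle_conj ht, Complex.conj_ofReal])

theorem ofReal_re_apply (h : CubicRemainder E A R) (p : ℝ) : ((E p).re : ℂ) = E p :=
  Complex.conj_eq_iff_re.1 (by rw [← h.conj, Complex.conj_ofReal])

theorem ofReal_re_deriv2 (h : CubicRemainder E A R) (p : ℝ) :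
    ((deriv (deriv E) p).re : ℂ) = deriv (deriv E) p :=
  Complex.conj_eq_iff_re.1 (by rw [← h.deriv2_conj, Complex.conj_ofReal])

end CubicRemainder

/-- The law of the tilted and standardized variable. -/
def tiltedLaw (ν : Measure ℝ) (h x s : ℝ) : Measure ℝ :=
  (ν.tilted fun w => h * w).map fun w => (w - x) / s

namespace HasCubicCGF

variable {E : ℂ → ℂ} {R Δ : ℝ} {ν : Measure ℝ}

theorem integrable_real (hν : HasCubicCGF ν E R Δ) {h : ℝ} (hh : |h| < R * Δ) :
    Integrable (fun w : ℝ => Real.exp (h * w)) ν := by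
  have := (hν.integrable h (by simpa using hh)).norm
  refine this.congr (ae_of_all _ fun w => ?_)
  simp only
  rw [← Complex.ofReal_mul, ← Complex.ofReal_exp, Complex.norm_real, Real.norm_eq_abs,
    abs_of_pos (Real.exp_pos _)]

theorem ofReal_integral (hν : HasCubicCGF ν E R Δ) {h : ℝ} (hh : |h| < R * Δ) :
    ((∫ w : ℝ, Real.exp (h * w) ∂ν : ℝ) : ℂ) =
      Complex.exp ((h : ℂ) ^ 2 / 2 + Δ ^ 2 * E (h / Δ)) := by
  rw [← hν.integral_eq h (by simpa using hh), ← integral_complex_ofReal]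
  congr 1
  funext w
  push_cast
  rfl

/-- The characteristic function of a tilted law is the quotient of the moment generating function at
`h + i u / s` by its value at `h`; centring contributes the phase. -/
theorem charFun_tiltedLaw (hν : HasCubicCGF ν E R Δ) {h x s u : ℝ}
    (hh : |h| < R * Δ) (hu : ‖(h + (u / s : ℝ) * Complex.I : ℂ)‖ < R * Δ) :
    charFun (tiltedLaw ν h x s) u =
      Complex.exp ((((h + (u / s : ℝ) * Complex.I : ℂ)) ^ 2 / 2 +
        Δ ^ 2 * E ((h + (u / s : ℝ) * Complex.I) / Δ)) -
        ((h : ℂ) ^ 2 / 2 + Δ ^ 2 * E (h / Δ)) - (u / s : ℝ) * x * Complex.I) := by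
  rw [charFun_apply_real, tiltedLaw, integral_map (by fun_prop)
    (Continuous.aestronglyMeasurable (by fun_prop)), integral_tilted, Complex.exp_sub,
    Complex.exp_sub, ← hν.ofReal_integral hh, ← hν.integral_eq _ hu, div_div, ← integral_div]
  congr 1
  funext w
  have e : Complex.exp ((h + (u / s : ℝ) * Complex.I) * w) = Complex.exp (h * w) *
      Complex.exp (u * ((w - x) / s : ℝ) * Complex.I) *
      Complex.exp ((u / s : ℝ) * x * Complex.I) := by
    rw [← Complex.exp_add, ← Complex.exp_add]
    congr 1
    push_cast
    ring
  rw [e, Complex.real_smul, Complex.ofReal_div, Complex.ofReal_exp, Complex.ofReal_mul]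
  have := Complex.exp_ne_zero ((u / s : ℝ) * x * Complex.I)
  rw [mul_comm (((∫ w : ℝ, Real.exp (h * w) ∂ν : ℝ) : ℂ)), mul_div_mul_comm, mul_div_right_comm]
  field_simp

variable [IsProbabilityMeasure ν]

theorem isProbabilityMeasure_tiltedLaw (hν : HasCubicCGF ν E R Δ) {h : ℝ} (hh : |h| < R * Δ)
    (x s : ℝ) : IsProbabilityMeasure (tiltedLaw ν h x s) := by
  have := isProbabilityMeasure_tilted (hν.integrable_real hh)
  exact Measure.isProbabilityMeasure_map (by fun_prop)

/-- The tilt is undone under the substitution `w = x + s t`: the density of `ν` with respect to the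
tilted law is the normalising constant times `exp (-h x) exp (-h s t)`. -/
theorem measure_Ici_eq (hν : HasCubicCGF ν E R Δ) {h x s : ℝ} (hs : 0 < s)
    (hh : |h| < R * Δ) :
    ν.real (Set.Ici x) = (∫ w : ℝ, Real.exp (h * w) ∂ν) * Real.exp (-(h * x)) *
      ∫ t in Set.Ici 0, Real.exp (-(h * s * t)) ∂(tiltedLaw ν h x s) := by
  have hM : 0 < ∫ w : ℝ, Real.exp (h * w) ∂ν := integral_exp_pos (hν.integrable_real hh)
  have hpre : (fun w : ℝ => (w - x) / s) ⁻¹' Set.Ici 0 = Set.Ici x := by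
    ext w
    simp only [Set.mem_preimage, Set.mem_Ici]
    rw [le_div_iff₀ hs, zero_mul, sub_nonneg]
  rw [tiltedLaw, setIntegral_map measurableSet_Ici
    (Continuous.aestronglyMeasurable (by fun_prop)) (by fun_prop), hpre, setIntegral_tilted]
  have he : ∀ w : ℝ, (Real.exp (h * w) / ∫ w : ℝ, Real.exp (h * w) ∂ν) •
      Real.exp (-(h * s * ((w - x) / s))) =
        Real.exp (h * x) / ∫ w : ℝ, Real.exp (h * w) ∂ν := by
    intro w
    rw [smul_eq_mul, div_mul_eq_mul_div, ← Real.exp_add]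
    congr 2
    field_simp
    ring
  simp_rw [he]
  rw [setIntegral_const, smul_eq_mul]
  have : Real.exp (-(h * x)) * Real.exp (h * x) = 1 := by rw [← Real.exp_add]; simp
  field_simp
  linear_combination (-ν.real (Set.Ici x)) * this

end HasCubicCGF

/-! ### The law tilted to the saddle point -/

/-- The data of the saddle point attached to `t`: the point `p` and the standard deviation `s` of
the tilted law. -/
structure IsSaddle (E : ℂ → ℂ) (A R t p s : ℝ) : Prop where
  nonneg : 0 ≤ p
  le : p ≤ 2 * t
  le_radius : p ≤ R / 32
  eq_saddle : (p : ℂ) = saddle E t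
  abs_sub_le : |p - t| ≤ 32 * A * t ^ 2
  add_deriv : (p : ℂ) + deriv E p = t
  half_le : 1 / 2 ≤ s
  abs_sub_one_le : |s - 1| ≤ 32 * A * p
  sq_eq : (s : ℂ) ^ 2 = 1 + deriv (deriv E) p

theorem CubicRemainder.exists_isSaddle {E : ℂ → ℂ} {A R t : ℝ} (hE : CubicRemainder E A R)
    (ht0 : 0 ≤ t) (htr : t ≤ saddleRadius A R / 4) (htA : 320 * A * t ≤ 1) :
    ∃ p s, IsSaddle E A R t p s := by
  have hA := hE.pos_const
  have hR := hE.pos_radius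
  have hr0 := hE.saddleRadius_pos
  have hnt : ‖(t : ℂ)‖ = t := by simp [abs_of_nonneg ht0]
  have htlt : ‖(t : ℂ)‖ < saddleRadius A R / 2 := by rw [hnt]; linarith
  obtain ⟨p, hpc⟩ : ∃ p : ℝ, (p : ℂ) = saddle E t := ⟨_, hE.ofReal_re_saddle htlt⟩
  have hp2 : |p| ≤ 2 * t := by
    have := hE.norm_saddle_le htlt
    rwa [← hpc, hnt, Complex.norm_real, Real.norm_eq_abs] at this
  have hpt : |p - t| ≤ 32 * A * t ^ 2 := by
    have := hE.norm_saddle_sub_le htlt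
    rwa [← hpc, hnt, ← Complex.ofReal_sub, Complex.norm_real, Real.norm_eq_abs] at this
  -- `|p - t| ≤ 32 A t² ≤ t / 10`, by the hypothesis `320 A t ≤ 1`.
  have hp0 : 0 ≤ p := by
    have := (abs_le.1 hpt).1
    nlinarith
  rw [abs_of_nonneg hp0] at hp2
  have hrR : saddleRadius A R ≤ R / 16 := saddleRadius_le A R
  have hpn : ‖(p : ℂ)‖ = p := by simp [abs_of_nonneg hp0]
  -- The variance of the tilted law is the second derivative of `z²/2 + E` at `p`, so `s` is taken
  -- to be `√(1 + κ)`.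
  obtain ⟨κ, hκc⟩ : ∃ κ : ℝ, (κ : ℂ) = deriv (deriv E) p := ⟨_, hE.ofReal_re_deriv2 p⟩
  have hκ1 : |κ| ≤ 32 * A * p := by
    have := hE.norm_deriv2_le (z := (p : ℂ)) (by rw [hpn]; linarith)
    rwa [← hκc, hpn, Complex.norm_real, Real.norm_eq_abs] at this
  have hκ2 : |κ| ≤ 1 / 2 := by nlinarith
  have hκ3 := abs_le.1 hκ2
  have hs2 : √(1 + κ) ^ 2 = 1 + κ := Real.sq_sqrt (by linarith)
  have hs0 : 0 < √(1 + κ) := Real.sqrt_pos.2 (by linarith)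
  refine ⟨p, √(1 + κ), hp0, hp2, by linarith, hpc, hpt, ?_, by nlinarith, ?_, ?_⟩
  · have := hE.saddle_eq htlt
    rw [← hpc] at this
    linear_combination this
  · refine le_trans ?_ hκ1
    have h1 : |κ| = |√(1 + κ) - 1| * (√(1 + κ) + 1) := by
      rw [← abs_of_pos (by linarith : 0 < √(1 + κ) + 1), ← abs_mul]
      congr 1
      linarith
    rw [h1]
    have := abs_nonneg (√(1 + κ) - 1)
    nlinarith
  · rw [← hκc]
    exact_mod_cast hs2

/-- Expand `E` to second order at `p`. The linear terms cancel because `p + E'(p) = t`, the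
quadratic ones give exactly `-u²/2` because `s² = 1 + E''(p)`, and `ξ` is `Δ²` times the cubic
remainder. Since `s ≥ 1/2`, the unscaled frequency is at most `2|u|`, whence `512 = 64 · 2³`. -/
theorem IsSaddle.charFun_tiltedLaw {E : ℂ → ℂ} {A R t p s τ Δ : ℝ} {ν : Measure ℝ}
    [IsProbabilityMeasure ν] (hp : IsSaddle E A R t p s) (hE : CubicRemainder E A R)
    (hΔ : 0 < Δ) (hν : HasCubicCGF ν E R Δ) (hτR : τ ≤ R / 64) (hτA : 2048 * A * τ ≤ 1)
    {u : ℝ} (hu : |u| ≤ τ * Δ) :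
    ∃ ξ : ℂ, ‖ξ‖ ≤ 512 * A / Δ * |u| ^ 3 ∧ ‖ξ‖ ≤ u ^ 2 / 4 ∧
      charFun (tiltedLaw ν (Δ * p) (Δ * t) s) u = Real.exp (-u ^ 2 / 2) * Complex.exp ξ := by
  have hA := hE.pos_const
  have hR := hE.pos_radius
  have hs0 : 0 < s := by linarith [hp.half_le]
  have hp0 := hp.nonneg
  have hpn : ‖(p : ℂ)‖ = p := by simp [abs_of_nonneg hp0]
  have hh0 : 0 ≤ Δ * p := by positivity
  have hhR : |Δ * p| < R * Δ := by
    rw [abs_of_nonneg hh0, mul_comm]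
    gcongr
    linarith [hp.le_radius]
  obtain ⟨v, hv⟩ : ∃ v : ℝ, v = u / s := ⟨_, rfl⟩
  have hv2 : |v| ≤ 2 * |u| := by
    rw [hv, abs_div, abs_of_pos hs0, div_le_iff₀ hs0]
    have := abs_nonneg u
    nlinarith [hp.half_le]
  have hus : u = v * s := by rw [hv]; field_simp
  obtain ⟨w, hw⟩ : ∃ w : ℂ, w = ((v / Δ : ℝ) : ℂ) * Complex.I := ⟨_, rfl⟩
  have hwn : ‖w‖ = |v| / Δ := by
    rw [hw, norm_mul, Complex.norm_I, mul_one, Complex.norm_real, Real.norm_eq_abs, abs_div,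
      abs_of_pos hΔ]
  have hwτ : ‖w‖ ≤ 2 * τ := by
    rw [hwn, div_le_iff₀ hΔ]; linarith
  have hwR : ‖w‖ < R / 16 := by linarith
  have htay := hE.norm_taylor_le (p := (p : ℂ)) (by rw [hpn]; linarith [hp.le_radius]) hwR
  have hΔc : (Δ : ℂ) ≠ 0 := by exact_mod_cast hΔ.ne'
  refine ⟨Δ ^ 2 * (E (p + w) - E p - w * deriv E p - w ^ 2 / 2 * deriv (deriv E) p), ?_⟩
  have hb : ‖(Δ : ℂ) ^ 2 * (E (p + w) - E p - w * deriv E p -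
      w ^ 2 / 2 * deriv (deriv E) p)‖ ≤ 512 * A / Δ * |u| ^ 3 := by
    rw [norm_mul, norm_pow, Complex.norm_real, Real.norm_eq_abs, abs_of_pos hΔ]
    calc _ ≤ Δ ^ 2 * (64 * A * ‖w‖ ^ 3) := by gcongr
      _ = 64 * A / Δ * |v| ^ 3 := by rw [hwn]; field_simp
      _ ≤ 64 * A / Δ * (2 * |u|) ^ 3 := by gcongr
      _ = _ := by ring
  refine ⟨hb, hb.trans ?_, ?_⟩
  · have h1 : 512 * A / Δ * |u| ≤ 1 / 4 := by
      rw [div_mul_eq_mul_div, div_le_iff₀ hΔ]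
      calc 512 * A * |u| ≤ 512 * A * (τ * Δ) := by gcongr
        _ = 2048 * A * τ * (1 / 4 * Δ) := by ring
        _ ≤ 1 * (1 / 4 * Δ) := by gcongr
        _ = _ := one_mul _
    calc 512 * A / Δ * |u| ^ 3 = 512 * A / Δ * |u| * u ^ 2 := by
          rw [← sq_abs u]; ring
      _ ≤ 1 / 4 * u ^ 2 := by gcongr
      _ = _ := by ring
  · have e3 : ((Δ * p : ℝ) : ℂ) = Δ * p := by push_cast; rfl
    rw [hν.charFun_tiltedLaw hhR]
    · rw [Complex.ofReal_exp, ← Complex.exp_add]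
      congr 1
      have e4 : (v : ℂ) * Complex.I = Δ * w := by rw [hw]; push_cast; field_simp
      have e1 : ((Δ * p : ℂ) + Δ * w) / Δ = p + w := by field_simp
      have e2 : (Δ * p : ℂ) / Δ = p := by field_simp
      have e6 : ((-u ^ 2 / 2 : ℝ) : ℂ) = (Δ * w) ^ 2 * (1 + deriv (deriv E) p) / 2 := by
        rw [← hp.sq_eq, ← e4, hus]
        push_cast
        rw [mul_pow _ Complex.I, Complex.I_sq]
        ring
      rw [← hv, mul_right_comm _ _ Complex.I, e4, e3, e1, e2, e6, Complex.ofReal_mul, ← hp.add_deriv]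
      ring
    · rw [← hv]
      calc ‖((Δ * p : ℝ) : ℂ) + v * Complex.I‖ ≤ ‖((Δ * p : ℝ) : ℂ)‖ + ‖v * Complex.I‖ :=
            norm_add_le _ _
        _ = Δ * p + |v| := by
            rw [norm_mul, Complex.norm_I, mul_one, Complex.norm_real, Complex.norm_real,
              Real.norm_eq_abs, Real.norm_eq_abs, abs_of_nonneg hh0]
        _ < R * Δ := by
            have h1 : |v| ≤ 2 * (R / 64 * Δ) := by
              calc |v| ≤ 2 * |u| := hv2
                _ ≤ 2 * (τ * Δ) := by gcongr
                _ ≤ _ := by gcongr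
            have h2 : Δ * p ≤ Δ * (R / 32) := by gcongr; exact hp.le_radius
            nlinarith

/-- The smoothing inequality with `T = τ Δ` and `η = 512 A / Δ`: both error terms are of order
`1/Δ`. The bound `‖ξ‖ ≤ u²/4` provides the Gaussian domination that it requires. -/
theorem IsSaddle.abs_measure_Icc_sub_le {C : ℝ} (hBE : ∀ (ν : Measure ℝ)
    [IsProbabilityMeasure ν] (T η : ℝ), 0 < T → 0 ≤ η →
    (∀ u : ℝ, |u| ≤ T → ‖charFun ν u‖ ≤ Real.exp (-u ^ 2 / 4)) →
    (∀ u : ℝ, |u| ≤ T → ‖charFun ν u - Real.exp (-u ^ 2 / 2)‖ ≤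
      η * |u| ^ 3 * Real.exp (-u ^ 2 / 4)) →
    ∀ a b : ℝ, a ≤ b →
      |ν.real (Set.Icc a b) - (gaussianReal 0 1).real (Set.Icc a b)| ≤ C * (1 / T + η))
    {E : ℂ → ℂ} {A R t p s τ Δ : ℝ} {ν : Measure ℝ}
    [IsProbabilityMeasure ν] (hp : IsSaddle E A R t p s) (hE : CubicRemainder E A R)
    (hΔ : 0 < Δ) (hν : HasCubicCGF ν E R Δ) (hτ0 : 0 < τ) (hτR : τ ≤ R / 64)
    (hτA : 2048 * A * τ ≤ 1)
    [IsProbabilityMeasure (tiltedLaw ν (Δ * p) (Δ * t) s)] (a b : ℝ) (hab : a ≤ b) :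
    |(tiltedLaw ν (Δ * p) (Δ * t) s).real (Set.Icc a b) -
      (gaussianReal 0 1).real (Set.Icc a b)| ≤ C * (1 / (τ * Δ) + 512 * A / Δ) := by
  have hA := hE.pos_const
  refine hBE _ (τ * Δ) (512 * A / Δ) (by positivity) (by positivity)
    (fun u hu => ?_) (fun u hu => ?_) a b hab
  · obtain ⟨ξ, _, h2, h3⟩ := hp.charFun_tiltedLaw hE hΔ hν hτR hτA hu
    rw [h3, norm_mul, Complex.norm_real, Real.norm_eq_abs, abs_of_pos (Real.exp_pos _),
      Complex.norm_exp, ← Real.exp_add, Real.exp_le_exp]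
    linarith [Complex.re_le_norm ξ]
  · obtain ⟨ξ, h1, h2, h3⟩ := hp.charFun_tiltedLaw hE hΔ hν hτR hτA hu
    rw [h3, ← mul_sub_one, norm_mul, Complex.norm_real, Real.norm_eq_abs,
      abs_of_pos (Real.exp_pos _)]
    calc _ ≤ Real.exp (-u ^ 2 / 2) * (512 * A / Δ * |u| ^ 3 * Real.exp (u ^ 2 / 4)) := by
          gcongr
          exact (norm_exp_sub_one_le_mul_exp ξ).trans (by gcongr)
      _ = 512 * A / Δ * |u| ^ 3 * (Real.exp (-u ^ 2 / 2) * Real.exp (u ^ 2 / 4)) := by ring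
      _ = _ := by
          rw [← Real.exp_add]; congr 2; ring

/-- The exact Laplace argument `Δ p s` differs from `x = Δ t` by at most `160 A t x`, and the Mills
ratio has Lipschitz constant `4 / x²` beyond `x / 2`. The factors of `t` cancel, leaving an error
uniform in `x`. -/
theorem IsSaddle.abs_mills_sub_le {E : ℂ → ℂ} {A R t p s Δ : ℝ} (hp : IsSaddle E A R t p s)
    (hA : 0 < A) (ht0 : 0 ≤ t) (htA : 320 * A * t ≤ 1) (hΔ : 0 < Δ) :
    |mills (Δ * p * s) - mills (Δ * t)| ≤ 640 * A / Δ := by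
  have hp0 := hp.nonneg
  have hd : |Δ * p * s - Δ * t| ≤ 160 * A * t * (Δ * t) := by
    have e : Δ * p * s - Δ * t = Δ * (p * (s - 1) + (p - t)) := by ring
    rw [e, abs_mul, abs_of_pos hΔ]
    calc Δ * |p * (s - 1) + (p - t)| ≤ Δ * (p * (32 * A * p) + 32 * A * t ^ 2) := by
          gcongr
          refine (abs_add_le _ _).trans (add_le_add ?_ hp.abs_sub_le)
          rw [abs_mul, abs_of_nonneg hp0]
          gcongr
          exact hp.abs_sub_one_le
      _ ≤ Δ * ((2 * t) * (32 * A * (2 * t)) + 32 * A * t ^ 2) := by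
          have := hp.le
          gcongr
      _ = 160 * A * t * (Δ * t) := by ring
  rcases ht0.eq_or_lt with h0 | h0
  · have : Δ * p * s = Δ * t := by
      rw [← h0, mul_zero, mul_zero] at hd
      have := abs_nonpos_iff.1 hd
      rw [← h0]
      linarith
    rw [this, sub_self, abs_zero]
    positivity
  · have hx : 0 < Δ * t := by positivity
    have hm : Δ * t / 2 ≤ Δ * p * s := by
      have := (abs_le.1 hd).1
      nlinarith
    refine (LinearRandomField.abs_mills_sub_le (m := Δ * t / 2) (by positivity) hm
      (by linarith)).trans ?_
    calc |Δ * p * s - Δ * t| / (Δ * t / 2) ^ 2 ≤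
          (160 * A * t * (Δ * t)) / (Δ * t / 2) ^ 2 := by gcongr
      _ = 640 * A / Δ := by field_simp; norm_num

/-- An exact identity resting on `p²/2 + E(p) - p t = (E(p) + (p - t)²/2) - t²/2`: the last term
cancels against the Gaussian factor of `1 - Φ(x)`. -/
theorem IsSaddle.measure_Ici_div {E : ℂ → ℂ} {A R t p s Δ : ℝ} {ν : Measure ℝ}
    [IsProbabilityMeasure ν] (hp : IsSaddle E A R t p s) (hE : CubicRemainder E A R)
    (ht0 : 0 ≤ t) (hΔ : 0 < Δ) (hν : HasCubicCGF ν E R Δ) :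
    ν.real (Set.Ici (Δ * t)) / (1 - Phi (Δ * t)) =
      Real.exp (Δ ^ 2 * (legendreRemainder E (t : ℂ)).re) *
        ((√(2 * Real.pi) * ∫ t in Set.Ici 0, Real.exp (-(Δ * p * s * t))
          ∂(tiltedLaw ν (Δ * p) (Δ * t) s)) / mills (Δ * t)) := by
  have hR := hE.pos_radius
  have hmp := mills_pos (y := Δ * t) (by positivity)
  have hs0 : 0 < s := by linarith [hp.half_le]
  have hp0 := hp.nonneg
  have hhR : |Δ * p| < R * Δ := by
    rw [abs_of_nonneg (by positivity), mul_comm]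
    gcongr
    linarith [hp.le_radius]
  have hMGF : ∫ w : ℝ, Real.exp (Δ * p * w) ∂ν =
      Real.exp ((Δ * p) ^ 2 / 2 + Δ ^ 2 * (E p).re) := by
    have h1 := hν.ofReal_integral hhR
    have e2 : ((Δ * p : ℝ) : ℂ) / Δ = p := by
      have hΔc : (Δ : ℂ) ≠ 0 := by exact_mod_cast hΔ.ne'
      push_cast; field_simp
    rw [e2, ← hE.ofReal_re_apply] at h1
    exact_mod_cast h1
  have hG : (legendreRemainder E (t : ℂ)).re = (E p).re + (p - t) ^ 2 / 2 := by
    rw [legendreRemainder, ← hp.eq_saddle, Complex.add_re]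
    congr 1
    have : ((p : ℂ) - t) ^ 2 / 2 = (((p - t) ^ 2 / 2 : ℝ) : ℂ) := by push_cast; rfl
    rw [this, Complex.ofReal_re]
  rw [hν.measure_Ici_eq hs0 hhR, one_sub_Phi, hMGF, hG]
  have e : Real.exp (Δ ^ 2 * ((E p).re + (p - t) ^ 2 / 2)) * Real.exp (-(Δ * t) ^ 2 / 2) =
      Real.exp ((Δ * p) ^ 2 / 2 + Δ ^ 2 * (E p).re) * Real.exp (-(Δ * p * (Δ * t))) := by
    rw [← Real.exp_add, ← Real.exp_add]
    congr 1
    ring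
  rw [← e]
  have h1 := Real.exp_ne_zero (-(Δ * t) ^ 2 / 2)
  have h2 : √(2 * Real.pi) ≠ 0 := by positivity
  have h3 := hmp.ne'
  generalize Real.exp (-(Δ * t) ^ 2 / 2) = a at *
  generalize Real.exp (Δ ^ 2 * ((E p).re + (p - t) ^ 2 / 2)) = b at *
  generalize mills (Δ * t) = c at *
  generalize √(2 * Real.pi) = d at *
  field_simp

/-- The constants depend on `A` and `R` alone, which makes the expansion uniform in `n`. An absolute
error `O(1/Δ)` in the Laplace integral becomes a relative error `O((x + 1)/Δ)` after division by the
Mills ratio. -/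
theorem exists_cramer_of_hasCubicCGF {A R : ℝ} (hA : 0 < A) (hR : 0 < R) :
    ∃ ε > 0, ∃ K : ℝ, ∀ (E : ℂ → ℂ), CubicRemainder E A R → ∀ Δ : ℝ, 0 < Δ →
      ∀ (ν : Measure ℝ) [IsProbabilityMeasure ν], HasCubicCGF ν E R Δ →
      ∀ x : ℝ, 0 ≤ x → x ≤ ε * Δ → ∃ θ : ℝ, |θ| ≤ K * ((x + 1) / Δ) ∧
        ν.real (Set.Ici x) / (1 - Phi x) =
          Real.exp (Δ ^ 2 * (legendreRemainder E ((x / Δ : ℝ) : ℂ)).re) * (1 + θ) := by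
  obtain ⟨C, hC, hBE⟩ := exists_abs_measure_Icc_sub_gaussian_le
  have hr0 : 0 < CubicRemainder.saddleRadius A R := lt_min (by positivity) (by positivity)
  -- Frequencies up to `τ Δ` stay in the disc of the Taylor expansion and keep the cubic remainder
  -- below `u²/4`.
  obtain ⟨τ, hτ0, hτR, hτA⟩ : ∃ τ : ℝ, 0 < τ ∧ τ ≤ R / 64 ∧ 2048 * A * τ ≤ 1 := by
    refine ⟨min (R / 64) (1 / (2048 * A)), lt_min (by positivity) (by positivity),
      min_le_left _ _, ?_⟩
    calc 2048 * A * _ ≤ 2048 * A * (1 / (2048 * A)) := by gcongr; exact min_le_right _ _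
      _ = 1 := by field_simp
  refine ⟨min (CubicRemainder.saddleRadius A R / 4) (1 / (320 * A)),
    lt_min (by positivity) (by positivity),
    (3 * (C * (1 / τ + 512 * A)) + 640 * A) * Real.exp (3 / 2), ?_⟩
  intro E hE Δ hΔ ν _ hν x hx hxε
  obtain ⟨t, ht⟩ : ∃ t : ℝ, t = x / Δ := ⟨_, rfl⟩
  have ht0 : 0 ≤ t := by rw [ht]; positivity
  have hxt : x = Δ * t := by rw [ht]; field_simp
  rw [← div_le_iff₀ hΔ, ← ht] at hxε
  have htA : 320 * A * t ≤ 1 := by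
    calc 320 * A * t ≤ 320 * A * (1 / (320 * A)) := by
          gcongr; exact hxε.trans (min_le_right _ _)
      _ = 1 := by field_simp
  obtain ⟨p, s, hp⟩ := hE.exists_isSaddle ht0 (hxε.trans (min_le_left _ _)) htA
  have hp0 := hp.nonneg
  have hs0 : 0 < s := by linarith [hp.half_le]
  have hhR : |Δ * p| < R * Δ := by
    rw [abs_of_nonneg (by positivity), mul_comm]
    gcongr
    linarith [hp.le_radius]
  have hprob := hν.isProbabilityMeasure_tiltedLaw hhR (Δ * t) s
  have hL := abs_setIntegral_exp_sub_le (hp.abs_measure_Icc_sub_le hBE hE hΔ hν hτ0 hτR hτA)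
    (y := Δ * p * s) (by positivity)
  rw [setIntegral_exp_gaussianReal] at hL
  have hMM := hp.abs_mills_sub_le hA ht0 htA hΔ
  rw [← ht, hxt, hp.measure_Ici_div hE ht0 hΔ hν]
  rw [hxt] at hx
  clear hBE
  generalize ∫ y in Set.Ici 0, Real.exp (-(Δ * p * s * y)) ∂(tiltedLaw ν (Δ * p) (Δ * t) s) = J at *
  have hJM : |√(2 * Real.pi) * J - mills (Δ * p * s)| ≤ 3 * (C * (1 / τ + 512 * A)) / Δ := by
    have hpi : 0 < √(2 * Real.pi) := by positivity
    have hpi3 : √(2 * Real.pi) ≤ 3 := by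
      rw [Real.sqrt_le_left (by norm_num)]
      linarith [Real.pi_le_four]
    have e : √(2 * Real.pi) * J - mills (Δ * p * s) =
        √(2 * Real.pi) * (J - (√(2 * Real.pi))⁻¹ * mills (Δ * p * s)) := by
      field_simp
    rw [e, abs_mul, abs_of_pos hpi]
    calc _ ≤ 3 * (C * (1 / (τ * Δ) + 512 * A / Δ)) := by gcongr
      _ = _ := by field_simp
  have hm := le_mills hx
  have hmp := mills_pos hx
  refine ⟨(√(2 * Real.pi) * J - mills (Δ * t)) / mills (Δ * t), ?_, ?_⟩
  · rw [abs_div, abs_of_pos hmp, div_le_iff₀ hmp]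
    have h1 : |√(2 * Real.pi) * J - mills (Δ * t)| ≤
        (3 * (C * (1 / τ + 512 * A)) + 640 * A) / Δ := by
      calc _ = |(√(2 * Real.pi) * J - mills (Δ * p * s)) +
            (mills (Δ * p * s) - mills (Δ * t))| := by
            congr 1; ring
        _ ≤ _ := abs_add_le _ _
        _ ≤ 3 * (C * (1 / τ + 512 * A)) / Δ + 640 * A / Δ := add_le_add hJM hMM
        _ = _ := by ring
    refine h1.trans ?_
    calc (3 * (C * (1 / τ + 512 * A)) + 640 * A) / Δ
        = (3 * (C * (1 / τ + 512 * A)) + 640 * A) * Real.exp (3 / 2) * ((Δ * t + 1) / Δ) *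
          (Real.exp (-(3 / 2)) / (1 + Δ * t)) := by
          rw [Real.exp_neg]
          have h2 := Real.exp_ne_zero (3 / 2)
          have h3 : 1 + Δ * t ≠ 0 := by positivity
          generalize Real.exp (3 / 2) = a at *
          generalize 3 * (C * (1 / τ + 512 * A)) + 640 * A = b at *
          field_simp
          ring
      _ ≤ _ := by gcongr
  · congr 1
    field_simp
    ring

/-! ### Moment generating function of an infinite linear combination -/

/-- `ε` is a family of independent copies of `Y`, whose cumulant generating function is `L`
on the disc of radius `H`, where it is `O(z ^ 2)`. -/
structure IsInnovation {Ω ι : Type*} [MeasurableSpace Ω] (ε : ι → Ω → ℝ) (Y : Ω → ℝ)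
    (μ : Measure Ω) (L : ℂ → ℂ) (H B : ℝ) : Prop where
  measurable : ∀ i, Measurable (ε i)
  indep : iIndepFun ε μ
  identDistrib : ∀ i, IdentDistrib (ε i) Y μ μ
  cgf : IsCGFOnDisc L Y μ H
  nonneg : 0 ≤ B
  norm_le : ∀ z ∈ Metric.ball (0 : ℂ) H, ‖L z‖ ≤ B * ‖z‖ ^ 2

namespace IsInnovation

variable {Ω ι : Type*} [MeasurableSpace Ω] {ε : ι → Ω → ℝ} {Y : Ω → ℝ} {μ : Measure Ω}
  {L : ℂ → ℂ} {H B : ℝ}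

theorem integral_exp (h : IsInnovation ε Y μ L H B) (i : ι) {z : ℂ} (hz : ‖z‖ < H) :
    ∫ ω, Complex.exp (z * ε i ω) ∂μ = Complex.exp (L z) := by
  rw [h.cgf.exp_eq z (by simpa using hz), complexMGF]
  exact ((h.identDistrib i).comp (u := fun y : ℝ => Complex.exp (z * y))
    (by fun_prop)).integral_eq

theorem integrable_exp_real (h : IsInnovation ε Y μ L H B) (i : ι) {y : ℝ} (hy : |y| < H) :
    Integrable (fun ω => Real.exp (y * ε i ω)) μ := by
  have h1 := (h.cgf.integrable (y : ℂ) (by simpa using hy)).norm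
  have h2 : Integrable (fun ω => Real.exp (y * Y ω)) μ := by
    refine h1.congr (ae_of_all _ fun ω => ?_)
    simp [Complex.norm_exp]
  exact ((h.identDistrib i).comp (u := fun t : ℝ => Real.exp (y * t))
    (by fun_prop)).integrable_iff.2 h2

theorem integrable_exp_sum_real (h : IsInnovation ε Y μ L H B) (c : ι → ℝ) (s : Finset ι) {y : ℝ}
    (hy : ∀ k, |c k| * |y| < H) :
    Integrable (fun ω => Real.exp (y * ∑ k ∈ s, c k * ε k ω)) μ := by
  have := h.indep.isProbabilityMeasure
  have hi : iIndepFun (fun k ω => c k * ε k ω) μ :=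
    h.indep.comp (fun k (t : ℝ) => c k * t) (fun k => by fun_prop)
  have h1 := hi.integrable_exp_mul_sum (t := y) (s := s)
    (fun k => (h.measurable k).const_mul _) (fun k _ => by
      have := h.integrable_exp_real k (y := y * c k) (by
        rw [abs_mul, mul_comm]; exact hy k)
      refine this.congr (ae_of_all _ fun ω => ?_)
      simp only
      congr 1; ring)
  simpa only [Finset.sum_apply] using h1

theorem integrable_exp_sum (h : IsInnovation ε Y μ L H B) (c : ι → ℝ) (s : Finset ι) {z : ℂ}
    (hz : ∀ k, |c k| * ‖z‖ < H) :
    Integrable (fun ω => Complex.exp (z * ∑ k ∈ s, c k * ε k ω)) μ := by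
  have hm := h.measurable
  refine (h.integrable_exp_sum_real c s (y := z.re) fun k => ?_).mono' ?_ (ae_of_all _ fun ω => ?_)
  · exact (mul_le_mul_of_nonneg_left (Complex.abs_re_le_norm z) (abs_nonneg _)).trans_lt (hz k)
  · exact Measurable.aestronglyMeasurable (by fun_prop)
  · rw [Complex.norm_exp]
    rw [Complex.re_mul_ofReal]

theorem integral_exp_sum (h : IsInnovation ε Y μ L H B) (c : ι → ℝ) (s : Finset ι) {z : ℂ}
    (hz : ∀ k, |c k| * ‖z‖ < H) :
    ∫ ω, Complex.exp (z * ∑ k ∈ s, c k * ε k ω) ∂μ = Complex.exp (∑ k ∈ s, L (c k * z)) := by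
  have hind : iIndepFun (fun (k : s) => ε k) μ := h.indep.precomp Subtype.val_injective
  have h1 := hind.integral_fun_prod_comp (𝕜 := ℂ)
    (f := fun (k : s) (t : ℝ) => Complex.exp (c k * z * t))
    (fun k => (h.measurable k).aemeasurable)
    (fun k => Continuous.aestronglyMeasurable (by fun_prop))
  have h2 : ∀ ω, Complex.exp (z * ∑ k ∈ s, c k * ε k ω) =
      ∏ k : s, Complex.exp (c k * z * ε k ω) := by
    intro ω
    rw [← Complex.exp_sum, Complex.ofReal_sum, Finset.mul_sum, ← Finset.sum_coe_sort s]
    congr 1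
    refine Finset.sum_congr rfl fun k _ => ?_
    push_cast
    ring
  simp_rw [h2]
  rw [h1, Complex.exp_sum, ← Finset.prod_coe_sort s]
  refine Finset.prod_congr rfl fun k _ => ?_
  exact h.integral_exp k (by
    rw [norm_mul, Complex.norm_real, Real.norm_eq_abs]; exact hz k)

theorem norm_apply_mul_le (h : IsInnovation ε Y μ L H B) {c : ι → ℝ} {z : ℂ}
    (hz : ∀ k, |c k| * ‖z‖ < H) (k : ι) : ‖L (c k * z)‖ ≤ B * ‖z‖ ^ 2 * c k ^ 2 := by
  refine (h.norm_le _ ?_).trans_eq ?_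
  · rw [mem_ball_zero_iff, norm_mul, Complex.norm_real, Real.norm_eq_abs]
    exact hz k
  · rw [norm_mul, Complex.norm_real, Real.norm_eq_abs, mul_pow, sq_abs]
    ring

theorem summable_apply_mul (h : IsInnovation ε Y μ L H B) {c : ι → ℝ}
    (hc : Summable fun k => c k ^ 2) {z : ℂ} (hz : ∀ k, |c k| * ‖z‖ < H) :
    Summable fun k => L (c k * z) :=
  Summable.of_norm_bounded (hc.mul_left (B * ‖z‖ ^ 2)) (h.norm_apply_mul_le hz)

theorem integral_exp_sum_real_le (h : IsInnovation ε Y μ L H B) {c : ι → ℝ}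
    (hc : Summable fun k => c k ^ 2) (s : Finset ι) {y : ℝ} (hy : ∀ k, |c k| * |y| < H) :
    ∫ ω, Real.exp (y * ∑ k ∈ s, c k * ε k ω) ∂μ ≤
      Real.exp (B * y ^ 2 * ∑' k, c k ^ 2) := by
  have h1 := h.integral_exp_sum c s (z := y) (by simpa using hy)
  have h2 : ((∫ ω, Real.exp (y * ∑ k ∈ s, c k * ε k ω) ∂μ : ℝ) : ℂ) =
      Complex.exp (∑ k ∈ s, L (c k * y)) := by
    rw [← h1, ← integral_complex_ofReal]
    congr 1
    funext ω
    push_cast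
    rfl
  have h3 : ∫ ω, Real.exp (y * ∑ k ∈ s, c k * ε k ω) ∂μ ≤
      ‖((∫ ω, Real.exp (y * ∑ k ∈ s, c k * ε k ω) ∂μ : ℝ) : ℂ)‖ := by
    rw [Complex.norm_real]
    exact le_abs_self _
  refine h3.trans ?_
  rw [h2, Complex.norm_exp, Real.exp_le_exp]
  refine (Complex.re_le_norm _).trans ((norm_sum_le _ _).trans ?_)
  calc ∑ k ∈ s, ‖L (c k * y)‖ ≤ ∑ k ∈ s, B * ‖(y : ℂ)‖ ^ 2 * c k ^ 2 :=
        Finset.sum_le_sum fun k _ => h.norm_apply_mul_le (by simpa using hy) k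
    _ = B * y ^ 2 * ∑ k ∈ s, c k ^ 2 := by
        rw [← Finset.mul_sum, Complex.norm_real, Real.norm_eq_abs, sq_abs]
    _ ≤ _ := by
        have := h.nonneg
        gcongr
        exact hc.sum_le_tsum s (fun k _ => sq_nonneg _)

end IsInnovation

theorem eLpNorm_exp_two {Ω : Type*} [MeasurableSpace Ω] {μ : Measure Ω} {f : Ω → ℝ}
    (hf : Integrable (fun ω => Real.exp (2 * f ω)) μ) :
    eLpNorm (fun ω => Real.exp (f ω)) 2 μ =
      ENNReal.ofReal (∫ ω, Real.exp (2 * f ω) ∂μ) ^ (1 / 2 : ℝ) := by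
  have h1 := eLpNorm_nnreal_eq_lintegral (μ := μ) (f := fun ω => Real.exp (f ω)) (p := 2)
    (by norm_num)
  have e2 : ((2 : NNReal) : ENNReal) = 2 := rfl
  rw [e2] at h1
  rw [h1, ofReal_integral_eq_lintegral_ofReal hf (ae_of_all _ fun ω => (Real.exp_pos _).le)]
  congr 1
  refine lintegral_congr fun ω => ?_
  rw [Real.enorm_eq_ofReal (Real.exp_pos _).le, ENNReal.ofReal_rpow_of_pos (Real.exp_pos _),
    ← Real.exp_mul]
  congr 2
  push_cast
  ring

/-- The mean value inequality on the segment, where `|exp|` is at most the larger of its moduli at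
the two ends. -/
theorem norm_exp_sub_exp_le (a b : ℂ) :
    ‖Complex.exp a - Complex.exp b‖ ≤ ‖a - b‖ * (Real.exp a.re + Real.exp b.re) := by
  have h := Convex.norm_image_sub_le_of_norm_deriv_le (𝕜 := ℂ) (f := Complex.exp)
    (s := segment ℝ b a) (x := b) (y := a) (C := Real.exp a.re + Real.exp b.re)
    (fun y _ => Complex.differentiable_exp y) (fun y hy => ?_) (convex_segment b a)
    (left_mem_segment ℝ b a) (right_mem_segment ℝ b a)
  · rwa [mul_comm] at h
  · rw [Complex.deriv_exp, Complex.norm_exp]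
    obtain ⟨u, v, hu, hv, huv, rfl⟩ := hy
    have hle : (u • b + v • a).re ≤ max a.re b.re := by
      simp only [Complex.add_re, Complex.smul_re, smul_eq_mul]
      calc u * b.re + v * a.re ≤ u * max a.re b.re + v * max a.re b.re := by
            gcongr
            · exact le_max_right _ _
            · exact le_max_left _ _
        _ = max a.re b.re := by rw [← add_mul, huv, one_mul]
    refine (Real.exp_le_exp.2 hle).trans ?_
    rcases max_cases a.re b.re with ⟨h1, _⟩ | ⟨h1, _⟩ <;> rw [h1]
    · linarith [Real.exp_pos b.re]
    · linarith [Real.exp_pos a.re]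

namespace IsInnovation

variable {Ω ι : Type*} [MeasurableSpace Ω] {ε : ι → Ω → ℝ} {Y : Ω → ℝ} {μ : Measure Ω}
  {L : ℂ → ℂ} {H B : ℝ}

theorem eLpNorm_exp_sum_le (h : IsInnovation ε Y μ L H B) {c : ι → ℝ}
    (hc : Summable fun k => c k ^ 2) (s : Finset ι) {y : ℝ} (hy : ∀ k, |c k| * |2 * y| < H) :
    eLpNorm (fun ω => Real.exp (y * ∑ k ∈ s, c k * ε k ω)) 2 μ ≤
      ENNReal.ofReal (Real.exp (B * (2 * y) ^ 2 * ∑' k, c k ^ 2)) ^ (1 / 2 : ℝ) := by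
  have hi := h.integrable_exp_sum_real c s hy
  rw [eLpNorm_exp_two (by simpa only [mul_assoc] using hi)]
  refine ENNReal.rpow_le_rpow (ENNReal.ofReal_le_ofReal ?_) (by norm_num)
  simpa only [mul_assoc] using h.integral_exp_sum_real_le hc s hy

variable [Countable ι]

/-- Fatou's lemma along a subsequence of partial sums converging almost everywhere, extracted from
the `L²` convergence. -/
theorem eLpNorm_exp_limit_le (h : IsInnovation ε Y μ L H B) {c : ι → ℝ}
    (hc : Summable fun k => c k ^ 2) {W : Ω → ℝ} (hW : AEMeasurable W μ)
    (hlim : Tendsto (fun s : Finset ι => eLpNorm (fun ω => W ω - ∑ k ∈ s, c k * ε k ω) 2 μ)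
      atTop (𝓝 0)) {y : ℝ} (hy : ∀ k, |c k| * |2 * y| < H) :
    eLpNorm (fun ω => Real.exp (y * W ω)) 2 μ ≤
      ENNReal.ofReal (Real.exp (B * (2 * y) ^ 2 * ∑' k, c k ^ 2)) ^ (1 / 2 : ℝ) := by
  have hm := h.measurable
  have hmeas : TendstoInMeasure μ (fun (s : Finset ι) ω => ∑ k ∈ s, c k * ε k ω) atTop W := by
    refine tendstoInMeasure_of_tendsto_eLpNorm (p := 2) (by norm_num)
      (fun s => Measurable.aestronglyMeasurable (by fun_prop)) hW.aestronglyMeasurable ?_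
    refine hlim.congr fun s => ?_
    rw [eLpNorm_sub_comm]
    rfl
  obtain ⟨ns, hns, hae⟩ := hmeas.exists_seq_tendsto_ae'
  refine Lp.eLpNorm_le_of_ae_tendsto
    (f := fun n ω => Real.exp (y * ∑ k ∈ ns n, c k * ε k ω)) (u := atTop)
    (Eventually.of_forall fun n => h.eLpNorm_exp_sum_le hc (ns n) hy)
    (fun n => Measurable.aestronglyMeasurable (by fun_prop)) ?_
  filter_upwards [hae] with ω hω
  exact (Real.continuous_exp.tendsto _).comp (hω.const_mul y)

/-- The finite sums have transform `exp (∑ L(c_k z))` by independence. Their exponentials converge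
in `L¹` by `|e^a - e^b| ≤ |a - b| (e^{Re a} + e^{Re b})` and Cauchy–Schwarz; the uniform `L²` bounds
on the exponentials are why `2‖z‖` occurs in the hypothesis. -/
theorem integrable_and_integral_exp_limit (h : IsInnovation ε Y μ L H B) {c : ι → ℝ}
    (hc : Summable fun k => c k ^ 2) {W : Ω → ℝ} (hW : AEMeasurable W μ)
    (hlim : Tendsto (fun s : Finset ι => eLpNorm (fun ω => W ω - ∑ k ∈ s, c k * ε k ω) 2 μ)
      atTop (𝓝 0)) {z : ℂ} (hz : ∀ k, |c k| * (2 * ‖z‖) < H) :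
    Integrable (fun ω => Complex.exp (z * W ω)) μ ∧
      ∫ ω, Complex.exp (z * W ω) ∂μ = Complex.exp (∑' k, L (c k * z)) := by
  have hprob := h.indep.isProbabilityMeasure
  have hm := h.measurable
  set y := z.re with hy
  have hyz : ∀ k, |c k| * |2 * y| < H := fun k => by
    refine lt_of_le_of_lt ?_ (hz k)
    rw [abs_mul, abs_two]
    gcongr
    exact Complex.abs_re_le_norm z
  have hz1 : ∀ k, |c k| * ‖z‖ < H := fun k => by
    refine lt_of_le_of_lt ?_ (hz k)
    gcongr
    linarith [norm_nonneg z]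
  set M := ENNReal.ofReal (Real.exp (B * (2 * y) ^ 2 * ∑' k, c k ^ 2)) ^ (1 / 2 : ℝ) with hM
  have hMtop : M ≠ ⊤ := ENNReal.rpow_ne_top_of_nonneg (by norm_num) ENNReal.ofReal_ne_top
  have hWexp := h.eLpNorm_exp_limit_le hc hW hlim hyz
  have hmW : AEStronglyMeasurable (fun ω => Real.exp (y * W ω)) μ :=
    (Real.measurable_exp.comp_aemeasurable (hW.const_mul y)).aestronglyMeasurable
  have hmWc : AEStronglyMeasurable (fun ω => Complex.exp (z * W ω)) μ :=
    (Complex.measurable_exp.comp_aemeasurable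
      ((Complex.measurable_ofReal.comp_aemeasurable hW).const_mul z)).aestronglyMeasurable
  have hnorm : ∀ t : ℝ, ‖Complex.exp (z * t)‖ = Real.exp (y * t) := fun t => by
    rw [Complex.norm_exp, Complex.re_mul_ofReal]
  constructor
  · have h2 : MemLp (fun ω => Real.exp (y * W ω)) 2 μ := ⟨hmW, hWexp.trans_lt hMtop.lt_top⟩
    refine (h2.integrable (by norm_num)).mono' hmWc (ae_of_all _ fun ω => ?_)
    rw [hnorm]
  · have hsum := (h.summable_apply_mul hc hz1).hasSum
    have ht1 : Tendsto (fun s : Finset ι => Complex.exp (∑ k ∈ s, L (c k * z))) atTop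
        (𝓝 (Complex.exp (∑' k, L (c k * z)))) :=
      (Complex.continuous_exp.tendsto _).comp hsum
    refine tendsto_nhds_unique ?_ ht1
    refine (tendsto_integral_of_L1' (l := atTop) (fun ω => Complex.exp (z * W ω)) hmWc
      (F := fun (s : Finset ι) ω => Complex.exp (z * ∑ k ∈ s, c k * ε k ω))
      (Eventually.of_forall fun s => h.integrable_exp_sum c s hz1) ?_).congr
      fun s => h.integral_exp_sum c s hz1
    have hupper : Tendsto (fun s : Finset ι => ENNReal.ofReal ‖z‖ *
        (eLpNorm (fun ω => W ω - ∑ k ∈ s, c k * ε k ω) 2 μ * (M + M))) atTop (𝓝 0) := by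
      have h1 := ENNReal.Tendsto.mul_const (b := M + M) hlim
        (Or.inr (ENNReal.add_ne_top.2 ⟨hMtop, hMtop⟩))
      have h2 := ENNReal.Tendsto.const_mul (a := ENNReal.ofReal ‖z‖) h1
        (Or.inr ENNReal.ofReal_ne_top)
      simpa using h2
    refine tendsto_of_tendsto_of_tendsto_of_le_of_le tendsto_const_nhds hupper
      (fun s => bot_le) fun s => ?_
    have hms : AEStronglyMeasurable (fun ω => Real.exp (y * ∑ k ∈ s, c k * ε k ω)) μ :=
      Measurable.aestronglyMeasurable (by fun_prop)
    have hmd : AEStronglyMeasurable (fun ω => W ω - ∑ k ∈ s, c k * ε k ω) μ :=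
      hW.aestronglyMeasurable.sub (Measurable.aestronglyMeasurable (by fun_prop))
    set g : Ω → ℝ := (fun ω => Real.exp (y * ∑ k ∈ s, c k * ε k ω)) +
      fun ω => Real.exp (y * W ω) with hg
    calc eLpNorm ((fun ω => Complex.exp (z * ∑ k ∈ s, c k * ε k ω)) -
          fun ω => Complex.exp (z * W ω)) 1 μ
        ≤ ENNReal.ofReal ‖z‖ *
          eLpNorm ((fun ω => W ω - ∑ k ∈ s, c k * ε k ω) • g) 1 μ := by
          refine eLpNorm_le_mul_eLpNorm_of_ae_le_mul (ae_of_all _ fun ω => ?_) 1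
          simp only [Pi.sub_apply, Pi.smul_apply', hg, Pi.add_apply, smul_eq_mul]
          refine (norm_exp_sub_exp_le _ _).trans_eq ?_
          rw [← mul_sub, norm_mul, ← Complex.ofReal_sub, Complex.norm_real, Complex.re_mul_ofReal,
            Complex.re_mul_ofReal, norm_mul, Real.norm_eq_abs, Real.norm_eq_abs,
            Real.norm_eq_abs, abs_of_pos (add_pos (Real.exp_pos _) (Real.exp_pos _)),
            abs_sub_comm]
          ring
      _ ≤ ENNReal.ofReal ‖z‖ *
          (eLpNorm (fun ω => W ω - ∑ k ∈ s, c k * ε k ω) 2 μ * eLpNorm g 2 μ) := by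
          gcongr
          exact eLpNorm_smul_le_mul_eLpNorm (p := 2) (q := 2) (r := 1) (hms.add hmW) hmd
      _ ≤ _ := by
          gcongr
          refine (eLpNorm_add_le hms hmW (by norm_num)).trans ?_
          gcongr
          exact h.eLpNorm_exp_sum_le hc s hyz

end IsInnovation

/-! ### Square summability of the coefficients of a convergent linear combination -/

/-- The squared `L²` norm of a partial sum is `σ²` times the partial sum of `c_k²`, and partial sums
close to `W` are bounded in `L²`. -/
theorem summable_sq_of_tendsto {Ω ι : Type*} [MeasurableSpace Ω] {ε : ι → Ω → ℝ}
    {μ : Measure Ω} {σ : ℝ} (hind : iIndepFun ε μ)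
    (hL2 : ∀ i, MemLp (ε i) 2 μ) (hmean : ∀ i, ∫ ω, ε i ω ∂μ = 0) (hσ : 0 < σ)
    (hvar : ∀ i, variance (ε i) μ = σ ^ 2) {c : ι → ℝ} {W : Ω → ℝ} (hW : AEMeasurable W μ)
    (hlim : Tendsto (fun s : Finset ι => eLpNorm (fun ω => W ω - ∑ k ∈ s, c k * ε k ω) 2 μ)
      atTop (𝓝 0)) : Summable fun k => c k ^ 2 := by
  have hprob := hind.isProbabilityMeasure
  have hmem : ∀ s : Finset ι, MemLp (fun ω => ∑ k ∈ s, c k * ε k ω) 2 μ := fun s =>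
    memLp_finsetSum s fun k _ => (hL2 k).const_mul _
  have hsq : ∀ s : Finset ι, ENNReal.ofReal (σ ^ 2 * ∑ k ∈ s, c k ^ 2) =
      eLpNorm (fun ω => ∑ k ∈ s, c k * ε k ω) 2 μ ^ 2 := by
    intro s
    have hv : variance (fun ω => ∑ k ∈ s, c k * ε k ω) μ = σ ^ 2 * ∑ k ∈ s, c k ^ 2 := by
      have h1 := IndepFun.variance_sum (μ := μ) (X := fun k ω => c k * ε k ω) (s := s)
        (fun k _ => (hL2 k).const_mul _) (fun i _ j _ hij =>
          (hind.indepFun hij).comp (φ := fun t : ℝ => c i * t) (ψ := fun t : ℝ => c j * t)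
            (by fun_prop) (by fun_prop))
      have e : (∑ k ∈ s, fun ω => c k * ε k ω) = fun ω => ∑ k ∈ s, c k * ε k ω := by
        funext ω; simp
      rw [e] at h1
      rw [h1, Finset.mul_sum]
      refine Finset.sum_congr rfl fun k _ => ?_
      rw [variance_const_mul, hvar]; ring
    have hmean0 : ∫ ω, ∑ k ∈ s, c k * ε k ω ∂μ = 0 := by
      rw [integral_finsetSum s fun k _ => ((hL2 k).integrable (by norm_num)).const_mul _]
      simp [integral_const_mul, hmean]
    rw [variance_of_integral_eq_zero (hmem s).aestronglyMeasurable.aemeasurable hmean0] at hv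
    rw [← hv, (hmem s).eLpNorm_eq_integral_rpow_norm (by norm_num) (by norm_num),
      ← ENNReal.ofReal_pow (by positivity), ← Real.rpow_natCast, ← Real.rpow_mul (by positivity)]
    simp
  obtain ⟨s0, hs0⟩ := (hlim.eventually_le_const (u := 1) (by norm_num)).exists
  have hWtop : eLpNorm W 2 μ < ⊤ := by
    have e : W = (fun ω => W ω - ∑ k ∈ s0, c k * ε k ω) + fun ω => ∑ k ∈ s0, c k * ε k ω := by
      funext ω; simp
    rw [e]
    refine (eLpNorm_add_le ((hW.aestronglyMeasurable).sub (hmem s0).1) (hmem s0).1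
      (by norm_num)).trans_lt ?_
    exact ENNReal.add_lt_top.2 ⟨hs0.trans_lt ENNReal.one_lt_top, (hmem s0).2⟩
  set M : ENNReal := (1 + eLpNorm W 2 μ) ^ 2 with hM
  have hMtop : M ≠ ⊤ := by
    rw [hM]
    exact ENNReal.pow_ne_top (ENNReal.add_ne_top.2 ⟨ENNReal.one_ne_top, hWtop.ne⟩)
  have hbig : ∀ᶠ s : Finset ι in atTop, σ ^ 2 * ∑ k ∈ s, c k ^ 2 ≤ M.toReal := by
    filter_upwards [hlim.eventually_le_const (u := 1) (by norm_num)] with s hs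
    rw [← ENNReal.ofReal_le_iff_le_toReal hMtop, hsq, hM]
    gcongr
    have e : (fun ω => ∑ k ∈ s, c k * ε k ω) = W - (fun ω => W ω - ∑ k ∈ s, c k * ε k ω) := by
      funext ω; simp
    rw [e, add_comm]
    refine (eLpNorm_sub_le hW.aestronglyMeasurable
      (hW.aestronglyMeasurable.sub (hmem s).1) (by norm_num)).trans ?_
    exact add_le_add_right hs _
  obtain ⟨s1, hs1⟩ := eventually_atTop.1 hbig
  classical
  refine summable_of_sum_le (c := M.toReal / σ ^ 2) (fun k => sq_nonneg _) fun s => ?_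
  rw [le_div_iff₀ (by positivity), mul_comm]
  -- The bound is known only for index sets containing `s1`; enlarging a set can only increase a sum
  -- of squares.
  refine le_trans ?_ (hs1 (s ∪ s1) Finset.subset_union_right)
  gcongr
  exact Finset.subset_union_left

/-! ### The cumulant generating function as a power series in the cumulants -/

/-- The power series `∑ κ_m z ^ m / m!`. -/
def cgfSeries (κ : ℕ → ℝ) (z : ℂ) : ℂ := ∑' m, ((κ m / m.factorial : ℝ) : ℂ) * z ^ m

theorem cgfSeries_conj (κ : ℕ → ℝ) (z : ℂ) :
    cgfSeries κ (starRingEnd ℂ z) = starRingEnd ℂ (cgfSeries κ z) := by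
  rw [cgfSeries, cgfSeries, Complex.conj_tsum]
  congr 1
  funext m
  rw [map_mul, map_pow, Complex.conj_ofReal]

/-- Agreement at the single point `0` would not survive differentiation, so the induction carries
equality on a whole real neighbourhood. -/
theorem iteratedDeriv_ofReal_eventually {f : ℂ → ℂ} {g : ℝ → ℝ} (hf : AnalyticAt ℂ f 0)
    (hfg : ∀ᶠ x : ℝ in 𝓝 0, f x = g x) (n : ℕ) :
    ∀ᶠ x : ℝ in 𝓝 0, iteratedDeriv n f x = iteratedDeriv n g x := by
  induction n with
  | zero => simpa using hfg
  | succ n ih =>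
    have han : ∀ᶠ z in 𝓝 (0 : ℂ), AnalyticAt ℂ (iteratedDeriv n f) z := by
      refine hf.eventually_analyticAt.mono fun z hz => ?_
      rw [iteratedDeriv_eq_iterate]
      exact hz.iterated_deriv n
    have hcont : Tendsto (fun x : ℝ => (x : ℂ)) (𝓝 0) (𝓝 0) := by
      have := Complex.continuous_ofReal.tendsto 0
      simpa using this
    filter_upwards [hcont.eventually han, ih.eventually_nhds] with x hx1 hx2
    rw [iteratedDeriv_succ, iteratedDeriv_succ]
    have h1 : HasDerivAt (iteratedDeriv n f) (deriv (iteratedDeriv n f) x) x :=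
      hx1.differentiableAt.hasDerivAt
    have h2 : HasDerivAt (fun y : ℝ => ((iteratedDeriv n g y : ℝ) : ℂ)) _ x :=
      h1.comp_ofReal.congr_of_eventuallyEq (hx2.mono fun y hy => hy.symm)
    have h3 : HasDerivAt (iteratedDeriv n g) _ x :=
      h1.real_of_complex.congr_of_eventuallyEq
        (hx2.mono fun y hy => by simp only [hy, Complex.ofReal_re])
    rw [h3.deriv]
    exact h2.unique h3.ofReal_comp

namespace IsCGFOnDisc

variable {Ω : Type*} [MeasurableSpace Ω] {μ : Measure Ω} {L : ℂ → ℂ} {Y : Ω → ℝ} {H : ℝ}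

theorem mono (h : IsCGFOnDisc L Y μ H) {H' : ℝ} (hH : H' ≤ H) : IsCGFOnDisc L Y μ H' where
  integrable z hz := h.integrable z (Metric.ball_subset_ball hH hz)
  analytic z hz := h.analytic z (Metric.ball_subset_ball hH hz)
  map_zero := h.map_zero
  exp_eq z hz := h.exp_eq z (Metric.ball_subset_ball hH hz)

/-- `L` vanishes at `0`, so near the origin its imaginary part lies in `(-π, π)` and `L` is the
principal logarithm of the moment generating function. -/
theorem eventually_eq_cgf (h : IsCGFOnDisc L Y μ H) (hH : 0 < H) :
    ∀ᶠ x : ℝ in 𝓝 0, L x = cgf Y μ x := by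
  have hcont : Tendsto (fun x : ℝ => (x : ℂ)) (𝓝 0) (𝓝 0) := by
    have := Complex.continuous_ofReal.tendsto 0
    simpa using this
  have hL : Tendsto L (𝓝 0) (𝓝 0) := by
    have := (h.analytic 0 (Metric.mem_ball_self hH)).continuousAt.tendsto
    rwa [h.map_zero] at this
  have h1 : ∀ᶠ x : ℝ in 𝓝 0, ‖L x‖ < Real.pi := by
    have := (hL.comp hcont).norm
    rw [norm_zero] at this
    exact this.eventually_lt_const Real.pi_pos
  have h2 : ∀ᶠ x : ℝ in 𝓝 0, (x : ℂ) ∈ Metric.ball (0 : ℂ) H :=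
    hcont.eventually (Metric.ball_mem_nhds 0 hH)
  filter_upwards [h1, h2] with x hx1 hx2
  have h3 := h.exp_eq x hx2
  have him := (Complex.abs_im_le_norm (L x)).trans_lt hx1
  rw [abs_lt] at him
  rw [← Complex.log_exp him.1 him.2.le, h3, complexMGF_ofReal, cgf, Complex.ofReal_log mgf_nonneg]

theorem iteratedDeriv_eq_cumulant (h : IsCGFOnDisc L Y μ H) (hH : 0 < H) (n : ℕ) :
    iteratedDeriv n L 0 = cumulant Y μ n := by
  have := (iteratedDeriv_ofReal_eventually (h.analytic 0 (Metric.mem_ball_self hH))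
    (h.eventually_eq_cgf hH) n).self_of_nhds
  simpa [cumulant] using this

/-- This recovers `L` from the cumulants alone, so coefficients defined through `cgfSeries` can be
fixed before the probability space. -/
theorem cgfSeries_cumulant (h : IsCGFOnDisc L Y μ H) {z : ℂ}
    (hz : z ∈ Metric.ball (0 : ℂ) H) : cgfSeries (cumulant Y μ) z = L z := by
  have hH : 0 < H := by
    rw [mem_ball_zero_iff] at hz
    exact (norm_nonneg z).trans_lt hz
  have := Complex.hasSum_taylorSeries_on_ball h.analytic.differentiableOn hz
  rw [← this.tsum_eq, cgfSeries]
  congr 1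
  funext m
  rw [h.iteratedDeriv_eq_cumulant hH, sub_zero, smul_eq_mul, smul_eq_mul]
  push_cast
  rw [div_eq_mul_inv]
  ring

theorem zero_mem_interior (h : IsCGFOnDisc L Y μ H) (hH : 0 < H) :
    (0 : ℝ) ∈ interior (integrableExpSet Y μ) := by
  rw [mem_interior_iff_mem_nhds]
  filter_upwards [Metric.ball_mem_nhds (0 : ℝ) hH] with x hx
  have h1 := (h.integrable (x : ℂ) (by simpa using hx)).norm
  refine h1.congr (ae_of_all _ fun ω => ?_)
  simp [Complex.norm_exp]

variable [IsProbabilityMeasure μ]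

theorem cumulant_one (h : IsCGFOnDisc L Y μ H) (hH : 0 < H) :
    cumulant Y μ 1 = ∫ ω, Y ω ∂μ := by
  rw [cumulant, iteratedDeriv_one, deriv_cgf_zero (h.zero_mem_interior hH)]
  simp

theorem cumulant_two (h : IsCGFOnDisc L Y μ H) (hH : 0 < H) :
    cumulant Y μ 2 = variance Y μ := by
  have h0 := h.zero_mem_interior hH
  rw [cumulant, iteratedDeriv_two_cgf_eq_integral h0, deriv_cgf_zero h0,
    variance_eq_integral (aemeasurable_of_mem_interior_integrableExpSet h0)]
  simp

end IsCGFOnDisc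

/-! ### The cubic remainder of the normalised cumulant generating function -/

theorem norm_deriv_le_of_norm_le {f : ℂ → ℂ} {C R : ℝ} (hR : 0 < R)
    (hf : DifferentiableOn ℂ f (Metric.ball 0 R)) (hC : ∀ z ∈ Metric.ball (0 : ℂ) R, ‖f z‖ ≤ C) :
    ∀ z ∈ Metric.ball (0 : ℂ) (R / 2), ‖deriv f z‖ ≤ C / (R / 2) := by
  intro z hz
  rw [mem_ball_zero_iff] at hz
  have hsub : Metric.closedBall z (R / 2) ⊆ Metric.ball 0 R := by
    intro y hy
    rw [mem_closedBall_iff_norm] at hy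
    rw [mem_ball_zero_iff]
    calc ‖y‖ = ‖(y - z) + z‖ := by simp
      _ ≤ ‖y - z‖ + ‖z‖ := norm_add_le _ _
      _ < R := by linarith
  exact Complex.norm_deriv_le_of_forall_mem_sphere_norm_le (by linarith)
    ((hf.mono (Metric.closure_ball_subset_closedBall.trans hsub)).diffContOnCl)
    fun y hy => hC y (hsub (Metric.sphere_subset_closedBall hy))

/-- A bounded holomorphic function differs from its second order Taylor polynomial by `O(z ^ 3)`. -/
theorem norm_sub_taylor_le {f : ℂ → ℂ} {C R : ℝ} {v : ℂ} (hR : 0 < R) (hC0 : 0 ≤ C)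
    (hf : DifferentiableOn ℂ f (Metric.ball 0 R)) (hC : ∀ z ∈ Metric.ball (0 : ℂ) R, ‖f z‖ ≤ C)
    (h0 : f 0 = 0) (h1 : deriv f 0 = 0) (h2 : deriv (deriv f) 0 = v) :
    ∀ z ∈ Metric.ball (0 : ℂ) (R / 8), ‖f z - v * z ^ 2 / 2‖ ≤ 64 * C / R ^ 3 * ‖z‖ ^ 3 := by
  have hf1 := hf.deriv Metric.isOpen_ball
  have hf2 := hf1.deriv Metric.isOpen_ball
  have hs : ∀ r ≤ R, Metric.ball (0 : ℂ) r ⊆ Metric.ball 0 R := fun r hr =>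
    Metric.ball_subset_ball hr
  -- Each derivative halves the radius, which leads to `R / 8` and to the constant `2 · 4 · 8 = 64`.
  have b1 := norm_deriv_le_of_norm_le hR hf hC
  have b2 := norm_deriv_le_of_norm_le (by linarith) (hf1.mono (hs _ (by linarith))) b1
  have b3 := norm_deriv_le_of_norm_le (by linarith) (hf2.mono (hs _ (by linarith))) b2
  have e8 : R / 2 / 2 / 2 = R / 8 := by ring
  rw [e8] at b3
  have hK : C / (R / 2) / (R / 2 / 2) / (R / 8) = 64 * C / R ^ 3 := by field_simp; ring
  rw [hK] at b3
  have hmem : ∀ {g : ℂ → ℂ}, DifferentiableOn ℂ g (Metric.ball 0 R) →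
      ∀ z ∈ Metric.ball (0 : ℂ) (R / 8), HasDerivAt g (deriv g z) z := fun hg z hz =>
    (hg.differentiableAt (Metric.isOpen_ball.mem_nhds (hs _ (by linarith) hz))).hasDerivAt
  have d2 : ∀ z ∈ Metric.ball (0 : ℂ) (R / 8),
      HasDerivAt (fun z => deriv (deriv f) z - v) (deriv (deriv (deriv f)) z) z := fun z hz =>
    (hmem hf2 z hz).sub_const v
  have s2 := norm_le_pow_of_norm_deriv_le (k := 0) (A := 64 * C / R ^ 3) (R := R / 8)
    (f := fun z => deriv (deriv f) z - v) (by positivity)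
    (fun z hz => (d2 z hz).differentiableAt.differentiableWithinAt) (by simp [h2])
    (fun z hz => by rw [(d2 z hz).deriv]; simpa using b3 z hz)
  have d1 : ∀ z ∈ Metric.ball (0 : ℂ) (R / 8),
      HasDerivAt (fun z => deriv f z - v * z) (deriv (deriv f) z - v) z := fun z hz => by
    simpa using (hmem hf1 z hz).fun_sub ((hasDerivAt_id' z).const_mul v)
  have s1 := norm_le_pow_of_norm_deriv_le (k := 1) (A := 64 * C / R ^ 3) (R := R / 8)
    (f := fun z => deriv f z - v * z) (by positivity)
    (fun z hz => (d1 z hz).differentiableAt.differentiableWithinAt) (by simp [h1])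
    (fun z hz => by rw [(d1 z hz).deriv]; exact s2 z hz)
  have d0 : ∀ z ∈ Metric.ball (0 : ℂ) (R / 8),
      HasDerivAt (fun z => f z - v * z ^ 2 / 2) (deriv f z - v * z) z := fun z hz => by
    have := (hmem hf z hz).fun_sub (((hasDerivAt_pow 2 z).const_mul v).div_const 2)
    refine this.congr_deriv ?_
    norm_num
    ring
  exact norm_le_pow_of_norm_deriv_le (k := 2) (A := 64 * C / R ^ 3) (R := R / 8)
    (f := fun z => f z - v * z ^ 2 / 2) (by positivity)
    (fun z hz => (d0 z hz).differentiableAt.differentiableWithinAt) (by simp [h0])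
    (fun z hz => by rw [(d0 z hz).deriv]; exact s1 z hz)

/-- For `W = ∑ c_k ε_k`, the function `E` with `log 𝔼 exp (z W) = z ^ 2 / 2 + Δ ^ 2 E (z / Δ)`. -/
def scaledRemainder {ι : Type*} (κ : ℕ → ℝ) (c : ι → ℝ) (Δ : ℝ) (s : ℂ) : ℂ :=
  (∑' k, cgfSeries κ (c k * (Δ * s))) / Δ ^ 2 - s ^ 2 / 2

theorem scaledRemainder_conj {ι : Type*} (κ : ℕ → ℝ) (c : ι → ℝ) (Δ : ℝ) (s : ℂ) :
    scaledRemainder κ c Δ (starRingEnd ℂ s) = starRingEnd ℂ (scaledRemainder κ c Δ s) := by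
  simp only [scaledRemainder, map_sub, map_div₀, map_pow, Complex.conj_ofReal, map_ofNat,
    Complex.conj_tsum, ← cgfSeries_conj, map_mul]

/-- The quadratic parts of `L(c_k Δ s)` sum to `Δ² s² / 2` because `∑ c_k² = 1/σ²`. In the cubic
parts one factor `|c_k| Δ ≤ k₀` is spent, and the remaining `c_k²` is summable: this is where the
smallness of the individual weights enters. -/
theorem cubicRemainder_scaledRemainder {ι : Type*} {κ : ℕ → ℝ} {c : ι → ℝ} {L : ℂ → ℂ}
    {Δ H M σ k₀ : ℝ} (hL : ∀ z ∈ Metric.ball (0 : ℂ) H, cgfSeries κ z = L z)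
    (hd : DifferentiableOn ℂ L (Metric.ball 0 H)) (hM : 0 < M) (hσ : 0 < σ)
    (hk : 0 < k₀) (hΔ : 0 < Δ)
    (hb : ∀ z ∈ Metric.ball (0 : ℂ) H, ‖L z - σ ^ 2 * z ^ 2 / 2‖ ≤ M * ‖z‖ ^ 3)
    (hc : HasSum (fun k => c k ^ 2) (1 / σ ^ 2)) (hck : ∀ k, |c k| * Δ ≤ k₀)
    {R : ℝ} (hR : 0 < R) (hRH : k₀ * R ≤ H) :
    CubicRemainder (scaledRemainder κ c Δ) (M * k₀ / σ ^ 2) R := by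
  have hΔc : (Δ : ℂ) ≠ 0 := by exact_mod_cast hΔ.ne'
  have hσc : (σ : ℂ) ≠ 0 := by exact_mod_cast hσ.ne'
  have hn : ∀ (k : ι) (s : ℂ), ‖(c k * (Δ * s) : ℂ)‖ = |c k| * Δ * ‖s‖ := fun k s => by
    rw [norm_mul, norm_mul, Complex.norm_real, Complex.norm_real, Real.norm_eq_abs,
      Real.norm_eq_abs, abs_of_pos hΔ, mul_assoc]
  have hmem : ∀ s ∈ Metric.ball (0 : ℂ) R, ∀ k, (c k * (Δ * s) : ℂ) ∈ Metric.ball (0 : ℂ) H := by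
    intro s hs k
    rw [mem_ball_zero_iff] at hs ⊢
    rw [hn]
    calc |c k| * Δ * ‖s‖ ≤ k₀ * ‖s‖ := by gcongr; exact hck k
      _ < k₀ * R := by gcongr
      _ ≤ H := hRH
  have hq : ∀ s ∈ Metric.ball (0 : ℂ) R, ∀ k,
      ‖L (c k * (Δ * s)) - σ ^ 2 * (c k * (Δ * s)) ^ 2 / 2‖ ≤
        M * k₀ * Δ ^ 2 * ‖s‖ ^ 3 * c k ^ 2 := by
    intro s hs k
    refine (hb _ (hmem s hs k)).trans ?_
    rw [hn]
    calc M * (|c k| * Δ * ‖s‖) ^ 3 = M * (|c k| * Δ) * Δ ^ 2 * ‖s‖ ^ 3 * |c k| ^ 2 := by ring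
      _ ≤ M * k₀ * Δ ^ 2 * ‖s‖ ^ 3 * |c k| ^ 2 := by gcongr; exact hck k
      _ = _ := by rw [sq_abs]
  have hsq : ∀ s : ℂ, HasSum (fun k => (σ ^ 2 * (c k * (Δ * s)) ^ 2 / 2 : ℂ))
      (Δ ^ 2 * (s ^ 2 / 2)) := by
    intro s
    have h1 : HasSum (fun k => ((c k ^ 2 : ℝ) : ℂ)) ((1 / σ ^ 2 : ℝ) : ℂ) :=
      Complex.hasSum_ofReal.2 hc
    have h2 := h1.mul_left ((σ : ℂ) ^ 2 * (Δ * s) ^ 2 / 2)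
    have e1 : (fun k => (σ ^ 2 * (c k * (Δ * s)) ^ 2 / 2 : ℂ)) =
        fun k => (σ : ℂ) ^ 2 * (Δ * s) ^ 2 / 2 * ((c k ^ 2 : ℝ) : ℂ) := by
      funext k; push_cast; ring
    have e2 : (Δ : ℂ) ^ 2 * (s ^ 2 / 2) = (σ : ℂ) ^ 2 * (Δ * s) ^ 2 / 2 * ((1 / σ ^ 2 : ℝ) : ℂ) := by
      push_cast; field_simp
    rw [e1, e2]
    exact h2
  have hsum : ∀ s ∈ Metric.ball (0 : ℂ) R, Summable fun k => L (c k * (Δ * s)) := by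
    intro s hs
    have h1 : Summable fun k => L (c k * (Δ * s)) - σ ^ 2 * (c k * (Δ * s)) ^ 2 / 2 :=
      Summable.of_norm_bounded (hc.summable.mul_left _) (hq s hs)
    simpa using h1.add (hsq s).summable
  have heq : ∀ s ∈ Metric.ball (0 : ℂ) R, scaledRemainder κ c Δ s =
      (∑' k, (L (c k * (Δ * s)) - σ ^ 2 * (c k * (Δ * s)) ^ 2 / 2)) / Δ ^ 2 := by
    intro s hs
    rw [(hsum s hs).tsum_sub (hsq s).summable, (hsq s).tsum_eq, scaledRemainder, sub_div]
    congr 1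
    · congr 1
      exact tsum_congr fun k => hL _ (hmem s hs k)
    · field_simp
  refine ⟨by positivity, hR, ?_, fun s hs => ?_, scaledRemainder_conj κ c Δ⟩
  · refine DifferentiableOn.congr (f := fun s : ℂ =>
      ((∑' k, (L (c k * (Δ * s)) - σ ^ 2 * (c k * (Δ * s)) ^ 2 / 2)) / Δ ^ 2 : ℂ)) ?_ heq
    refine DifferentiableOn.div_const ?_ _
    refine Complex.differentiableOn_tsum_of_summable_norm
      (hc.summable.mul_left (M * k₀ * Δ ^ 2 * R ^ 3)) (fun k => ?_) Metric.isOpen_ball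
      (fun k s hs => ?_)
    · refine DifferentiableOn.sub (hd.comp (by fun_prop) fun s hs => hmem s hs k) (by fun_prop)
    · refine (hq s hs k).trans ?_
      rw [mem_ball_zero_iff] at hs
      gcongr
  · rw [heq s hs, norm_div, norm_pow, Complex.norm_real, Real.norm_eq_abs, abs_of_pos hΔ,
      div_le_iff₀ (by positivity)]
    refine (tsum_of_norm_bounded (hc.mul_left _) (hq s hs)).trans_eq ?_
    ring

/-! ### Coefficients of the partial sums -/

theorem mem_cube {d n : ℕ} {i : Fin d → ℤ} : i ∈ cube d n ↔ ∀ k, |i k| ≤ n := by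
  simp only [cube, Finset.mem_Icc, Pi.le_def, abs_le, ← forall_and]

theorem card_cube (d n : ℕ) : (cube d n).card = (2 * n + 1) ^ d := by
  rw [cube, Pi.card_Icc]
  simp only [Int.card_Icc, Finset.prod_const, Finset.card_univ, Fintype.card_fin]
  congr 1
  omega

theorem cube_mono (d : ℕ) : Monotone (cube d) := fun m n h i hi => by
  rw [mem_cube] at hi ⊢
  exact fun k => (hi k).trans (by exact_mod_cast h)

theorem exists_subset_cube {d : ℕ} (s : Finset (Fin d → ℤ)) : ∃ m, s ⊆ cube d m := by
  refine ⟨s.sup fun i => Finset.univ.sup fun k => (i k).natAbs, fun i hi => mem_cube.2 fun k => ?_⟩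
  have h1 : (i k).natAbs ≤ Finset.univ.sup fun k => (i k).natAbs :=
    Finset.le_sup (f := fun k => (i k).natAbs) (Finset.mem_univ k)
  have h2 := Finset.le_sup (f := fun i : Fin d → ℤ => Finset.univ.sup fun k => (i k).natAbs) hi
  rw [Int.abs_eq_natAbs]
  exact_mod_cast h1.trans h2

theorem coeffSum_eq_sum_image {d : ℕ} (a : (Fin d → ℤ) → ℝ) (n : ℕ) (j : Fin d → ℤ) :
    coeffSum a n j = ∑ v ∈ (cube d n).image (· - j), a v := by
  rw [Finset.sum_image (fun x _ y _ h => sub_left_injective h), coeffSum]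

theorem rate_sq (d n : ℕ) : rate d n ^ 2 = (n : ℝ) ^ d := by
  rw [rate, ← Real.rpow_natCast, ← Real.rpow_mul (by positivity), ← Real.rpow_natCast]
  congr 1
  push_cast
  ring

theorem rate_nonneg (d n : ℕ) : 0 ≤ rate d n := by unfold rate; positivity

theorem rate_pos (d : ℕ) {n : ℕ} (hn : 1 ≤ n) : 0 < rate d n := by
  have : (0 : ℝ) < n := by exact_mod_cast hn
  unfold rate; positivity

theorem rate_mono (d : ℕ) {m n : ℕ} (hmn : m ≤ n) : rate d m ≤ rate d n := by
  unfold rate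
  gcongr

/-- If all weights are at most `K M` and at least `n^d` of them exceed `c M`, then the `ℓ²` norm is
at least `n^{d/2} c M`, so the common scale `M` drops out. -/
theorem coeffSum_mul_rate_le {d n : ℕ} {a : (Fin d → ℤ) → ℝ} {c K M : ℝ} (hn : 1 ≤ n) (hc : 0 < c)
    (hM : 0 < M) (hK : ∀ j, |coeffSum a n j| ≤ K * M) {T : Finset (Fin d → ℤ)}
    (hT : n ^ d ≤ T.card) (hcT : ∀ j ∈ T, c * M ≤ |coeffSum a n j|)
    (hs : Summable fun j => coeffSum a n j ^ 2) :
    0 < ∑' j, coeffSum a n j ^ 2 ∧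
      ∀ j, |coeffSum a n j| * rate d n ≤ K / c * √(∑' j, coeffSum a n j ^ 2) := by
  have hr := rate_pos d hn
  have h1 : (rate d n * (c * M)) ^ 2 ≤ ∑' j, coeffSum a n j ^ 2 := by
    calc (rate d n * (c * M)) ^ 2 = (n : ℝ) ^ d * (c * M) ^ 2 := by rw [mul_pow, rate_sq]
      _ ≤ T.card * (c * M) ^ 2 := by gcongr; exact_mod_cast hT
      _ = ∑ _j ∈ T, (c * M) ^ 2 := by simp
      _ ≤ ∑ j ∈ T, coeffSum a n j ^ 2 := Finset.sum_le_sum fun j hj => by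
          rw [← sq_abs (coeffSum a n j)]
          have := hcT j hj
          gcongr
      _ ≤ _ := hs.sum_le_tsum T fun j _ => sq_nonneg _
  have h2 : rate d n * (c * M) ≤ √(∑' j, coeffSum a n j ^ 2) := Real.le_sqrt_of_sq_le h1
  have hK0 : 0 ≤ K := by
    have := (abs_nonneg _).trans (hK 0)
    exact nonneg_of_mul_nonneg_left this hM
  refine ⟨lt_of_lt_of_le (by positivity) h1, fun j => ?_⟩
  calc |coeffSum a n j| * rate d n ≤ K * M * rate d n := by gcongr; exact hK j
    _ = K / c * (rate d n * (c * M)) := by field_simp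
    _ ≤ _ := by gcongr

theorem ShortMemory.exists_coeffSum_mul_rate_le {d : ℕ} {a : (Fin d → ℤ) → ℝ} (h : ShortMemory a)
    (hs : ∀ n, Summable fun j => coeffSum a n j ^ 2) :
    ∃ K, ∀ᶠ n in atTop, 0 < ∑' j, coeffSum a n j ^ 2 ∧
      ∀ j, |coeffSum a n j| * rate d n ≤ K * √(∑' j, coeffSum a n j ^ 2) := by
  obtain ⟨hsum, h0⟩ := h
  have hpos : 0 < |∑' i, a i| / 2 := by positivity
  obtain ⟨s, hS⟩ := (Metric.tendsto_atTop.1 hsum.of_abs.hasSum) _ hpos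
  obtain ⟨m, hm⟩ := exists_subset_cube s
  refine ⟨(∑' i, |a i|) / (|∑' i, a i| / 2), ?_⟩
  filter_upwards [eventually_ge_atTop (2 * m + 1)] with n hn
  refine coeffSum_mul_rate_le (M := 1) (T := cube d (n - m)) (by omega) hpos one_pos
    -- For `j` in the cube of side parameter `n - m`, the translated cube still contains the finite
    -- set carrying most of `∑ a_i`, and `n ≥ 2m + 1` leaves at least `n^d` such `j`.
    (fun j => ?_) ?_ (fun j hj => ?_) (hs n)
  · rw [coeffSum_eq_sum_image, mul_one]
    exact (Finset.abs_sum_le_sum_abs _ _).trans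
      (hsum.sum_le_tsum _ fun i _ => abs_nonneg _)
  · rw [card_cube]
    exact Nat.pow_le_pow_left (by omega) d
  · rw [coeffSum_eq_sum_image, mul_one]
    have h1 := hS ((cube d n).image (· - j)) fun v hv => by
      rw [Finset.mem_image]
      refine ⟨v + j, mem_cube.2 fun k => ?_, by simp⟩
      have h2 := mem_cube.1 (hm hv) k
      have h3 := mem_cube.1 hj k
      rw [Nat.cast_sub (by omega)] at h3
      have := abs_add_le (v k) (j k)
      simp only [Pi.add_apply]
      omega
    rw [Real.dist_eq] at h1
    have h2 := abs_sub_abs_le_abs_sub (∑' i, a i) (∑ v ∈ (cube d n).image (· - j), a v)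
    rw [abs_sub_comm] at h2
    linarith

/-! ### Slowly varying functions -/

namespace SlowlyVarying

variable {l : ℝ → ℝ}

/-- `l` is only assumed measurable on `[1, ∞)`; truncating the argument at `1` gives a measurable
function on the line. -/
theorem measurable_max (h : SlowlyVarying l) : Measurable fun x => l (max 1 x) :=
  h.1.comp (f := fun x : ℝ => (⟨max 1 x, le_max_left 1 x⟩ : Set.Ici (1 : ℝ)))
    (Measurable.subtype_mk (by fun_prop))

theorem eventually_ne_zero (h : SlowlyVarying l) : ∀ᶠ x in atTop, l x ≠ 0 := by
  filter_upwards [(h.2 2 two_pos).eventually_ne one_ne_zero] with x hx h0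
  simp [h0] at hx

theorem tendstoInMeasure (h : SlowlyVarying l) {x : ℕ → ℝ} (hx : Tendsto x atTop atTop) (b : ℝ) :
    TendstoInMeasure (volume.restrict (Set.Icc 1 b)) (fun m v => l (max 1 (v * x m)) / l (x m))
      atTop fun _ => 1 := by
  refine tendstoInMeasure_of_tendsto_ae (fun m => ?_) ?_
  · exact ((h.measurable_max.comp (measurable_id.mul_const (x m))).div_const
      (l (x m))).aestronglyMeasurable
  · refine (ae_restrict_iff' measurableSet_Icc).2 (ae_of_all _ fun v hv => ?_)
    have hv0 : 0 < v := by linarith [hv.1]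
    refine ((h.2 v hv0).comp hx).congr' ?_
    filter_upwards [hx.eventually_ge_atTop 1] with m hm
    have : 1 ≤ v * x m := by nlinarith [hv.1]
    simp [max_eq_right this]

/-- Local uniform convergence in the definition of slow variation. -/
theorem eventually_forall_Icc (h : SlowlyVarying l) {η : ℝ} (hη : 0 < η) :
    ∃ x₀, 1 ≤ x₀ ∧ ∀ x ≥ x₀, ∀ t ∈ Set.Icc (1 : ℝ) 2, |l (t * x) / l x - 1| ≤ η := by
  -- Otherwise there are bad `x_m → ∞` and `t_m ∈ [1, 2]`. By convergence in measure, some `v ∈ [1,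
  -- 2]` makes both `l(t v x)/l(x)` and `l(v t x)/l(t x)` close to `1`; their quotient is `l(t
  -- x)/l(x)`, a contradiction.
  by_contra! hcon
  have hcon' : ∀ m : ℕ, ∃ x : ℝ, (m : ℝ) + 1 ≤ x ∧ ∃ t ∈ Set.Icc (1 : ℝ) 2,
      η < |l (t * x) / l x - 1| := fun m => hcon _ (by linarith [(Nat.cast_nonneg m : (0 : ℝ) ≤ m)])
  choose x hxm t ht hbad using hcon'
  have hx : Tendsto x atTop atTop :=
    tendsto_atTop_mono (fun m => by linarith [hxm m]) tendsto_natCast_atTop_atTop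
  have htx : Tendsto (fun m => t m * x m) atTop atTop := by
    refine tendsto_atTop_mono (fun m => ?_) hx
    have := (ht m).1
    have := hxm m
    nlinarith [(Nat.cast_nonneg m : (0 : ℝ) ≤ m)]
  set e := min (η / 4) (1 / 4) with he
  have he0 : 0 < e := by positivity
  have hE : (0 : ENNReal) < ENNReal.ofReal (1 / 4) := by simp
  have h1 := (h.tendstoInMeasure hx 4 (ENNReal.ofReal e) (by simpa using he0)).eventually_lt_const hE
  have h2 := (h.tendstoInMeasure htx 2 (ENNReal.ofReal e) (by simpa using he0)).eventually_lt_const hE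
  obtain ⟨m, hm1, hm2, hl1, hl2⟩ := (h1.and (h2.and ((hx.eventually h.eventually_ne_zero).and
    (htx.eventually h.eventually_ne_zero)))).exists
  have ht1 := (ht m).1
  have ht2 := (ht m).2
  have hx1 : 1 ≤ x m := by linarith [hxm m, (Nat.cast_nonneg m : (0 : ℝ) ≤ m)]
  set P : Set ℝ := {v | ENNReal.ofReal e ≤ edist (l (max 1 (v * x m)) / l (x m)) 1}
  set Q : Set ℝ := {v | ENNReal.ofReal e ≤ edist (l (max 1 (v * (t m * x m))) / l (t m * x m)) 1}
  -- The point `t v` ranges in `[1, 4]`. The two exceptional sets have total measure at most `1/2`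
  -- in `v`, less than the length of `[1, 2]`.
  rw [Measure.restrict_apply' measurableSet_Icc] at hm1 hm2
  obtain ⟨v, hv, hvP, hvQ⟩ : ∃ v ∈ Set.Icc (1 : ℝ) 2, t m * v ∉ P ∧ v ∉ Q := by
    by_contra! hc
    have hsub : Set.Icc (1 : ℝ) 2 ⊆
        (fun v => t m * v) ⁻¹' (P ∩ Set.Icc 1 4) ∪ (Q ∩ Set.Icc 1 2) := by
      intro v hv
      by_cases hP : t m * v ∈ P
      · refine Or.inl ⟨hP, ?_, ?_⟩
        · nlinarith [hv.1]
        · nlinarith [hv.2, hv.1]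
      · exact Or.inr ⟨hc v hv hP, hv⟩
    have hvol := (measure_mono (μ := volume) hsub).trans (measure_union_le _ _)
    rw [Real.volume_Icc, Real.volume_preimage_mul_left (by linarith)] at hvol
    have h3 : ENNReal.ofReal |(t m)⁻¹| * volume (P ∩ Set.Icc 1 4) ≤ ENNReal.ofReal (1 / 4) := by
      calc _ ≤ 1 * volume (P ∩ Set.Icc 1 4) := by
            gcongr
            rw [ENNReal.ofReal_le_one, abs_of_pos (by positivity)]
            exact inv_le_one_of_one_le₀ ht1
        _ ≤ _ := by rw [one_mul]; exact hm1.le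
    have h4 := hvol.trans (add_le_add h3 hm2.le)
    rw [← ENNReal.ofReal_add (by norm_num) (by norm_num),
      ENNReal.ofReal_le_ofReal_iff (by norm_num)] at h4
    norm_num at h4
  have hdist : ∀ {y : ℝ}, ¬ ENNReal.ofReal e ≤ edist y 1 → |y - 1| < e := fun {y} hy => by
    rw [not_le, edist_dist, ENNReal.ofReal_lt_ofReal_iff he0, Real.dist_eq] at hy
    exact hy
  have hP := hdist hvP
  have hQ := hdist hvQ
  rw [show v * (t m * x m) = t m * v * x m by ring] at hQ
  set w := l (max 1 (t m * v * x m))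
  have hq0 : 0 < w / l (t m * x m) := by
    have := (abs_lt.1 hQ).1
    have : e ≤ 1 / 4 := min_le_right _ _
    linarith
  have hw : w ≠ 0 := fun h0 => by simp [h0] at hq0
  refine (hbad m).not_ge ?_
  have hee : e ≤ η / 4 := min_le_left _ _
  have hee' : e ≤ 1 / 4 := min_le_right _ _
  have hr : l (t m * x m) / l (x m) * (w / l (t m * x m)) = w / l (x m) := by
    field_simp
  set r := l (t m * x m) / l (x m)
  set q := w / l (t m * x m)
  set p := w / l (x m)
  rw [abs_lt] at hP hQ
  have h5 : r - 1 = (p - q) / q := by rw [← hr]; field_simp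
  rw [h5, abs_div, abs_of_pos hq0, div_le_iff₀ hq0, abs_le]
  constructor <;> nlinarith

/-- Potter's bounds. -/
theorem potter (h : SlowlyVarying l) {δ : ℝ} (hδ : 0 < δ) :
    ∃ x₀, 1 ≤ x₀ ∧ ∀ x ≥ x₀, l x ≠ 0 ∧ ∀ y ≥ x,
      |l y| ≤ 2 ^ δ * (y / x) ^ δ * |l x| ∧ |l x| ≤ 2 ^ δ * (y / x) ^ δ * |l y| := by
  -- The tolerance is chosen so that `l` changes by a factor between `2^{-δ}` and `2^δ` over one
  -- dyadic step; `iter` chains such steps.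
  have h2 : (1 : ℝ) < 2 ^ δ := Real.one_lt_rpow (by norm_num) hδ
  have h2' : ((2 : ℝ) ^ δ)⁻¹ < 1 := inv_lt_one_of_one_lt₀ h2
  obtain ⟨x₁, hx₁, hu⟩ := h.eventually_forall_Icc
    (η := min ((2 : ℝ) ^ δ - 1) (1 - ((2 : ℝ) ^ δ)⁻¹)) (lt_min (by linarith) (by linarith))
  obtain ⟨x₂, hx₂⟩ := eventually_atTop.1 h.eventually_ne_zero
  have step : ∀ x ≥ max x₁ x₂, ∀ t ∈ Set.Icc (1 : ℝ) 2,
      |l (t * x)| ≤ 2 ^ δ * |l x| ∧ |l x| ≤ 2 ^ δ * |l (t * x)| := by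
    intro x hx t ht
    have hlx : 0 < |l x| := abs_pos.2 (hx₂ x ((le_max_right _ _).trans hx))
    have h3 := abs_le.1 (hu x ((le_max_left _ _).trans hx) t ht)
    have h4 : l (t * x) / l x ≤ 2 ^ δ := by
      linarith [min_le_left ((2 : ℝ) ^ δ - 1) (1 - ((2 : ℝ) ^ δ)⁻¹)]
    have h5 : ((2 : ℝ) ^ δ)⁻¹ ≤ l (t * x) / l x := by
      linarith [min_le_right ((2 : ℝ) ^ δ - 1) (1 - ((2 : ℝ) ^ δ)⁻¹)]
    have h6 : 0 < l (t * x) / l x := lt_of_lt_of_le (by positivity) h5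
    have h7 : |l (t * x)| = l (t * x) / l x * |l x| := by
      rw [← abs_of_pos h6, abs_div]; field_simp
    rw [h7]
    refine ⟨by gcongr, ?_⟩
    calc |l x| = 2 ^ δ * (((2 : ℝ) ^ δ)⁻¹ * |l x|) := by field_simp
      _ ≤ _ := by gcongr
  have iter : ∀ k : ℕ, ∀ x ≥ max x₁ x₂, ∀ t ∈ Set.Icc (1 : ℝ) 2,
      |l (2 ^ k * t * x)| ≤ (2 ^ δ) ^ (k + 1) * |l x| ∧
        |l x| ≤ (2 ^ δ) ^ (k + 1) * |l (2 ^ k * t * x)| := by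
    intro k
    induction k with
    | zero => intro x hx t ht; simpa using step x hx t ht
    | succ k ih =>
      intro x hx t ht
      have hx0 : 0 < x := by linarith [(le_max_left x₁ x₂).trans hx]
      obtain ⟨h3, h4⟩ := ih x hx t ht
      have hk : (1 : ℝ) ≤ 2 ^ k := one_le_pow₀ (by norm_num)
      have h1t : 1 ≤ 2 ^ k * t := by nlinarith [ht.1]
      obtain ⟨h5, h6⟩ := step (2 ^ k * t * x) (by nlinarith) 2 (by norm_num)
      rw [show (2 : ℝ) ^ (k + 1) * t * x = 2 * (2 ^ k * t * x) by ring]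
      constructor
      · calc _ ≤ 2 ^ δ * ((2 ^ δ) ^ (k + 1) * |l x|) := h5.trans (by gcongr)
          _ = _ := by ring
      · calc _ ≤ (2 ^ δ) ^ (k + 1) * (2 ^ δ * |l (2 * (2 ^ k * t * x))|) := h4.trans (by gcongr)
          _ = _ := by ring
  refine ⟨max x₁ x₂, hx₁.trans (le_max_left _ _), fun x hx =>
    ⟨hx₂ x ((le_max_right _ _).trans hx), fun y hy => ?_⟩⟩
  have hx0 : 0 < x := by linarith [(le_max_left x₁ x₂).trans hx]
  have hyx : 1 ≤ y / x := (one_le_div hx0).2 hy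
  obtain ⟨k, hk1, hk2⟩ := exists_nat_pow_near hyx one_lt_two
  have hkt : (y / x) / 2 ^ k ∈ Set.Icc (1 : ℝ) 2 :=
    ⟨(one_le_div (by positivity)).2 hk1, (div_le_iff₀ (by positivity)).2 (by
      rw [pow_succ] at hk2; linarith)⟩
  obtain ⟨h3, h4⟩ := iter k x hx _ hkt
  have e1 : (2 : ℝ) ^ k * (y / x / 2 ^ k) * x = y := by field_simp
  rw [e1] at h3 h4
  have e2 : ((2 : ℝ) ^ δ) ^ (k + 1) ≤ 2 ^ δ * (y / x) ^ δ := by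
    rw [pow_succ, mul_comm, ← Real.rpow_natCast, ← Real.rpow_mul (by norm_num), mul_comm δ,
      Real.rpow_mul (by norm_num), Real.rpow_natCast]
    gcongr
  exact ⟨h3.trans (by gcongr), h4.trans (by gcongr)⟩

end SlowlyVarying

/-! ### Long memory -/

theorem latticePoint_apply {d : ℕ} (i : Fin d → ℤ) (k : Fin d) : latticePoint i k = i k := rfl

theorem abs_le_norm_latticePoint {d : ℕ} (i : Fin d → ℤ) (k : Fin d) :
    (|i k| : ℤ) ≤ ‖latticePoint i‖ := by
  have := PiLp.norm_apply_le (latticePoint i) k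
  rwa [latticePoint_apply, Real.norm_eq_abs, ← Int.cast_abs] at this

theorem latticePoint_ne_zero {d : ℕ} {i : Fin d → ℤ} (hi : i ≠ 0) : latticePoint i ≠ 0 := by
  obtain ⟨k, hk⟩ := Function.ne_iff.1 hi
  intro h
  have := abs_le_norm_latticePoint i k
  rw [h, norm_zero] at this
  have h2 : |i k| ≤ 0 := by exact_mod_cast this
  exact hk (abs_nonpos_iff.1 h2)

theorem le_norm_of_notMem_cube {d n : ℕ} {i : Fin d → ℤ} (hi : i ∉ cube d n) :
    (n : ℝ) + 1 ≤ ‖latticePoint i‖ := by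
  simp only [mem_cube, not_forall, not_le] at hi
  obtain ⟨k, hk⟩ := hi
  refine le_trans ?_ (abs_le_norm_latticePoint i k)
  exact_mod_cast hk

/-- Dyadic induction: the outer shell contributes at most `A n^{d-γ}` and the cube of half size a
fraction `c = 2^{-(d-γ)} < 1` of the claimed bound, so `A / (1 - c)` is a fixed point. -/
theorem sum_cube_rpow_le (d : ℕ) {γ : ℝ} (hγ : 0 ≤ γ) (hγd : γ < d) :
    ∃ D, ∀ n : ℕ, 1 ≤ n →
      ∑ v ∈ cube d n, (max 1 ‖latticePoint v‖) ^ (-γ) ≤ D * (n : ℝ) ^ (d - γ) := by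
  have hc : (2 : ℝ) ^ (-(d - γ)) < 1 := Real.rpow_lt_one_of_one_lt_of_neg (by norm_num) (by linarith)
  set c := (2 : ℝ) ^ (-(d - γ))
  set A := (3 : ℝ) ^ d * 2 ^ γ
  have hA : 0 < A := by positivity
  have hc0 : 0 < 1 - c := by linarith
  refine ⟨A / (1 - c), fun n => ?_⟩
  induction n using Nat.strong_induction_on with
  | _ n ih =>
    intro hn
    have hn0 : (0 : ℝ) < n := by exact_mod_cast hn
    have hn1 : (1 : ℝ) ≤ n := by exact_mod_cast hn
    have hcard : ((cube d n).card : ℝ) ≤ 3 ^ d * n ^ d := by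
      rw [card_cube, ← mul_pow]
      push_cast
      gcongr
      linarith
    have hshell : ∀ m : ℕ, (n : ℝ) / 2 ≤ m + 1 →
        ∑ v ∈ cube d n \ cube d m, (max 1 ‖latticePoint v‖) ^ (-γ) ≤ A * (n : ℝ) ^ (d - γ) := by
      intro m hm
      calc _ ≤ ∑ _v ∈ cube d n \ cube d m, ((n : ℝ) / 2) ^ (-γ) := by
            refine Finset.sum_le_sum fun v hv => ?_
            have := le_norm_of_notMem_cube (Finset.mem_sdiff.1 hv).2
            refine Real.rpow_le_rpow_of_nonpos (by positivity) ?_ (by linarith)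
            exact (hm.trans this).trans (le_max_right _ _)
        _ = (cube d n \ cube d m).card * ((n : ℝ) / 2) ^ (-γ) := by simp
        _ ≤ (3 ^ d * n ^ d) * ((n : ℝ) / 2) ^ (-γ) := by
            gcongr
            refine le_trans ?_ hcard
            exact_mod_cast Finset.card_le_card Finset.sdiff_subset
        _ = _ := by
            rw [Real.rpow_sub hn0, Real.rpow_natCast, Real.div_rpow hn0.le (by norm_num),
              Real.rpow_neg hn0.le, Real.rpow_neg (by norm_num)]
            simp only [A]
            field_simp
    rcases hn.eq_or_lt with h1 | h1
    · have h2 : ∑ v ∈ cube d n, (max 1 ‖latticePoint v‖) ^ (-γ) ≤ (cube d n).card := by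
        rw [← nsmul_one, ← Finset.sum_const]
        refine Finset.sum_le_sum fun v _ => ?_
        exact Real.rpow_le_one_of_one_le_of_nonpos (le_max_left _ _) (by linarith)
      refine h2.trans (hcard.trans ?_)
      rw [← h1]
      simp only [Nat.cast_one, one_pow, mul_one, Real.one_rpow]
      rw [le_div_iff₀ hc0]
      have h3 : (1 : ℝ) ≤ 2 ^ γ := Real.one_le_rpow (by norm_num) hγ
      have hcpos : 0 < c := by positivity
      have : (0 : ℝ) < 3 ^ d := by positivity
      calc (3 : ℝ) ^ d * (1 - c) ≤ 3 ^ d * 1 := by gcongr; linarith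
        _ ≤ A := by simp only [A]; gcongr
    · have h2 := ih (n / 2) (by omega) (by omega)
      have h3 := hshell (n / 2) (by
        have : n ≤ 2 * (n / 2 + 1) := by omega
        have : (n : ℝ) ≤ 2 * ((n / 2 : ℕ) + 1) := by exact_mod_cast this
        linarith)
      have h4 : (((n / 2 : ℕ) : ℝ)) ^ (d - γ) ≤ c * (n : ℝ) ^ (d - γ) := by
        calc _ ≤ ((n : ℝ) / 2) ^ (d - γ) := by
              refine Real.rpow_le_rpow (by positivity) Nat.cast_div_le (by linarith)
          _ = _ := by
              rw [Real.div_rpow hn0.le (by norm_num), show c = (2 : ℝ) ^ (-(d - γ)) from rfl,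
                Real.rpow_neg (by norm_num)]
              field_simp
      rw [← Finset.sum_sdiff (cube_mono d (Nat.div_le_self n 2))]
      calc _ ≤ A * (n : ℝ) ^ (d - γ) + A / (1 - c) * (c * (n : ℝ) ^ (d - γ)) :=
            add_le_add h3 (h2.trans (by gcongr))
        _ = _ := by field_simp; ring

/-- Uniformity in `j`: points of the translated cube outside the centred one have norm above `n` and
contribute at most `2`; the others are bounded by the centred sum. -/
theorem sum_cube_translate_le (d : ℕ) {γ : ℝ} (hγ : 0 ≤ γ) (hγd : γ < d) :
    ∃ D, ∀ n : ℕ, 1 ≤ n → ∀ j : Fin d → ℤ,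
      ∑ i ∈ cube d n, (1 + (n / max 1 ‖latticePoint (i - j)‖) ^ γ) ≤ D * (n : ℝ) ^ d := by
  obtain ⟨D, hD⟩ := sum_cube_rpow_le d hγ hγd
  refine ⟨2 * 3 ^ d + D, fun n hn j => ?_⟩
  have hn0 : (0 : ℝ) < n := by exact_mod_cast hn
  have hn1 : (1 : ℝ) ≤ n := by exact_mod_cast hn
  have hcard : ((cube d n).card : ℝ) ≤ 3 ^ d * n ^ d := by
    rw [card_cube, ← mul_pow]
    push_cast
    gcongr
    linarith
  have hterm : ∀ v : Fin d → ℤ, (0 : ℝ) < max 1 ‖latticePoint v‖ := fun v =>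
    lt_of_lt_of_le one_pos (le_max_left _ _)
  set T := (cube d n).image (· - j) with hT
  have hTc : T.card ≤ (cube d n).card := Finset.card_image_le
  have h1 : ∑ i ∈ cube d n, (1 + (n / max 1 ‖latticePoint (i - j)‖) ^ γ) =
      ∑ v ∈ T, (1 + (n / max 1 ‖latticePoint v‖) ^ γ) := by
    rw [hT, Finset.sum_image (fun x _ y _ h => sub_left_injective h)]
  have h2 : ∀ v ∈ T, (1 + (n / max 1 ‖latticePoint v‖) ^ γ) ≤
      2 + if v ∈ cube d n then (n / max 1 ‖latticePoint v‖) ^ γ else 0 := by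
    intro v _
    split_ifs with hv
    · linarith
    · have : (n / max 1 ‖latticePoint v‖) ^ γ ≤ 1 := by
        refine Real.rpow_le_one (div_nonneg hn0.le (hterm v).le) ?_ hγ
        rw [div_le_one (hterm v)]
        linarith [le_norm_of_notMem_cube hv, le_max_right 1 ‖latticePoint v‖]
      linarith
  rw [h1]
  calc _ ≤ ∑ v ∈ T, (2 + if v ∈ cube d n then (n / max 1 ‖latticePoint v‖) ^ γ else 0) :=
        Finset.sum_le_sum h2
    _ = T.card * 2 + ∑ v ∈ T with v ∈ cube d n, (n / max 1 ‖latticePoint v‖) ^ γ := by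
        rw [Finset.sum_add_distrib, Finset.sum_const, nsmul_eq_mul, Finset.sum_filter]
    _ ≤ (3 ^ d * n ^ d) * 2 + ∑ v ∈ cube d n, (n / max 1 ‖latticePoint v‖) ^ γ := by
        gcongr
        · refine le_trans ?_ hcard
          exact_mod_cast hTc
        · exact fun v hv => (Finset.mem_filter.1 hv).2
    _ = (3 ^ d * n ^ d) * 2 +
          (n : ℝ) ^ γ * ∑ v ∈ cube d n, (max 1 ‖latticePoint v‖) ^ (-γ) := by
        rw [Finset.mul_sum]
        congr 1
        refine Finset.sum_congr rfl fun v _ => ?_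
        rw [Real.div_rpow hn0.le (hterm v).le, Real.rpow_neg (hterm v).le, div_eq_mul_inv]
    _ ≤ (3 ^ d * n ^ d) * 2 + (n : ℝ) ^ γ * (D * (n : ℝ) ^ (d - γ)) := by
        gcongr
        exact hD n hn
    _ = _ := by
        rw [Real.rpow_sub hn0, Real.rpow_natCast]
        have : (n : ℝ) ^ γ ≠ 0 := (Real.rpow_pos_of_pos hn0 _).ne'
        field_simp

theorem exists_abs_coeffSum_le {d : ℕ} {a : (Fin d → ℤ) → ℝ} {α : ℝ} {l : ℝ → ℝ}
    {b : EuclideanSpace ℝ (Fin d) → ℝ} (hα0 : 0 < α) (hαd : α < d) (hl : SlowlyVarying l)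
    (hb : ContinuousOn b (Metric.sphere 0 1))
    (ha : ∀ i : Fin d → ℤ, i ≠ 0 → a i = l ‖latticePoint i‖ *
      b (‖latticePoint i‖⁻¹ • latticePoint i) * ‖latticePoint i‖ ^ (-α)) :
    ∃ K, ∀ᶠ n : ℕ in atTop, ∀ j,
      |coeffSum a n j| ≤ K * (|l n| * (n : ℝ) ^ (-α) * (n : ℝ) ^ d) := by
  -- `α + δ < d` keeps the singularity at the origin summable at the scale of the cube, and `δ ≤ α`
  -- controls the terms with norm above `n`.
  obtain ⟨δ, hδ, hδα, hδd⟩ : ∃ δ, 0 < δ ∧ δ ≤ α ∧ α + δ < d :=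
    ⟨min α ((d - α) / 2), lt_min hα0 (by linarith), min_le_left _ _, by
      linarith [min_le_right α (((d : ℝ) - α) / 2)]⟩
  obtain ⟨x₀, hx₀, hP⟩ := hl.potter hδ
  obtain ⟨Bb, hBb⟩ := (isCompact_sphere (0 : EuclideanSpace ℝ (Fin d)) 1).exists_bound_of_continuousOn hb
  obtain ⟨m₀, hm₀⟩ := exists_nat_ge x₀
  obtain ⟨D, hD⟩ := sum_cube_translate_le d (γ := α + δ) (by linarith) hδd
  set M := ∑ v ∈ cube d m₀, |a v| with hM
  have hM0 : 0 ≤ M := Finset.sum_nonneg fun _ _ => abs_nonneg _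
  have hx0 : 0 < x₀ := by linarith
  set Q := (2 : ℝ) ^ δ with hQ
  have hQ0 : 0 < Q := by positivity
  have hlx0 : 0 < |l x₀| := abs_pos.2 (hP x₀ le_rfl).1
  set K := max 0 Bb * Q + M * Q * x₀ ^ α / |l x₀| with hK
  set N : (Fin d → ℤ) → ℝ := fun v => max 1 ‖latticePoint v‖ with hN
  have hN1 : ∀ v, 1 ≤ N v := fun v => le_max_left _ _
  have hN0 : ∀ v, 0 < N v := fun v => lt_of_lt_of_le one_pos (hN1 v)
  -- A pointwise comparison with the size `|l(n)| n^{-α}` at distance `n`. Potter's bounds apply in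
  -- both directions for norms beyond `x₀`; the finitely many nearer terms, including the
  -- unrestricted `a 0`, are absorbed through `M`.
  have key : ∀ n : ℕ, x₀ ≤ n → ∀ v,
      |a v| ≤ K * (|l n| * (n : ℝ) ^ (-α)) * (1 + (n / N v) ^ (α + δ)) := by
    intro n hn v
    have hn0 : (0 : ℝ) < n := by linarith
    have hln : 0 < |l n| := abs_pos.2 (hP n hn).1
    have hpow : 0 ≤ ((n : ℝ) / N v) ^ (α + δ) :=
      Real.rpow_nonneg (div_nonneg hn0.le (hN0 v).le) _
    by_cases hv : ‖latticePoint v‖ < x₀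
    · have hvM : |a v| ≤ M := by
        refine Finset.single_le_sum (f := fun v => |a v|) (fun _ _ => abs_nonneg _) ?_
        by_contra hv'
        linarith [le_norm_of_notMem_cube hv']
      have hNx : N v ≤ x₀ := max_le hx₀ hv.le
      have h1 := ((hP x₀ le_rfl).2 n hn).2
      have h2 : (1 : ℝ) ≤ Q * x₀ ^ α / |l x₀| *
          (|l n| * (n : ℝ) ^ (-α)) * ((n : ℝ) / N v) ^ (α + δ) := by
        calc (1 : ℝ) ≤ (Q * (n / x₀) ^ δ * |l n|) / |l x₀| := (one_le_div hlx0).2 h1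
          _ = Q * x₀ ^ α / |l x₀| * (|l n| * (n : ℝ) ^ (-α)) * (n / x₀) ^ (α + δ) := by
              rw [Real.rpow_add (by positivity), Real.div_rpow hn0.le hx0.le α, Real.rpow_neg hn0.le]
              field_simp
          _ ≤ _ := by gcongr
      calc |a v| ≤ M * 1 := by linarith
        _ ≤ M * (Q * x₀ ^ α / |l x₀| *
          (|l n| * (n : ℝ) ^ (-α)) * ((n : ℝ) / N v) ^ (α + δ)) := by gcongr
        _ = M * Q * x₀ ^ α / |l x₀| *
          (|l n| * (n : ℝ) ^ (-α)) * ((n : ℝ) / N v) ^ (α + δ) := by ring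
        _ ≤ _ := by
          gcongr
          · have : 0 ≤ max 0 Bb := le_max_left _ _
            rw [hK]
            nlinarith [mul_nonneg this hQ0.le]
          · linarith
    · rw [not_lt] at hv
      have hNv : N v = ‖latticePoint v‖ := max_eq_right (hx₀.trans hv)
      have hv0 : v ≠ 0 := by
        rintro rfl
        have : latticePoint (0 : Fin d → ℤ) = 0 := by ext k; simp [latticePoint_apply]
        rw [this, norm_zero] at hv
        linarith
      have hne := latticePoint_ne_zero hv0
      have hw : 0 < ‖latticePoint v‖ := norm_pos_iff.2 hne
      have hbv : |b (‖latticePoint v‖⁻¹ • latticePoint v)| ≤ max 0 Bb := by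
        refine (hBb _ ?_).trans (le_max_right _ _)
        rw [mem_sphere_zero_iff_norm, norm_smul, norm_inv, norm_norm, inv_mul_cancel₀ hw.ne']
      have hla : |l ‖latticePoint v‖| * ‖latticePoint v‖ ^ (-α) ≤
          Q * (|l n| * (n : ℝ) ^ (-α)) * (1 + (n / N v) ^ (α + δ)) := by
        rw [hNv] at hpow ⊢
        set w := ‖latticePoint v‖
        rcases le_total w n with hwn | hwn
        · have h1 := ((hP w hv).2 n hwn).2
          calc |l w| * w ^ (-α) ≤ Q * (n / w) ^ δ * |l n| * w ^ (-α) := by gcongr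
            _ = Q * (|l n| * (n : ℝ) ^ (-α)) * (n / w) ^ (α + δ) := by
                rw [Real.rpow_add (by positivity), Real.div_rpow hn0.le hw.le α,
                  Real.rpow_neg hn0.le, Real.rpow_neg hw.le]
                field_simp
            _ ≤ _ := by gcongr; linarith
        · have h1 := ((hP n hn).2 w hwn).1
          calc |l w| * w ^ (-α) ≤ Q * (w / n) ^ δ * |l n| * w ^ (-α) := by gcongr
            _ = Q * (|l n| * (n : ℝ) ^ (-α)) * (w / n) ^ (δ - α) := by
                rw [Real.rpow_sub (by positivity), Real.div_rpow hw.le hn0.le α,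
                  Real.rpow_neg hn0.le, Real.rpow_neg hw.le]
                field_simp
            _ ≤ Q * (|l n| * (n : ℝ) ^ (-α)) * 1 := by
                gcongr
                exact Real.rpow_le_one_of_one_le_of_nonpos ((one_le_div hn0).2 hwn) (by linarith)
            _ ≤ _ := by gcongr; linarith
      rw [ha v hv0, abs_mul, abs_mul, abs_of_nonneg (Real.rpow_nonneg hw.le (-α))]
      have hB0 : 0 ≤ max 0 Bb := le_max_left _ _
      calc _ = |b (‖latticePoint v‖⁻¹ • latticePoint v)| *
            (|l ‖latticePoint v‖| * ‖latticePoint v‖ ^ (-α)) := by ring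
        _ ≤ max 0 Bb * (Q * (|l n| * (n : ℝ) ^ (-α)) * (1 + (n / N v) ^ (α + δ))) := by gcongr
        _ = max 0 Bb * Q * (|l n| * (n : ℝ) ^ (-α)) * (1 + (n / N v) ^ (α + δ)) := by ring
        _ ≤ _ := by
          gcongr
          rw [hK]
          have : 0 ≤ M * Q * x₀ ^ α / |l x₀| := by positivity
          linarith
  have hK0 : 0 ≤ K := by
    have : 0 ≤ max 0 Bb := le_max_left _ _
    positivity
  refine ⟨K * D, ?_⟩
  filter_upwards [eventually_ge_atTop m₀] with n hn j
  have hn' : x₀ ≤ n := hm₀.trans (by exact_mod_cast hn)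
  have hn1 : 1 ≤ n := by
    have : (1 : ℝ) ≤ n := hx₀.trans hn'
    exact_mod_cast this
  calc |coeffSum a n j| ≤ ∑ i ∈ cube d n, |a (i - j)| := Finset.abs_sum_le_sum_abs _ _
    _ ≤ ∑ i ∈ cube d n, K * (|l n| * (n : ℝ) ^ (-α)) * (1 + (n / N (i - j)) ^ (α + δ)) :=
        Finset.sum_le_sum fun i _ => key n hn' _
    _ = K * (|l n| * (n : ℝ) ^ (-α)) * ∑ i ∈ cube d n, (1 + (n / N (i - j)) ^ (α + δ)) := by
        rw [Finset.mul_sum]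
    _ ≤ K * (|l n| * (n : ℝ) ^ (-α)) * (D * (n : ℝ) ^ d) := by
        gcongr
        exact hD n hn1 j
    _ = _ := by ring

theorem norm_le_of_abs_apply_le {d : ℕ} {x : EuclideanSpace ℝ (Fin d)} {r : ℝ} (hr : 0 ≤ r)
    (h : ∀ k, |x k| ≤ r) : ‖x‖ ≤ d * r := by
  rw [EuclideanSpace.norm_eq]
  refine Real.sqrt_le_iff.2 ⟨by positivity, ?_⟩
  calc ∑ k, ‖x k‖ ^ 2 ≤ ∑ _k : Fin d, r ^ 2 := Finset.sum_le_sum fun k _ => by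
        have := h k
        rw [Real.norm_eq_abs]
        gcongr
    _ = d * r ^ 2 := by simp
    _ ≤ (d : ℝ) ^ 2 * r ^ 2 := by
        gcongr
        exact_mod_cast Nat.le_self_pow two_ne_zero d
    _ = _ := by ring

theorem dist_normalize_le {E : Type*} [NormedAddCommGroup E] [NormedSpace ℝ E] {u v : E} {t : ℝ}
    (hu : ‖u‖ = 1) (ht : 0 < t) (hv : v ≠ 0) : dist (‖v‖⁻¹ • v) u ≤ 2 * ‖v - t • u‖ / t := by
  have hv0 : 0 < ‖v‖ := norm_pos_iff.2 hv
  have htu : ‖t • u‖ = t := by rw [norm_smul, hu, mul_one, Real.norm_eq_abs, abs_of_pos ht]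
  have h1 : t • (‖v‖⁻¹ • v - u) = (t * ‖v‖⁻¹ - 1) • v + (v - t • u) := by module
  have h2 : ‖(t * ‖v‖⁻¹ - 1) • v‖ ≤ ‖v - t • u‖ := by
    rw [norm_smul, Real.norm_eq_abs]
    calc |t * ‖v‖⁻¹ - 1| * ‖v‖ = |(t * ‖v‖⁻¹ - 1) * ‖v‖| := by rw [abs_mul, abs_norm]
      _ = |‖t • u‖ - ‖v‖| := by rw [htu]; congr 1; field_simp
      _ ≤ ‖t • u - v‖ := abs_norm_sub_norm_le _ _
      _ = _ := norm_sub_rev _ _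
  have h3 : t * dist (‖v‖⁻¹ • v) u ≤ 2 * ‖v - t • u‖ := by
    rw [dist_eq_norm]
    calc t * ‖‖v‖⁻¹ • v - u‖ = ‖t • (‖v‖⁻¹ • v - u)‖ := by
          rw [norm_smul, Real.norm_eq_abs, abs_of_pos ht]
      _ ≤ ‖(t * ‖v‖⁻¹ - 1) • v‖ + ‖v - t • u‖ := by rw [h1]; exact norm_add_le _ _
      _ ≤ _ := by linarith
  rw [le_div_iff₀ ht]
  linarith

theorem le_abs_sum_of_forall_le_mul {ι : Type*} {s : Finset ι} {f : ι → ℝ} {g c : ℝ} (hg : |g| = 1)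
    (h : ∀ i ∈ s, c ≤ g * f i) : s.card * c ≤ |∑ i ∈ s, f i| := by
  calc (s.card : ℝ) * c = ∑ _i ∈ s, c := by simp
    _ ≤ ∑ i ∈ s, g * f i := Finset.sum_le_sum h
    _ = g * ∑ i ∈ s, f i := by rw [Finset.mul_sum]
    _ ≤ |g * ∑ i ∈ s, f i| := le_abs_self _
    _ = _ := by rw [abs_mul, hg, one_mul]

/-- The indices `j` are chosen so that every `i - j` lies near `t u`, with `t` of order `n` and `b u
≠ 0`. There `l` and `b` keep constant signs, so the terms of `b_{nj}` do not cancel and each has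
order at least `|l(n)| n^{-α}`. -/
theorem exists_le_abs_coeffSum {d : ℕ} (hd : 1 ≤ d) {a : (Fin d → ℤ) → ℝ} {α : ℝ} {l : ℝ → ℝ}
    {b : EuclideanSpace ℝ (Fin d) → ℝ} (hα0 : 0 < α) (hl : SlowlyVarying l)
    (hb : ContinuousOn b (Metric.sphere 0 1)) (hb0 : ∃ u ∈ Metric.sphere 0 1, b u ≠ 0)
    (ha : ∀ i : Fin d → ℤ, i ≠ 0 → a i = l ‖latticePoint i‖ *
      b (‖latticePoint i‖⁻¹ • latticePoint i) * ‖latticePoint i‖ ^ (-α)) :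
    ∃ c > 0, ∀ᶠ n : ℕ in atTop, ∃ T : Finset (Fin d → ℤ), n ^ d ≤ T.card ∧
      ∀ j ∈ T, c * (|l n| * (n : ℝ) ^ (-α) * (n : ℝ) ^ d) ≤ |coeffSum a n j| := by
  obtain ⟨u, hu, hbu⟩ := hb0
  have hbu0 : 0 < |b u| := abs_pos.2 hbu
  obtain ⟨η, hη, hbη⟩ := Metric.continuousOn_iff.1 hb u hu (|b u| / 2) (by positivity)
  rw [mem_sphere_zero_iff_norm] at hu
  have hd0 : (1 : ℝ) ≤ d := by exact_mod_cast hd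
  set e : ℝ := 3 * d with he
  have he0 : 0 < e := by positivity
  -- `e n` bounds the distance from `i - j` to `t u`. `R ≥ 2e` keeps the norm within `[ρ, 2ρ]`, and
  -- `R η > 2e` keeps the direction within `η` of `u`.
  set R : ℝ := 2 * e * (1 + 1 / η) with hR
  have hR0 : 0 < R := by positivity
  have hRe : 2 * e ≤ R := by
    rw [hR]
    exact le_mul_of_one_le_right (by positivity) (by linarith [one_div_pos.2 hη])
  have hR1 : 1 ≤ R := by linarith
  have hRη : 2 * e < R * η := by
    rw [hR, show 2 * e * (1 + 1 / η) * η = 2 * e * η + 2 * e by field_simp]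
    have : 0 < 2 * e * η := by positivity
    linarith
  obtain ⟨x₀, hx₀, hP⟩ := hl.potter one_pos
  obtain ⟨x₁, hx₁, hU⟩ := hl.eventually_forall_Icc (η := 1 / 2) (by norm_num)
  set c := (1 / 2 * (2 ^ (1 : ℝ) * R ^ (1 : ℝ))⁻¹) * (|b u| / 2) * (2 * R) ^ (-α) with hc
  refine ⟨c, by positivity, ?_⟩
  obtain ⟨m₀, hm₀⟩ := exists_nat_ge (max x₀ x₁)
  filter_upwards [eventually_ge_atTop m₀] with n hn
  have hnx : max x₀ x₁ ≤ n := hm₀.trans (by exact_mod_cast hn)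
  have hnx₀ : x₀ ≤ n := (le_max_left _ _).trans hnx
  have hnx₁ : x₁ ≤ n := (le_max_right _ _).trans hnx
  have hn1 : (1 : ℝ) ≤ n := hx₀.trans hnx₀
  have hn0 : (0 : ℝ) < n := by linarith
  -- The midpoint of `[ρ, 2ρ]` with `ρ = R n`, a dyadic window on which `l` is uniformly comparable
  -- with `l ρ`.
  set t : ℝ := 3 / 2 * R * n with ht
  have ht0 : 0 < t := by positivity
  set p : Fin d → ℤ := fun k => ⌊t * u k⌋ with hp
  set ρ : ℝ := R * n with hρ
  have hnρ : (n : ℝ) ≤ ρ := by rw [hρ]; exact le_mul_of_one_le_left hn0.le hR1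
  have hρ0 : 0 < ρ := by positivity
  have hlρ : l ρ ≠ 0 := (hP ρ (hnx₀.trans hnρ)).1
  have hlρ0 : 0 < |l ρ| := abs_pos.2 hlρ
  set g : ℝ := SignType.sign (l ρ) * SignType.sign (b u) with hg
  have hsgn : ∀ {y : ℝ}, y ≠ 0 → |(SignType.sign y : ℝ)| = 1 := fun {y} hy => by
    rcases hy.lt_or_gt with h | h
    · simp [sign_neg h]
    · simp [sign_pos h]
  have hg1 : |g| = 1 := by rw [hg, abs_mul, hsgn hlρ, hsgn hbu, one_mul]
  have hlow : ∀ v : Fin d → ℤ, (∀ k, |v k - p k| ≤ 2 * n) →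
      c * (|l n| * (n : ℝ) ^ (-α)) ≤ g * a v := by
    intro v hv
    have hdist : ‖latticePoint v - t • u‖ ≤ e * n := by
      rw [he, show 3 * (d : ℝ) * n = d * (3 * n) by ring]
      refine norm_le_of_abs_apply_le (by positivity) fun k => ?_
      have h1 : |(v k : ℝ) - p k| ≤ 2 * n := by exact_mod_cast hv k
      have h2 : |(p k : ℝ) - t * u k| ≤ 1 := by
        rw [abs_le]
        constructor
        · linarith [Int.lt_floor_add_one (t * u k)]
        · linarith [Int.floor_le (t * u k)]
      have h3 : (latticePoint v - t • u) k = ((v k : ℝ) - p k) + (p k - t * u k) := by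
        simp [latticePoint_apply]
      rw [h3]
      exact (abs_add_le _ _).trans (by linarith)
    have htu : ‖t • u‖ = t := by rw [norm_smul, hu, mul_one, Real.norm_eq_abs, abs_of_pos ht0]
    have henR : e * n ≤ ρ / 2 := by
      rw [hρ]; nlinarith
    have habs := abs_le.1 ((abs_norm_sub_norm_le (latticePoint v) (t • u)).trans hdist)
    rw [htu] at habs
    have htρ : t = 3 / 2 * ρ := by rw [ht, hρ]; ring
    have hw1 : ρ ≤ ‖latticePoint v‖ := by linarith [habs.1]
    have hw2 : ‖latticePoint v‖ ≤ 2 * ρ := by linarith [habs.2]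
    have hw0 : 0 < ‖latticePoint v‖ := by linarith
    have hvne : latticePoint v ≠ 0 := norm_pos_iff.1 hw0
    have hv0 : v ≠ 0 := by
      rintro rfl
      exact hvne (by ext k; simp [latticePoint_apply])
    have hbv : |b u| / 2 ≤ SignType.sign (b u) * b (‖latticePoint v‖⁻¹ • latticePoint v) := by
      have h1 := hbη (‖latticePoint v‖⁻¹ • latticePoint v) (by
        rw [mem_sphere_zero_iff_norm, norm_smul, norm_inv, norm_norm, inv_mul_cancel₀ hw0.ne']) (by
        refine (dist_normalize_le hu ht0 hvne).trans_lt ?_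
        rw [div_lt_iff₀ ht0]
        calc 2 * ‖latticePoint v - t • u‖ ≤ 2 * (e * n) := by gcongr
          _ = 2 * e * n := by ring
          _ < R * η * n := by gcongr
          _ ≤ η * t := by rw [ht]; nlinarith [mul_pos (mul_pos hR0 hη) hn0])
      rw [Real.dist_eq, abs_lt] at h1
      rcases hbu.lt_or_gt with h | h
      · rw [abs_of_neg h] at h1 ⊢
        simp only [sign_neg h, SignType.coe_neg, SignType.coe_one]
        linarith [h1.2]
      · rw [abs_of_pos h] at h1 ⊢
        simp only [sign_pos h, SignType.coe_one]
        linarith [h1.1]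
    have hlv : 1 / 2 * |l ρ| ≤ SignType.sign (l ρ) * l ‖latticePoint v‖ := by
      have h1 := abs_le.1 (hU ρ (hnx₁.trans hnρ) (‖latticePoint v‖ / ρ)
        ⟨(one_le_div hρ0).2 hw1, (div_le_iff₀ hρ0).2 hw2⟩)
      rw [div_mul_cancel₀ _ hρ0.ne'] at h1
      have h2 : (SignType.sign (l ρ) : ℝ) * l ‖latticePoint v‖ =
          l ‖latticePoint v‖ / l ρ * |l ρ| := by
        rw [← sign_mul_self (l ρ)]
        field_simp
      rw [h2]
      exact mul_le_mul_of_nonneg_right (by linarith [h1.1]) (abs_nonneg _)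
    have hln : (2 ^ (1 : ℝ) * R ^ (1 : ℝ))⁻¹ * |l n| ≤ |l ρ| := by
      have h1 := ((hP n hnx₀).2 ρ hnρ).2
      rw [show ρ / n = R by rw [hρ]; field_simp] at h1
      rw [inv_mul_le_iff₀ (by positivity)]
      exact h1
    have hpow : (2 * R) ^ (-α) * (n : ℝ) ^ (-α) ≤ ‖latticePoint v‖ ^ (-α) := by
      rw [← Real.mul_rpow (by positivity) hn0.le]
      refine Real.rpow_le_rpow_of_nonpos hw0 ?_ (by linarith)
      linarith
    rw [ha v hv0]
    calc c * (|l n| * (n : ℝ) ^ (-α)) =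
          (1 / 2 * ((2 ^ (1 : ℝ) * R ^ (1 : ℝ))⁻¹ * |l n|)) * (|b u| / 2) *
            ((2 * R) ^ (-α) * (n : ℝ) ^ (-α)) := by rw [hc]; ring
      _ ≤ (1 / 2 * |l ρ|) * (|b u| / 2) * ‖latticePoint v‖ ^ (-α) := by gcongr
      _ ≤ (SignType.sign (l ρ) * l ‖latticePoint v‖) *
          (SignType.sign (b u) * b (‖latticePoint v‖⁻¹ • latticePoint v)) *
            ‖latticePoint v‖ ^ (-α) := by
          have : 0 ≤ SignType.sign (l ρ) * l ‖latticePoint v‖ := le_trans (by positivity) hlv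
          gcongr
      _ = _ := by rw [hg]; ring
  refine ⟨(cube d n).image fun j => j - p, ?_, fun j hj => ?_⟩
  · rw [Finset.card_image_of_injective _ sub_left_injective, card_cube]
    exact Nat.pow_le_pow_left (by omega) d
  · obtain ⟨j', hj', rfl⟩ := Finset.mem_image.1 hj
    have h1 := le_abs_sum_of_forall_le_mul (s := cube d n) (f := fun i => a (i - (j' - p))) hg1
      (c := c * (|l n| * (n : ℝ) ^ (-α))) fun i hi => hlow _ fun k => by
        have h2 := mem_cube.1 hi k
        have h3 := mem_cube.1 hj' k
        have h4 : (i - (j' - p)) k - p k = i k - j' k := by simp only [Pi.sub_apply]; ring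
        rw [h4]
        have := abs_sub (i k) (j' k)
        omega
    refine le_trans ?_ h1
    have h5 : (n : ℝ) ^ d ≤ (cube d n).card := by
      rw [card_cube]
      exact_mod_cast Nat.pow_le_pow_left (by omega) d
    calc _ = (n : ℝ) ^ d * (c * (|l n| * (n : ℝ) ^ (-α))) := by ring
      _ ≤ _ := by gcongr

theorem LongMemory.exists_coeffSum_mul_rate_le {d : ℕ} (hd : 1 ≤ d) {a : (Fin d → ℤ) → ℝ}
    (h : LongMemory a) (hs : ∀ n, Summable fun j => coeffSum a n j ^ 2) :
    ∃ K, ∀ᶠ n in atTop, 0 < ∑' j, coeffSum a n j ^ 2 ∧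
      ∀ j, |coeffSum a n j| * rate d n ≤ K * √(∑' j, coeffSum a n j ^ 2) := by
  obtain ⟨α, l, b, hα, hαd, hl, hb, hb0, ha⟩ := h
  have hα0 : 0 < α := lt_of_le_of_lt (by positivity) hα
  obtain ⟨K, hK⟩ := exists_abs_coeffSum_le hα0 hαd hl hb ha
  obtain ⟨c, hc, hcT⟩ := exists_le_abs_coeffSum hd hα0 hl hb hb0 ha
  refine ⟨K / c, ?_⟩
  filter_upwards [hK, hcT, eventually_ge_atTop 1,
    tendsto_natCast_atTop_atTop.eventually hl.eventually_ne_zero] with n hKn hTn hn hln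
  obtain ⟨T, hT, hcT⟩ := hTn
  have hn0 : (0 : ℝ) < n := by exact_mod_cast hn
  have hln0 : 0 < |l n| := abs_pos.2 hln
  exact coeffSum_mul_rate_le hn hc (by positivity) hKn hT hcT (hs n)

/-! ### Sums of a linear random field -/

theorem exists_coeffSum_mul_rate_le {d : ℕ} (hd : 1 ≤ d) {a : (Fin d → ℤ) → ℝ}
    (h : ShortMemory a ∨ LongMemory a) (hs : ∀ n, Summable fun j => coeffSum a n j ^ 2) :
    ∃ K, ∀ᶠ n in atTop, 0 < ∑' j, coeffSum a n j ^ 2 ∧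
      ∀ j, |coeffSum a n j| * rate d n ≤ K * √(∑' j, coeffSum a n j ^ 2) :=
  h.elim (fun h => h.exists_coeffSum_mul_rate_le hs) fun h => h.exists_coeffSum_mul_rate_le hd hs

theorem sqrt_sumVar {d : ℕ} (a : (Fin d → ℤ) → ℝ) {σ : ℝ} (hσ : 0 < σ) (n : ℕ) :
    √(sumVar a σ n) = σ * √(∑' j, coeffSum a n j ^ 2) := by
  rw [sumVar, Real.sqrt_mul (sq_nonneg σ), Real.sqrt_sq hσ.le]

theorem sumVar_nonneg {d : ℕ} (a : (Fin d → ℤ) → ℝ) (σ : ℝ) (n : ℕ) : 0 ≤ sumVar a σ n :=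
  mul_nonneg (sq_nonneg σ) (tsum_nonneg fun _ => sq_nonneg _)

/-- The weights of the innovations in `S_n / √B_n` are `O(n^{-d/2})`. -/
theorem exists_normalized_coeffSum_le {d : ℕ} (hd : 1 ≤ d) {a : (Fin d → ℤ) → ℝ} {σ : ℝ}
    (hσ : 0 < σ) (h : ShortMemory a ∨ LongMemory a)
    (hs : ∀ n, Summable fun j => coeffSum a n j ^ 2) :
    (∀ᶠ n in atTop, 0 < sumVar a σ n) ∧
      ∃ k₀ > 0, ∀ n j, |coeffSum a n j / √(sumVar a σ n)| * rate d n ≤ k₀ := by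
  obtain ⟨K, hK⟩ := exists_coeffSum_mul_rate_le hd h hs
  refine ⟨hK.mono fun n hn => mul_pos (by positivity) hn.1, ?_⟩
  obtain ⟨n₀, hn₀⟩ := eventually_atTop.1 hK
  have hpos : 0 < max (K / σ) (rate d n₀ / σ) + 1 := by
    have : 0 ≤ rate d n₀ / σ := div_nonneg (rate_nonneg d n₀) hσ.le
    linarith [le_max_right (K / σ) (rate d n₀ / σ)]
  refine ⟨max (K / σ) (rate d n₀ / σ) + 1, hpos, fun n j => ?_⟩
  rw [abs_div, abs_of_nonneg (Real.sqrt_nonneg _), sqrt_sumVar a hσ]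
  set V := ∑' j, coeffSum a n j ^ 2 with hV
  have hV0 : 0 ≤ V := tsum_nonneg fun _ => sq_nonneg _
  -- If the variance vanishes, the quotient is `0` by the convention on division. For the other
  -- small `n`, the trivial `|b_{nj}| ≤ √V` suffices, since the rate is then at most `rate d n₀`.
  rcases hV0.eq_or_lt with h0 | hVpos
  · rw [← h0]
    simpa using hpos.le
  have hsq : 0 < √V := Real.sqrt_pos.2 hVpos
  rcases le_total n₀ n with hn | hn
  · have h1 := (hn₀ n hn).2 j
    calc |coeffSum a n j| / (σ * √V) * rate d n = |coeffSum a n j| * rate d n / (σ * √V) := by ring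
      _ ≤ K * √V / (σ * √V) := by gcongr
      _ = K / σ := by field_simp
      _ ≤ _ := by linarith [le_max_left (K / σ) (rate d n₀ / σ)]
  · have h1 : |coeffSum a n j| ≤ √V := by
      refine Real.le_sqrt_of_sq_le ?_
      rw [sq_abs]
      exact (hs n).le_tsum j fun _ _ => sq_nonneg _
    calc |coeffSum a n j| / (σ * √V) * rate d n ≤ √V / (σ * √V) * rate d n₀ := by
          have := rate_nonneg d n
          have := rate_mono d hn
          gcongr
      _ = rate d n₀ / σ := by field_simp
      _ ≤ _ := by linarith [le_max_right (K / σ) (rate d n₀ / σ)]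

theorem hasSum_normalized_coeffSum_sq {d : ℕ} {a : (Fin d → ℤ) → ℝ} {σ : ℝ} {n : ℕ}
    (hσ : 0 < σ) (hs : Summable fun j => coeffSum a n j ^ 2) (hB : sumVar a σ n ≠ 0) :
    HasSum (fun j => (coeffSum a n j / √(sumVar a σ n)) ^ 2) (1 / σ ^ 2) := by
  have h1 := hs.hasSum.div_const (sumVar a σ n)
  have e : (∑' j, coeffSum a n j ^ 2) / sumVar a σ n = 1 / σ ^ 2 := by
    rw [sumVar] at hB ⊢
    have := right_ne_zero_of_mul hB
    field_simp
  rw [e] at h1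
  simpa only [div_pow, Real.sq_sqrt (sumVar_nonneg a σ n)] using h1

section

variable {Ω : Type*} [MeasurableSpace Ω] {μ : Measure Ω} {d : ℕ} {X : (Fin d → ℤ) → Ω → ℝ}
  {a : (Fin d → ℤ) → ℝ} {ε : (Fin d → ℤ) → Ω → ℝ}

theorem IsLinearField.aemeasurable_partialSum (hX : IsLinearField X a ε μ) (n : ℕ) :
    AEMeasurable (partialSum X n) μ :=
  Finset.aemeasurable_fun_sum _ fun j _ => (hX j).1

/-- Reindexing by `i ↦ j - i` lets all the fields `X_j` be approximated along one finite set `T` of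
innovations; the triangle inequality then sums the errors over the cube. -/
theorem IsLinearField.tendsto_partialSum (hX : IsLinearField X a ε μ)
    (hε : ∀ i, Measurable (ε i)) (n : ℕ) :
    Tendsto (fun T : Finset (Fin d → ℤ) =>
      eLpNorm (fun ω => partialSum X n ω - ∑ k ∈ T, coeffSum a n k * ε k ω) 2 μ) atTop (𝓝 0) := by
  have hj : ∀ j, Tendsto (fun T : Finset (Fin d → ℤ) =>
      eLpNorm (fun ω => X j ω - ∑ k ∈ T, a (j - k) * ε k ω) 2 μ) atTop (𝓝 0) := by
    intro j
    refine ((hX j).2.comp (tendsto_finset_image_atTop_atTop (i := fun k => j - k)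
      (j := fun k => j - k) fun k => sub_sub_cancel j k)).congr fun T => ?_
    simp only [Function.comp_apply]
    congr 1
    funext ω
    rw [Finset.sum_image fun x _ y _ h => sub_right_injective h]
    simp only [sub_sub_cancel]
  have hsum := tendsto_finsetSum (cube d n) fun j _ => hj j
  rw [Finset.sum_const_zero] at hsum
  refine tendsto_of_tendsto_of_tendsto_of_le_of_le tendsto_const_nhds hsum
    (fun _ => zero_le) fun T => ?_
  have e : (fun ω => partialSum X n ω - ∑ k ∈ T, coeffSum a n k * ε k ω) =
      ∑ j ∈ cube d n, fun ω => X j ω - ∑ k ∈ T, a (j - k) * ε k ω := by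
    funext ω
    simp only [partialSum, coeffSum, Finset.sum_apply, Finset.sum_sub_distrib, Finset.sum_mul]
    rw [Finset.sum_comm]
  simp only [e]
  refine eLpNorm_sum_le (fun j _ => ?_) (by norm_num)
  exact ((hX j).1.sub (Measurable.aemeasurable (by fun_prop))).aestronglyMeasurable

theorem tendsto_eLpNorm_div {ι : Type*} {c : ι → ℝ} {ε : ι → Ω → ℝ} {S : Ω → ℝ}
    (h : Tendsto (fun T : Finset ι => eLpNorm (fun ω => S ω - ∑ k ∈ T, c k * ε k ω) 2 μ)
      atTop (𝓝 0)) (s : ℝ) :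
    Tendsto (fun T : Finset ι => eLpNorm (fun ω => S ω / s - ∑ k ∈ T, c k / s * ε k ω) 2 μ)
      atTop (𝓝 0) := by
  have h1 := ENNReal.Tendsto.const_mul h (Or.inr (enorm_ne_top (x := s⁻¹)))
  rw [mul_zero] at h1
  refine h1.congr fun T => ?_
  rw [← eLpNorm_const_smul]
  congr 1
  funext ω
  simp only [Pi.smul_apply, smul_eq_mul, mul_sub, Finset.mul_sum]
  congr 1
  · ring
  · exact Finset.sum_congr rfl fun k _ => by ring

end

/-- The factor `2` in `2 k₀ R ≤ H` leaves room for the second moments of the exponentials used in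
passing to the infinite sum. -/
theorem IsInnovation.hasCubicCGF_map {Ω ι : Type*} [MeasurableSpace Ω] [Countable ι]
    {ε : ι → Ω → ℝ} {Y : Ω → ℝ} {μ : Measure Ω} {L : ℂ → ℂ} {H B Δ k₀ R : ℝ} {κ : ℕ → ℝ}
    (h : IsInnovation ε Y μ L H B)
    (hL : ∀ z ∈ Metric.ball (0 : ℂ) H, cgfSeries κ z = L z) {c : ι → ℝ}
    (hc : Summable fun k => c k ^ 2) {W : Ω → ℝ} (hW : AEMeasurable W μ)
    (hlim : Tendsto (fun s : Finset ι => eLpNorm (fun ω => W ω - ∑ k ∈ s, c k * ε k ω) 2 μ)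
      atTop (𝓝 0)) (hΔ : 0 < Δ) (hk : 0 < k₀) (hck : ∀ k, |c k| * Δ ≤ k₀) (hR : 2 * k₀ * R ≤ H) :
    HasCubicCGF (μ.map W) (scaledRemainder κ c Δ) R Δ := by
  have hΔc : (Δ : ℂ) ≠ 0 := by exact_mod_cast hΔ.ne'
  have hz : ∀ z : ℂ, ‖z‖ < R * Δ → ∀ k, |c k| * (2 * ‖z‖) < H := by
    intro z hz k
    have h1 : |c k| ≤ k₀ / Δ := (le_div_iff₀ hΔ).2 (hck k)
    calc |c k| * (2 * ‖z‖) ≤ k₀ / Δ * (2 * ‖z‖) := by gcongr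
      _ < k₀ / Δ * (2 * (R * Δ)) := by gcongr
      _ = 2 * k₀ * R := by field_simp
      _ ≤ H := hR
  have hmeas : ∀ z : ℂ, AEStronglyMeasurable (fun w : ℝ => Complex.exp (z * w)) (μ.map W) :=
    fun z => Continuous.aestronglyMeasurable (by fun_prop)
  refine ⟨fun z hzR => ?_, fun z hzR => ?_⟩
  · rw [integrable_map_measure (hmeas z) hW]
    exact (h.integrable_and_integral_exp_limit hc hW hlim (hz z hzR)).1
  · rw [integral_map hW (hmeas z),
      (h.integrable_and_integral_exp_limit hc hW hlim (hz z hzR)).2]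
    congr 1
    have e : ∀ k, L (c k * z) = cgfSeries κ (c k * (Δ * (z / Δ))) := fun k => by
      rw [mul_div_cancel₀ _ hΔc, hL]
      rw [mem_ball_zero_iff, norm_mul, Complex.norm_real, Real.norm_eq_abs]
      refine lt_of_le_of_lt ?_ (hz z hzR k)
      gcongr
      linarith [norm_nonneg z]
    rw [tsum_congr e, scaledRemainder]
    generalize ∑' k, cgfSeries κ (c k * (Δ * (z / Δ))) = V
    field_simp
    ring

/-- The strict inequality in `F_n` makes the complement the closed half line, the one handled by
tilting. -/
theorem one_sub_normDist {Ω : Type*} [MeasurableSpace Ω] {μ : Measure Ω} [IsProbabilityMeasure μ]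
    {d : ℕ} {X : (Fin d → ℤ) → Ω → ℝ} {a : (Fin d → ℤ) → ℝ} {σ : ℝ} {n : ℕ}
    (hS : AEMeasurable (partialSum X n) μ) (hB : 0 < sumVar a σ n) (x : ℝ) :
    1 - normDist X a σ μ n x =
      (μ.map fun ω => partialSum X n ω / √(sumVar a σ n)).real (Set.Ici x) := by
  have hsq : 0 < √(sumVar a σ n) := Real.sqrt_pos.2 hB
  rw [normDist, ← probReal_compl_eq_one_sub₀ (nullMeasurableSet_lt hS aemeasurable_const),
    map_measureReal_apply_of_aemeasurable (hS.div_const _) measurableSet_Ici]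
  congr 1
  ext ω
  simp [le_div_iff₀ hsq]

/-! ### The coefficients of the field and the main theorem -/

/-- The coefficients `β_{kn}` of the series `λ_n`, as a function of the cumulants `κ` of the
innovations and of the coefficients `a` of the field. -/
def fieldCramerCoeff {d : ℕ} (κ : ℕ → ℝ) (a : (Fin d → ℤ) → ℝ) (n k : ℕ) : ℝ :=
  -- `√(κ 2)` plays the role of `σ`. For `n` with `B_n = 0` the normalisation is void, and the value
  -- `0` preserves the uniform bounds.
  if sumVar a √(κ 2) n = 0 then 0 else
    cramerCoeff (scaledRemainder κ (fun j => coeffSum a n j / √(sumVar a √(κ 2) n)) (rate d n)) k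

theorem IsCGFOnDisc.norm_sub_sq_le {Ω : Type*} [MeasurableSpace Ω] {μ : Measure Ω}
    [IsProbabilityMeasure μ] {Y : Ω → ℝ} {L : ℂ → ℂ} {H C σ : ℝ} (h : IsCGFOnDisc L Y μ H) (hH : 0 < H) (hC : 0 < C)
    (hLC : ∀ z ∈ Metric.ball (0 : ℂ) H, ‖L z‖ < C) (hmean : ∫ ω, Y ω ∂μ = 0)
    (hvar : variance Y μ = σ ^ 2) :
    ∀ z ∈ Metric.ball (0 : ℂ) (H / 8), ‖L z - σ ^ 2 * z ^ 2 / 2‖ ≤ 64 * C / H ^ 3 * ‖z‖ ^ 3 := by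
  have h1 := h.iteratedDeriv_eq_cumulant hH 1
  have h2 := h.iteratedDeriv_eq_cumulant hH 2
  rw [h.cumulant_one hH, hmean, iteratedDeriv_one, Complex.ofReal_zero] at h1
  rw [h.cumulant_two hH, hvar, iteratedDeriv_succ, iteratedDeriv_one, Complex.ofReal_pow] at h2
  exact norm_sub_taylor_le hH hC.le h.analytic.differentiableOn (fun z hz => (hLC z hz).le)
    h.map_zero h1 h2

theorem norm_le_of_norm_sub_sq_le {L : ℂ → ℂ} {r M σ : ℝ} (hM : 0 ≤ M)
    (h : ∀ z ∈ Metric.ball (0 : ℂ) r, ‖L z - σ ^ 2 * z ^ 2 / 2‖ ≤ M * ‖z‖ ^ 3) :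
    ∀ z ∈ Metric.ball (0 : ℂ) r, ‖L z‖ ≤ (σ ^ 2 / 2 + M * r) * ‖z‖ ^ 2 := by
  intro z hz
  have h1 := h z hz
  rw [mem_ball_zero_iff] at hz
  have h2 : ‖(σ ^ 2 * z ^ 2 / 2 : ℂ)‖ = σ ^ 2 / 2 * ‖z‖ ^ 2 := by
    rw [norm_div, norm_mul, norm_pow, norm_pow, Complex.norm_real, Real.norm_eq_abs, sq_abs]
    norm_num
    ring
  calc ‖L z‖ = ‖(L z - σ ^ 2 * z ^ 2 / 2) + σ ^ 2 * z ^ 2 / 2‖ := by rw [sub_add_cancel]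
    _ ≤ M * ‖z‖ ^ 3 + σ ^ 2 / 2 * ‖z‖ ^ 2 := (norm_add_le _ _).trans (by rw [h2]; gcongr)
    _ = M * ‖z‖ * ‖z‖ ^ 2 + σ ^ 2 / 2 * ‖z‖ ^ 2 := by ring
    _ ≤ M * r * ‖z‖ ^ 2 + σ ^ 2 / 2 * ‖z‖ ^ 2 := by gcongr
    _ = _ := by ring

/-- The coefficients of `λ_n` recover the remainder of the Legendre transform. -/
theorem CubicRemainder.sq_mul_legendreRemainder_re {E : ℂ → ℂ} {A R Δ x : ℝ}
    (h : CubicRemainder E A R) (hΔ : 0 < Δ) (hx0 : 0 ≤ x)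
    (hx : x / Δ < CubicRemainder.saddleRadius A R / 8) :
    Δ ^ 2 * (legendreRemainder E ((x / Δ : ℝ) : ℂ)).re =
      x ^ 3 / Δ * ∑' k, cramerCoeff E k * (x / Δ) ^ k := by
  have h1 := h.pow_mul_tsum_cramerCoeff (t := ((x / Δ : ℝ) : ℂ)) (by
    rw [Complex.norm_real, Real.norm_eq_abs, abs_of_nonneg (by positivity)]
    exact hx)
  have h2 : ∑' k, (cramerCoeff E k : ℂ) * ((x / Δ : ℝ) : ℂ) ^ k =
      ((∑' k, cramerCoeff E k * (x / Δ) ^ k : ℝ) : ℂ) := by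
    rw [Complex.ofReal_tsum]
    push_cast
    rfl
  rw [h2, ← Complex.ofReal_pow, ← Complex.ofReal_mul] at h1
  rw [← h1, Complex.ofReal_re]
  field_simp

end LinearRandomField

end

/-- The coefficients `β` are a function of the cumulant sequence of the innovations and of the
coefficients `a` only: `β` is chosen before the probability space and the field. -/
theorem theorem2 (d : ℕ) (hd : 1 ≤ d) :
    ∃ β : (ℕ → ℝ) → ((Fin d → ℤ) → ℝ) → ℕ → ℕ → ℝ,
      ∀ (Ω : Type*) [MeasurableSpace Ω] (μ : Measure Ω) [IsProbabilityMeasure μ]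
        (ε : (Fin d → ℤ) → Ω → ℝ) (a : (Fin d → ℤ) → ℝ) (X : (Fin d → ℤ) → Ω → ℝ)
        (σ H C : ℝ) (L : ℂ → ℂ),
        (∀ i, Measurable (ε i)) → iIndepFun ε μ → (∀ i, IdentDistrib (ε i) (ε 0) μ μ) →
        MemLp (ε 0) 2 μ → ∫ ω, ε 0 ω ∂μ = 0 → 0 < σ → variance (ε 0) μ = σ ^ 2 →
        LinearRandomField.IsLinearField X a ε μ →
        (LinearRandomField.ShortMemory a ∨ LinearRandomField.LongMemory a) →
        0 < H → 0 < C → LinearRandomField.IsCGFOnDisc L (ε 0) μ H →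
        (∀ z ∈ Metric.ball (0 : ℂ) H, ‖L z‖ < C) →
        -- the power series `λ_n(t) = ∑ β_{kn} t^k` are bounded, uniformly in `n`, for small `|t|`
        (∃ r > 0, ∃ K : ℝ, ∀ n : ℕ, 1 ≤ n → ∀ t : ℂ, ‖t‖ < r →
          Summable (fun k => (β (LinearRandomField.cumulant (ε 0) μ) a n k : ℂ) * t ^ k) ∧
          ‖∑' k, (β (LinearRandomField.cumulant (ε 0) μ) a n k : ℂ) * t ^ k‖ ≤ K) ∧
        -- the expansion, uniformly over `0 ≤ x ≤ c_n` for every `c_n = o(n^{d/2})`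
        (∀ c : ℕ → ℝ, c =o[atTop] (fun n => LinearRandomField.rate d n) →
          ∃ K : ℝ, ∀ᶠ n in atTop, ∀ x : ℝ, 0 ≤ x → x ≤ c n →
            ∃ θ : ℝ, |θ| ≤ K * ((x + 1) / LinearRandomField.rate d n) ∧
              (1 - LinearRandomField.normDist X a σ μ n x) / (1 - LinearRandomField.Phi x) =
                Real.exp (x ^ 3 / LinearRandomField.rate d n *
                  ∑' k, β (LinearRandomField.cumulant (ε 0) μ) a n k *
                    (x / LinearRandomField.rate d n) ^ k) * (1 + θ)) := by
  refine ⟨LinearRandomField.fieldCramerCoeff, ?_⟩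
  intro Ω _ μ _ ε a X σ H C L hmeas hind hid hL2 hmean hσ hvar hX ha hH hC hL hLC
  have hmean' : ∀ i, ∫ ω, ε i ω ∂μ = 0 := fun i => (hid i).integral_eq.trans hmean
  have hvar' : ∀ i, variance (ε i) μ = σ ^ 2 := fun i => (hid i).variance_eq.trans hvar
  have hL2' : ∀ i, MemLp (ε i) 2 μ := fun i => (hid i).memLp_iff.2 hL2
  have hs : ∀ n, Summable fun j => LinearRandomField.coeffSum a n j ^ 2 := fun n =>
    LinearRandomField.summable_sq_of_tendsto hind hL2' hmean' hσ hvar'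
      (hX.aemeasurable_partialSum n) (hX.tendsto_partialSum hmeas n)
  obtain ⟨hBpos, k₀, hk₀, hk⟩ := LinearRandomField.exists_normalized_coeffSum_le hd hσ ha hs
  have hκσ : √(LinearRandomField.cumulant (ε 0) μ 2) = σ := by
    rw [hL.cumulant_two hH, hvar, Real.sqrt_sq hσ.le]
  set κ := LinearRandomField.cumulant (ε 0) μ with hκ
  set M := 64 * C / H ^ 3 with hM
  have hM0 : 0 < M := by positivity
  -- `H / 8` is the radius on which the quadratic approximation of `L` holds, and `2 k₀` comes from
  -- the weight bound and the second moments.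
  set R := H / 8 / (2 * k₀) with hR
  have hR0 : 0 < R := by positivity
  have hRH : 2 * k₀ * R = H / 8 := by rw [hR]; field_simp
  set A := M * k₀ / σ ^ 2 with hA
  have hA0 : 0 < A := by positivity
  have hquad := hL.norm_sub_sq_le hH hC hLC hmean hvar
  have hinn : LinearRandomField.IsInnovation ε (ε 0) μ L (H / 8) (σ ^ 2 / 2 + M * (H / 8)) :=
    ⟨hmeas, hind, hid, hL.mono (by linarith), by positivity,
      LinearRandomField.norm_le_of_norm_sub_sq_le hM0.le hquad⟩
  have hser : ∀ z ∈ Metric.ball (0 : ℂ) (H / 8), LinearRandomField.cgfSeries κ z = L z :=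
    fun z hz => hinn.cgf.cgfSeries_cumulant hz
  set c : ℕ → (Fin d → ℤ) → ℝ := fun n j =>
    LinearRandomField.coeffSum a n j / √(LinearRandomField.sumVar a σ n) with hc
  set E : ℕ → ℂ → ℂ := fun n =>
    LinearRandomField.scaledRemainder κ (c n) (LinearRandomField.rate d n) with hE
  have hβ : ∀ n, LinearRandomField.sumVar a σ n ≠ 0 → ∀ k,
      LinearRandomField.fieldCramerCoeff κ a n k = LinearRandomField.cramerCoeff (E n) k := by
    intro n hn k
    rw [LinearRandomField.fieldCramerCoeff, hκσ, if_neg hn]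
  have hcub : ∀ n, 1 ≤ n → LinearRandomField.sumVar a σ n ≠ 0 →
      LinearRandomField.CubicRemainder (E n) A R := by
    intro n hn hB
    refine LinearRandomField.cubicRemainder_scaledRemainder hser
      hinn.cgf.analytic.differentiableOn hM0 hσ hk₀ (LinearRandomField.rate_pos d hn) hquad
      (LinearRandomField.hasSum_normalized_coeffSum_sq hσ (hs n) hB) (hk n) hR0 ?_
    nlinarith [mul_pos hk₀ hR0]
  have hr : 0 < LinearRandomField.CubicRemainder.saddleRadius A R / 8 :=
    div_pos (lt_min (by positivity) (by positivity)) (by norm_num)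
  refine ⟨⟨_, hr, 24 * A, fun n hn t ht => ?_⟩, fun x₁ hx₁ => ?_⟩
  · by_cases hB : LinearRandomField.sumVar a σ n = 0
    · have h0 : ∀ k, LinearRandomField.fieldCramerCoeff κ a n k = 0 := fun k => by
        rw [LinearRandomField.fieldCramerCoeff, hκσ, if_pos hB]
      simp only [h0, Complex.ofReal_zero, zero_mul, tsum_zero, norm_zero]
      exact ⟨summable_zero, by positivity⟩
    · simp only [hβ n hB]
      exact ⟨(hcub n hn hB).summable_cramerCoeff ht, (hcub n hn hB).norm_tsum_cramerCoeff_le ht⟩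
  · obtain ⟨e, he, K, hK⟩ := LinearRandomField.exists_cramer_of_hasCubicCGF hA0 hR0
    refine ⟨K, ?_⟩
    -- The expansion needs `x/Δ ≤ e`; its rewriting as a power series needs `x/Δ` strictly below
    -- `saddleRadius / 8`, hence the smaller bound with `16`.
    have he' : 0 < min e (LinearRandomField.CubicRemainder.saddleRadius A R / 16) :=
      lt_min he (by linarith)
    filter_upwards [hBpos, eventually_ge_atTop 1, hx₁.bound he'] with n hB hn hxn x hx0 hx
    have hΔ := LinearRandomField.rate_pos d hn
    have hxΔ : x ≤ min e (LinearRandomField.CubicRemainder.saddleRadius A R / 16) *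
        LinearRandomField.rate d n := by
      rw [Real.norm_eq_abs, Real.norm_eq_abs, abs_of_pos hΔ] at hxn
      exact hx.trans ((le_abs_self _).trans hxn)
    have hW : AEMeasurable (fun ω => LinearRandomField.partialSum X n ω /
        √(LinearRandomField.sumVar a σ n)) μ := (hX.aemeasurable_partialSum n).div_const _
    have hlaw := hinn.hasCubicCGF_map hser
      (LinearRandomField.hasSum_normalized_coeffSum_sq hσ (hs n) hB.ne').summable hW
      (LinearRandomField.tendsto_eLpNorm_div (hX.tendsto_partialSum hmeas n) _) hΔ hk₀ (hk n)
      hRH.le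
    have hprob := Measure.isProbabilityMeasure_map hW
    obtain ⟨θ, hθ, hθx⟩ := hK (E n) (hcub n hn hB.ne') _ hΔ _ hlaw x hx0
      (hxΔ.trans (by gcongr; exact min_le_left _ _))
    refine ⟨θ, hθ, ?_⟩
    rw [LinearRandomField.one_sub_normDist (hX.aemeasurable_partialSum n) hB, hθx]
    simp only [hβ n hB.ne']
    rw [(hcub n hn hB.ne').sq_mul_legendreRemainder_re hΔ hx0]
    rw [div_lt_iff₀ hΔ]
    refine hxΔ.trans_lt (mul_lt_mul_of_pos_right ?_ hΔ)
    exact (min_le_right _ _).trans_lt (by linarith)
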